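/- Let $N\ge 2$, let $D\subset\{0,1,\dots,N-1\}^2$ with $1<|D|<N^2$, and for $i\in D$ let $\varphi_i(x)=\frac1N(x+i)$, $x\in\mathbb R^2$. Let $F=F(N,D)$ be the generalized Sierpiński carpet, i.e. the unique non-empty compact set with $F=\bigcup_{i\in D}\varphi_i(F)$. For $k\ge 1$ let $\Gamma_k$ be the $k$-th Hata graph: its vertices are the words $i_1\cdots i_k\in D^k$, and two distinct words $\mathbf i,\mathbf j$ are joined by an edge if and only if $\varphi_{\mathbf i}(F)\cap\varphi_{\mathbf j}(F)\ne\varnothing$, where $\varphi_{i_1\cdots i_k}=\varphi_{i_1}\circ\cdots\circ\varphi_{i_k}$. A cut vertex of a graph $G$ is a vertex $v$ such that the graph $G-\{v\}$, obtained by deleting $v$ and its incident edges, is disconnected. For a finite connected graph $G$ let $\chi(G)$ be the maximum, over all cut vertices $v$ of $G$, of the number of vertices of the second largest connected component of $G-\{v\}$ (component sizes being listed with multiplicity), and let $\chi(G)=0$ if $G$ has no cut vertex. A cut point of $F$ is a point $x\in F$ such that $F\setminus\{x\}$ is not connected. Suppose that $F$ is connected. Then $F$ has a cut point if and only if $$\chi(\Gamma_k)\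 \ge\ |D|^{k-1}-1\qquad\text{for every } k\ge 2 .$$ -/

import Mathlib

/-- The similarity `x ↦ (x + i) / N` of the plane that belongs to the digit `i`.
The plane is modelled by `ℝ × ℝ`; only its topology and its linear structure are used. -/
noncomputable def digitMap (N : ℕ) (i : Fin N × Fin N) (x : ℝ × ℝ) : ℝ × ℝ :=
  ((N : ℝ)⁻¹) • (x + (((i.1 : ℕ) : ℝ), ((i.2 : ℕ) : ℝ)))

/-- `K` is an attractor of the iterated function system `φ i`, `i ∈ D`: a non-empty compact set
with `K = ⋃ i ∈ D, φ i (K)`. -/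
def IsAttractor (N : ℕ) (D : Finset (Fin N × Fin N)) (K : Set (ℝ × ℝ)) : Prop :=
  K.Nonempty ∧ IsCompact K ∧ K = ⋃ i ∈ D, digitMap N i '' K

/-- The `n`-th approximation of the carpet: `Q 0 = [0,1]²`, `Q (n+1) = ⋃ i ∈ D, φ i (Q n)`. -/
noncomputable def carpetApprox (N : ℕ) (D : Finset (Fin N × Fin N)) : ℕ → Set (ℝ × ℝ)
  | 0 => Set.Icc 0 1
  | n + 1 => ⋃ i ∈ D, digitMap N i '' carpetApprox N D n

/-- The generalized Sierpiński carpet `F(N, D)`, as the intersection of its approximations.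
It is the unique attractor of the system `φ i`, `i ∈ D`: see `isAttractor_iff_eq_carpet`. -/
noncomputable def carpet (N : ℕ) (D : Finset (Fin N × Fin N)) : Set (ℝ × ℝ) :=
  ⋂ n, carpetApprox N D n

theorem digitMap_continuous (N : ℕ) (i : Fin N × Fin N) : Continuous (digitMap N i) := by
  unfold digitMap; fun_prop

theorem dist_digitMap (N : ℕ) (i : Fin N × Fin N) (x y : ℝ × ℝ) :
    dist (digitMap N i x) (digitMap N i y) = (N : ℝ)⁻¹ * dist x y := by
  unfold digitMap
  rw [dist_smul₀, dist_add_right, Real.norm_of_nonneg (by positivity)]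

theorem digitMap_injective {N : ℕ} (hN : 2 ≤ N) (i : Fin N × Fin N) :
    Function.Injective (digitMap N i) := by
  intro x y h
  have h0 : (N : ℝ)⁻¹ ≠ 0 := by positivity
  have := dist_digitMap N i x y
  rw [h, dist_self] at this
  exact dist_eq_zero.1 ((mul_eq_zero.1 this.symm).resolve_left h0)

theorem digitMap_mem_Icc {N : ℕ} (hN : 2 ≤ N) (i : Fin N × Fin N) {x : ℝ × ℝ}
    (hx : x ∈ Set.Icc (0 : ℝ × ℝ) 1) : digitMap N i x ∈ Set.Icc (0 : ℝ × ℝ) 1 := by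
  obtain ⟨⟨h1, h2⟩, h3, h4⟩ := hx
  simp only [Prod.fst_zero, Prod.snd_zero, Prod.fst_one, Prod.snd_one] at h1 h2 h3 h4
  have hN0 : (0 : ℝ) < N := by positivity
  have e1 : ((i.1 : ℕ) : ℝ) + 1 ≤ N := by exact_mod_cast i.1.isLt
  have e2 : ((i.2 : ℕ) : ℝ) + 1 ≤ N := by exact_mod_cast i.2.isLt
  refine ⟨⟨?_, ?_⟩, ?_, ?_⟩ <;> simp only [digitMap, Prod.smul_fst, Prod.smul_snd, Prod.fst_add,
    Prod.snd_add, smul_eq_mul, Prod.fst_zero, Prod.snd_zero, Prod.fst_one, Prod.snd_one]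
  · positivity
  · positivity
  · rw [inv_mul_le_iff₀ hN0]; linarith
  · rw [inv_mul_le_iff₀ hN0]; linarith

theorem carpetApprox_succ_subset {N : ℕ} (hN : 2 ≤ N) (D : Finset (Fin N × Fin N)) (n : ℕ) :
    carpetApprox N D (n + 1) ⊆ carpetApprox N D n := by
  induction n with
  | zero =>
    simp only [carpetApprox, Set.iUnion_subset_iff, Set.image_subset_iff]
    exact fun i _ x hx => digitMap_mem_Icc hN i hx
  | succ n ih =>
    rw [carpetApprox, carpetApprox]
    exact Set.iUnion₂_mono fun i _ => Set.image_mono ih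

theorem carpetApprox_isCompact (N : ℕ) (D : Finset (Fin N × Fin N)) (n : ℕ) :
    IsCompact (carpetApprox N D n) := by
  induction n with
  | zero => exact isCompact_Icc
  | succ n ih =>
    rw [carpetApprox]
    exact D.isCompact_biUnion fun i _ => ih.image (digitMap_continuous N i)

theorem carpetApprox_nonempty {N : ℕ} {D : Finset (Fin N × Fin N)} (hD : D.Nonempty) (n : ℕ) :
    (carpetApprox N D n).Nonempty := by
  induction n with
  | zero => exact ⟨0, le_refl _, zero_le_one⟩
  | succ n ih =>
    obtain ⟨x, hx⟩ := ih
    obtain ⟨i, hi⟩ := hD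
    rw [carpetApprox]
    exact ⟨digitMap N i x, Set.mem_iUnion₂.2 ⟨i, hi, x, hx, rfl⟩⟩

theorem isAttractor_carpet {N : ℕ} (hN : 2 ≤ N) {D : Finset (Fin N × Fin N)} (hD : D.Nonempty) :
    IsAttractor N D (carpet N D) := by
  have anti : Antitone (carpetApprox N D) := antitone_nat_of_succ_le (carpetApprox_succ_subset hN D)
  refine ⟨?_, ?_, ?_⟩
  · exact IsCompact.nonempty_iInter_of_sequence_nonempty_isCompact_isClosed _
      (carpetApprox_succ_subset hN D) (carpetApprox_nonempty hD) (carpetApprox_isCompact N D 0)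
      fun n => (carpetApprox_isCompact N D n).isClosed
  · exact (carpetApprox_isCompact N D 0).of_isClosed_subset
      (isClosed_iInter fun n => (carpetApprox_isCompact N D n).isClosed)
      (Set.iInter_subset _ 0)
  · apply Set.Subset.antisymm
    · intro x hx
      have hx' : ∀ n, ∃ i : D, x ∈ digitMap N i '' carpetApprox N D n := by
        intro n
        have := Set.mem_iInter.1 hx (n + 1)
        rw [carpetApprox] at this
        obtain ⟨i, hi, h⟩ := Set.mem_iUnion₂.1 this
        exact ⟨⟨i, hi⟩, h⟩
      choose f hf using hx'
      obtain ⟨i, hi⟩ := Finite.exists_infinite_fiber f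
      have hinf : (f ⁻¹' {i}).Infinite := Set.infinite_coe_iff.1 hi
      obtain ⟨m, hm⟩ := hinf.nonempty
      obtain ⟨y, -, hxy⟩ := hf m
      rw [Set.mem_preimage, Set.mem_singleton_iff] at hm
      rw [hm] at hxy
      refine Set.mem_iUnion₂.2 ⟨i, i.2, y, Set.mem_iInter.2 fun n => ?_, hxy⟩
      obtain ⟨k, hk, hnk⟩ := hinf.exists_gt n
      rw [Set.mem_preimage, Set.mem_singleton_iff] at hk
      obtain ⟨z, hz, hxz⟩ := hf k
      rw [hk, ← hxy] at hxz
      exact anti hnk.le (digitMap_injective hN _ hxz ▸ hz)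
    · refine Set.iUnion₂_subset fun i hi => ?_
      rintro _ ⟨y, hy, rfl⟩
      refine Set.mem_iInter.2 fun n => carpetApprox_succ_subset hN D n ?_
      rw [carpetApprox]
      exact Set.mem_iUnion₂.2 ⟨i, hi, y, Set.mem_iInter.1 hy n, rfl⟩

/-- Of two attractors of the same system, each one contains the other. -/
theorem IsAttractor.subset {N : ℕ} (hN : 2 ≤ N) {D : Finset (Fin N × Fin N)}
    {K L : Set (ℝ × ℝ)} (hK : IsAttractor N D K) (hL : IsAttractor N D L) : K ⊆ L := by
  obtain ⟨hKn, hKc, hKe⟩ := hK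
  obtain ⟨hLn, hLc, hLe⟩ := hL
  obtain ⟨x, hxK, hx⟩ := hKc.exists_isMaxOn hKn
    (Metric.continuous_infDist_pt L).continuousOn
  have key : Metric.infDist x L ≤ (N : ℝ)⁻¹ * Metric.infDist x L := by
    have hx' := hxK
    rw [hKe] at hx'
    obtain ⟨i, hi, y, hy, hyx⟩ := Set.mem_iUnion₂.1 hx'
    obtain ⟨z, hz, hyz⟩ := hLc.exists_infDist_eq_dist hLn y
    have hzL : digitMap N i z ∈ L := by
      rw [hLe]; exact Set.mem_iUnion₂.2 ⟨i, hi, z, hz, rfl⟩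
    calc Metric.infDist x L ≤ dist x (digitMap N i z) := Metric.infDist_le_dist_of_mem hzL
      _ = (N : ℝ)⁻¹ * Metric.infDist y L := by rw [← hyx, dist_digitMap, hyz]
      _ ≤ (N : ℝ)⁻¹ * Metric.infDist x L := by
        gcongr
        exact hx hy
  have hN2 : (N : ℝ)⁻¹ ≤ 2⁻¹ := inv_anti₀ (by norm_num) (by exact_mod_cast hN)
  have h0 : 0 ≤ Metric.infDist x L := Metric.infDist_nonneg
  have hzero : Metric.infDist x L = 0 := by nlinarith
  intro w hw
  refine (hLc.isClosed.mem_iff_infDist_zero hLn).2 (le_antisymm ?_ Metric.infDist_nonneg)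
  rw [← hzero]
  exact hx hw

/-- The carpet is the unique non-empty compact set `K` with `K = ⋃ i ∈ D, φ i (K)`. -/
theorem isAttractor_iff_eq_carpet {N : ℕ} (hN : 2 ≤ N) {D : Finset (Fin N × Fin N)}
    (hD : D.Nonempty) (K : Set (ℝ × ℝ)) : IsAttractor N D K ↔ K = carpet N D := by
  constructor
  · intro h
    exact (h.subset hN (isAttractor_carpet hN hD)).antisymm ((isAttractor_carpet hN hD).subset hN h)
  · rintro rfl
    exact isAttractor_carpet hN hD

/-- For a word `w = i₁ ⋯ i_k` over `D`, the composition `φ i₁ ∘ ⋯ ∘ φ i_k`. -/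
noncomputable def wordMap (N : ℕ) (D : Finset (Fin N × Fin N)) :
    (k : ℕ) → (Fin k → D) → ℝ × ℝ → ℝ × ℝ
  | 0, _ => id
  | k + 1, w => digitMap N (w 0) ∘ wordMap N D k (fun j => w j.succ)

/-- The `k`-th Hata graph: its vertices are the words of length `k` over `D`, and two distinct
words `v`, `w` are adjacent when the cells `φ_v(F)` and `φ_w(F)` meet. -/
def hataGraph (N : ℕ) (D : Finset (Fin N × Fin N)) (k : ℕ) : SimpleGraph (Fin k → D) where
  Adj v w := v ≠ w ∧ (wordMap N D k v '' carpet N D ∩ wordMap N D k w '' carpet N D).Nonempty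
  symm := ⟨fun _ _ h => ⟨h.1.symm, by rw [Set.inter_comm]; exact h.2⟩⟩
  loopless := ⟨fun _ h => h.1 rfl⟩

/-- `x` is a cut point of the set `X`: it lies in `X` and `X \ {x}` is not connected. -/
def IsCutPoint {E : Type*} [TopologicalSpace E] (X : Set E) (x : E) : Prop :=
  x ∈ X ∧ ¬ IsPreconnected (X \ {x})

/-- `G - {v}`: delete the vertex `v` and all edges incident with it. -/
def deleteVertex {V : Type*} (G : SimpleGraph V) (v : V) :
    SimpleGraph ({v}ᶜ : Set V) :=
  G.induce {v}ᶜ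

/-- `v` is a cut vertex of `G`: the graph `G - {v}` is disconnected. -/
def IsCutVertex {V : Type*} (G : SimpleGraph V) (v : V) : Prop :=
  ¬ (deleteVertex G v).Preconnected

open Classical in
/-- The sizes of the connected components of a finite graph (with multiplicity), in
non-increasing order. -/
noncomputable def componentSizes {V : Type*} [Fintype V] (G : SimpleGraph V) : List ℕ :=
  ((Finset.univ : Finset G.ConnectedComponent).val.map fun c => c.supp.ncard).sort (· ≥ ·)

open Classical in
/-- The largest size, over all cut vertices `v` of `G`, of the second largest connected component
of `G - {v}`; it is `0` if `G` has no cut vertex. The entry number `1` of the list of component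
sizes is the second one. -/
noncomputable def chi {V : Type*} [Fintype V] (G : SimpleGraph V) : ℕ :=
  (Finset.univ.filter fun v => IsCutVertex G v).sup
    fun v => (componentSizes (deleteVertex G v)).getD 1 0

/-! Cells of level k have diameter at most N^(-k), so a cut vertex of the Hata graph that leaves two
large components is the trace of a cut point at that scale.

Large `chi` gives a cut point (`exists_isCutPoint_of_le_chi`). Suppose that F has no cut point, and
let the cells of cut vertices with two large components accumulate at x. The cells of level 5 that
miss x are joined inside a compact part of F \ {x}, which the shrinking cells eventually miss; so
all words below them lie in one component. At most four cells of level 5 contain x, and they carry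
too few words for a second large component.

Conversely, let F have a cut point. Call F fragile if the digits split into two classes whose cells
share at most one point x (`IsFragileAt`).

In the fragile case a word whose cell contains x is deleted (`IsFragileAt.pow_sub_one_le_chi`). If
its class has a further digit, two full blocks of |D|^k words are separated. If its first letter is
alone in its class, the second large set is its own block without the deleted word, whence the -1.
The contact point needs a unique address, and in the last case the block must stay connected; if it
does not, a cut vertex of the digit graph provides another fragile splitting.

In the non-fragile case a separation of F \ {x} persists in some cell of level one
(`Separates.exists_zoom`), hence along a whole address, and an extremal choice of x makes this
address unique. If at some level the cells beside the address occur on both sides, deleting a word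
of the address separates two full blocks. Otherwise they all lie on one side at each level, and this
side changes infinitely often because cells shrink to points. Two changes produce two pinched cells,
that is, cells all of whose contacts with other cells lie in one subcell. Planar geometry
(`not_pinched_pinched`) excludes this; the only configuration that resists is N = 2 with all four
digits. -/

/-! ### Self-similarity of the carpet, word maps and cells. -/

theorem carpet_eq {N : ℕ} (hN : 2 ≤ N) {D : Finset (Fin N × Fin N)} (hD : D.Nonempty) :
    carpet N D = ⋃ i ∈ D, digitMap N i '' carpet N D :=
  (isAttractor_carpet hN hD).2.2

theorem exists_digitMap_eq {N : ℕ} (hN : 2 ≤ N) {D : Finset (Fin N × Fin N)} (hD : D.Nonempty)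
    {y : ℝ × ℝ} (hy : y ∈ carpet N D) : ∃ i ∈ D, ∃ z ∈ carpet N D, digitMap N i z = y := by
  rw [carpet_eq hN hD] at hy
  simpa using hy

theorem digitMap_mem_carpet {N : ℕ} (hN : 2 ≤ N) {D : Finset (Fin N × Fin N)}
    {i : Fin N × Fin N} (hi : i ∈ D) {z : ℝ × ℝ} (hz : z ∈ carpet N D) :
    digitMap N i z ∈ carpet N D := by
  rw [carpet_eq hN ⟨i, hi⟩]
  exact Set.mem_iUnion₂.2 ⟨i, hi, z, hz, rfl⟩

theorem carpet_subset_Icc (N : ℕ) (D : Finset (Fin N × Fin N)) :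
    carpet N D ⊆ Set.Icc 0 1 :=
  Set.iInter_subset _ 0

theorem isCompact_carpet (N : ℕ) (D : Finset (Fin N × Fin N)) : IsCompact (carpet N D) :=
  (carpetApprox_isCompact N D 0).of_isClosed_subset
    (isClosed_iInter fun n => (carpetApprox_isCompact N D n).isClosed) (Set.iInter_subset _ 0)

/-- A point of the unit square that is fixed by a digit map belongs to the carpet. -/
theorem mem_carpet_of_fixed {N : ℕ} {D : Finset (Fin N × Fin N)} {i : Fin N × Fin N}
    (hi : i ∈ D) {p : ℝ × ℝ} (hp : p ∈ Set.Icc (0 : ℝ × ℝ) 1) (hfix : digitMap N i p = p) :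
    p ∈ carpet N D := by
  refine Set.mem_iInter.2 fun n => ?_
  induction n with
  | zero => exact hp
  | succ n ih => exact Set.mem_iUnion₂.2 ⟨i, hi, p, ih, hfix⟩

theorem wordMap_succ (N : ℕ) (D : Finset (Fin N × Fin N)) (k : ℕ) (w : Fin (k + 1) → D)
    (x : ℝ × ℝ) :
    wordMap N D (k + 1) w x = digitMap N (w 0) (wordMap N D k (Fin.tail w) x) := rfl

theorem wordMap_continuous (N : ℕ) (D : Finset (Fin N × Fin N)) (k : ℕ) (w : Fin k → D) :
    Continuous (wordMap N D k w) := by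
  induction k with
  | zero => exact continuous_id
  | succ k ih => exact (digitMap_continuous N _).comp (ih _)

theorem dist_wordMap (N : ℕ) (D : Finset (Fin N × Fin N)) (k : ℕ) (w : Fin k → D)
    (x y : ℝ × ℝ) :
    dist (wordMap N D k w x) (wordMap N D k w y) = ((N : ℝ)⁻¹) ^ k * dist x y := by
  induction k with
  | zero => simp [wordMap]
  | succ k ih => rw [wordMap_succ, wordMap_succ, dist_digitMap, ih, pow_succ]; ring

/-- The cell `φ_w(F)` of a word `w`. -/
noncomputable def cell (N : ℕ) (D : Finset (Fin N × Fin N)) (k : ℕ) (w : Fin k → D) :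
    Set (ℝ × ℝ) :=
  wordMap N D k w '' carpet N D

theorem hataGraph_adj {N : ℕ} {D : Finset (Fin N × Fin N)} {k : ℕ} {v w : Fin k → D} :
    (hataGraph N D k).Adj v w ↔ v ≠ w ∧ (cell N D k v ∩ cell N D k w).Nonempty := Iff.rfl

theorem cell_zero (N : ℕ) (D : Finset (Fin N × Fin N)) (w : Fin 0 → D) :
    cell N D 0 w = carpet N D := by
  simp [cell, wordMap]

theorem cell_succ (N : ℕ) (D : Finset (Fin N × Fin N)) (k : ℕ) (w : Fin (k + 1) → D) :
    cell N D (k + 1) w = digitMap N (w 0) '' cell N D k (Fin.tail w) := by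
  rw [cell, cell, Set.image_image]
  rfl

theorem cell_cons (N : ℕ) (D : Finset (Fin N × Fin N)) (k : ℕ) (i : D) (u : Fin k → D) :
    cell N D (k + 1) (Fin.cons i u) = digitMap N i '' cell N D k u := by
  rw [cell_succ]; simp

theorem isCompact_cell (N : ℕ) (D : Finset (Fin N × Fin N)) (k : ℕ) (w : Fin k → D) :
    IsCompact (cell N D k w) :=
  (isCompact_carpet N D).image (wordMap_continuous N D k w)

theorem isConnected_cell {N : ℕ} {D : Finset (Fin N × Fin N)} (hF : IsConnected (carpet N D))
    (k : ℕ) (w : Fin k → D) : IsConnected (cell N D k w) :=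
  hF.image _ (wordMap_continuous N D k w).continuousOn

theorem cell_subset_carpet {N : ℕ} (hN : 2 ≤ N) (D : Finset (Fin N × Fin N)) (k : ℕ)
    (w : Fin k → D) : cell N D k w ⊆ carpet N D := by
  induction k with
  | zero => rw [cell_zero]
  | succ k ih =>
    rw [cell_succ]
    rintro _ ⟨y, hy, rfl⟩
    exact digitMap_mem_carpet hN (w 0).2 (ih _ hy)

theorem exists_mem_cell {N : ℕ} (hN : 2 ≤ N) {D : Finset (Fin N × Fin N)} (hD : D.Nonempty)
    (k : ℕ) {y : ℝ × ℝ} (hy : y ∈ carpet N D) : ∃ w : Fin k → D, y ∈ cell N D k w := by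
  induction k generalizing y with
  | zero => exact ⟨Fin.elim0, by rwa [cell_zero]⟩
  | succ k ih =>
    obtain ⟨i, hi, z, hz, rfl⟩ := exists_digitMap_eq hN hD hy
    obtain ⟨u, hu⟩ := ih hz
    exact ⟨Fin.cons ⟨i, hi⟩ u, by rw [cell_cons]; exact ⟨z, hu, rfl⟩⟩

theorem dist_le_of_mem_cell {N : ℕ} {D : Finset (Fin N × Fin N)} {k : ℕ} {w : Fin k → D}
    {y z : ℝ × ℝ} (hy : y ∈ cell N D k w) (hz : z ∈ cell N D k w) :
    dist y z ≤ ((N : ℝ)⁻¹) ^ k := by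
  obtain ⟨a, ha, rfl⟩ := hy
  obtain ⟨b, hb, rfl⟩ := hz
  rw [dist_wordMap]
  refine mul_le_of_le_one_right (by positivity) ?_
  obtain ⟨⟨h1, h2⟩, h3, h4⟩ := carpet_subset_Icc N D ha
  obtain ⟨⟨h5, h6⟩, h7, h8⟩ := carpet_subset_Icc N D hb
  simp only [Prod.fst_zero, Prod.snd_zero, Prod.fst_one, Prod.snd_one] at *
  rw [Prod.dist_eq, Real.dist_eq, Real.dist_eq]
  exact max_le (abs_le.2 ⟨by linarith, by linarith⟩) (abs_le.2 ⟨by linarith, by linarith⟩)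

theorem tendsto_inv_pow {N : ℕ} (hN : 2 ≤ N) :
    Filter.Tendsto (fun k : ℕ => ((N : ℝ)⁻¹) ^ k) Filter.atTop (nhds 0) :=
  tendsto_pow_atTop_nhds_zero_of_lt_one (by positivity)
    (inv_lt_one_of_one_lt₀ (by exact_mod_cast hN))

/-! ### Coordinates up to the symmetries of the square. -/

/-- A coordinate system of the plane that is adapted to the digit maps: up to symmetries of the
square, `κ` and `τ` are the two coordinates of a point, and `kd`, `td` those of a digit. -/
structure Chart (N : ℕ) where
  κ : ℝ × ℝ → ℝ
  τ : ℝ × ℝ → ℝ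
  kd : Fin N × Fin N → ℕ
  td : Fin N × Fin N → ℕ
  κ_map : ∀ i y, (N : ℝ) * κ (digitMap N i y) = kd i + κ y
  τ_map : ∀ i y, (N : ℝ) * τ (digitMap N i y) = td i + τ y
  κ_nonneg : ∀ y ∈ Set.Icc (0 : ℝ × ℝ) 1, 0 ≤ κ y
  κ_le : ∀ y ∈ Set.Icc (0 : ℝ × ℝ) 1, κ y ≤ 1
  τ_nonneg : ∀ y ∈ Set.Icc (0 : ℝ × ℝ) 1, 0 ≤ τ y
  τ_le : ∀ y ∈ Set.Icc (0 : ℝ × ℝ) 1, τ y ≤ 1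
  kd_lt : ∀ i, kd i < N
  td_lt : ∀ i, td i < N
  ext_point : ∀ y z, κ y = κ z → τ y = τ z → y = z
  ext_digit : ∀ i j, kd i = kd j → td i = td j → i = j

namespace Chart

/-- The standard coordinates. -/
noncomputable def std {N : ℕ} (hN : 2 ≤ N) : Chart N where
  κ := Prod.fst
  τ := Prod.snd
  kd i := i.1
  td i := i.2
  κ_map i y := by
    have : (N : ℝ) ≠ 0 := by positivity
    simp only [digitMap, Prod.smul_fst, Prod.fst_add, smul_eq_mul]; field_simp; ring
  τ_map i y := by
    have : (N : ℝ) ≠ 0 := by positivity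
    simp only [digitMap, Prod.smul_snd, Prod.snd_add, smul_eq_mul]; field_simp; ring
  κ_nonneg y hy := hy.1.1
  κ_le y hy := hy.2.1
  τ_nonneg y hy := hy.1.2
  τ_le y hy := hy.2.2
  kd_lt i := i.1.isLt
  td_lt i := i.2.isLt
  ext_point y z h h' := Prod.ext h h'
  ext_digit i j h h' := Prod.ext (Fin.ext h) (Fin.ext h')

/-- Exchange the two coordinates. -/
def swap {N : ℕ} (C : Chart N) : Chart N where
  κ := C.τ
  τ := C.κ
  kd := C.td
  td := C.kd
  κ_map := C.τ_map
  τ_map := C.κ_map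
  κ_nonneg := C.τ_nonneg
  κ_le := C.τ_le
  τ_nonneg := C.κ_nonneg
  τ_le := C.κ_le
  kd_lt := C.td_lt
  td_lt := C.kd_lt
  ext_point y z h h' := C.ext_point y z h' h
  ext_digit i j h h' := C.ext_digit i j h' h

/-- Reverse the first coordinate. -/
def flip {N : ℕ} (C : Chart N) : Chart N where
  κ y := 1 - C.κ y
  τ := C.τ
  kd i := N - 1 - C.kd i
  td := C.td
  κ_map i y := by
    have h := C.kd_lt i
    have h2 : ((N - 1 - C.kd i : ℕ) : ℝ) = N - 1 - C.kd i := by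
      rw [Nat.cast_sub (by omega), Nat.cast_sub (by omega)]; simp
    rw [h2, mul_sub, C.κ_map]; ring
  τ_map := C.τ_map
  κ_nonneg y hy := by linarith [C.κ_le y hy]
  κ_le y hy := by linarith [C.κ_nonneg y hy]
  τ_nonneg := C.τ_nonneg
  τ_le := C.τ_le
  kd_lt i := by have := C.kd_lt i; omega
  td_lt := C.td_lt
  ext_point y z h h' := C.ext_point y z (by linarith) h'
  ext_digit i j h h' := C.ext_digit i j
    (by have := C.kd_lt i; have := C.kd_lt j; omega) h'

/-- Reverse the second coordinate. -/
def flipSnd {N : ℕ} (C : Chart N) : Chart N := C.swap.flip.swap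

/-- The first coordinate of the lower left corner of the cell of a word, in units of `N⁻¹ ^ k`. -/
def kw {N : ℕ} {D : Finset (Fin N × Fin N)} (C : Chart N) : (k : ℕ) → (Fin k → D) → ℕ
  | 0, _ => 0
  | k + 1, w => C.kd (w 0) * N ^ k + kw C k (Fin.tail w)

theorem kw_lt {N : ℕ} {D : Finset (Fin N × Fin N)} (C : Chart N) (k : ℕ) (w : Fin k → D) :
    C.kw k w < N ^ k := by
  induction k with
  | zero => simp [kw]
  | succ k ih =>
    have h1 := ih (Fin.tail w)
    have h2 : C.kd (w 0) + 1 ≤ N := C.kd_lt (w 0)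
    calc C.kd (w 0) * N ^ k + C.kw k (Fin.tail w) < C.kd (w 0) * N ^ k + N ^ k := by omega
      _ = (C.kd (w 0) + 1) * N ^ k := by ring
      _ ≤ N * N ^ k := Nat.mul_le_mul_right _ h2
      _ = N ^ (k + 1) := by ring

theorem κ_wordMap {N : ℕ} {D : Finset (Fin N × Fin N)} (C : Chart N) (k : ℕ) (w : Fin k → D)
    (y : ℝ × ℝ) : (N : ℝ) ^ k * C.κ (wordMap N D k w y) = C.kw k w + C.κ y := by
  induction k with
  | zero => simp [kw, wordMap]
  | succ k ih =>
    rw [wordMap_succ, pow_succ, mul_assoc, C.κ_map, mul_add, ih, kw]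
    push_cast; ring

theorem word_ext {N : ℕ} {D : Finset (Fin N × Fin N)} (C : Chart N) {k : ℕ} {v w : Fin k → D}
    (h : C.kw k v = C.kw k w) (h' : C.swap.kw k v = C.swap.kw k w) : v = w := by
  induction k with
  | zero => exact Subsingleton.elim _ _
  | succ k ih =>
    have key : ∀ a b a' b' m : ℕ, b < m → b' < m → a * m + b = a' * m + b' →
        a = a' ∧ b = b' := by
      intro a b a' b' m hb hb' he
      have hm : 0 < m := by omega
      have h1 : (a * m + b) / m = a := by
        rw [mul_comm, Nat.mul_add_div hm, Nat.div_eq_of_lt hb, add_zero]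
      have h2 : (a' * m + b') / m = a' := by
        rw [mul_comm, Nat.mul_add_div hm, Nat.div_eq_of_lt hb', add_zero]
      have h3 : a = a' := by rw [← h1, ← h2, he]
      subst h3
      exact ⟨rfl, by omega⟩
    obtain ⟨h1, h2⟩ := key _ _ _ _ _ (C.kw_lt k _) (C.kw_lt k _) h
    obtain ⟨h3, h4⟩ := key _ _ _ _ _ (C.swap.kw_lt k _) (C.swap.kw_lt k _) h'
    have h5 : v 0 = w 0 := Subtype.ext (C.ext_digit _ _ h1 h3)
    rw [← Fin.cons_self_tail v, ← Fin.cons_self_tail w, h5, ih h2 h4]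

end Chart

/-- Two unit intervals with integer endpoints meet only if they are equal or adjacent. -/
theorem nat_add_unit_cases {a b : ℕ} {s t : ℝ} (hs : 0 ≤ s) (hs' : s ≤ 1) (ht : 0 ≤ t)
    (ht' : t ≤ 1) (h : (a : ℝ) + s = b + t) :
    (a = b ∧ s = t) ∨ (b = a + 1 ∧ s = 1 ∧ t = 0) ∨ (a = b + 1 ∧ s = 0 ∧ t = 1) := by
  rcases lt_trichotomy a b with hab | hab | hab
  · have h1 : (a : ℝ) + 1 ≤ b := by exact_mod_cast hab
    have h2 : (b : ℝ) = a + 1 := by linarith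
    exact Or.inr (Or.inl ⟨by exact_mod_cast h2, by linarith, by linarith⟩)
  · subst hab; exact Or.inl ⟨rfl, by linarith⟩
  · have h1 : (b : ℝ) + 1 ≤ a := by exact_mod_cast hab
    have h2 : (a : ℝ) = b + 1 := by linarith
    exact Or.inr (Or.inr ⟨by exact_mod_cast h2, by linarith, by linarith⟩)

namespace Chart

theorem digit_cases {N : ℕ} {D : Finset (Fin N × Fin N)} (C : Chart N) {i j : Fin N × Fin N}
    {y z : ℝ × ℝ} (hy : y ∈ carpet N D) (hz : z ∈ carpet N D)
    (h : digitMap N i y = digitMap N j z) :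
    (C.kd i = C.kd j ∧ C.κ y = C.κ z) ∨ (C.kd j = C.kd i + 1 ∧ C.κ y = 1 ∧ C.κ z = 0) ∨
      (C.kd i = C.kd j + 1 ∧ C.κ y = 0 ∧ C.κ z = 1) := by
  have hy := carpet_subset_Icc N D hy
  have hz := carpet_subset_Icc N D hz
  exact nat_add_unit_cases (C.κ_nonneg y hy) (C.κ_le y hy) (C.κ_nonneg z hz) (C.κ_le z hz)
    (by rw [← C.κ_map, ← C.κ_map, h])

theorem word_cases {N : ℕ} {D : Finset (Fin N × Fin N)} (C : Chart N) {k : ℕ} {v w : Fin k → D}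
    {y z : ℝ × ℝ} (hy : y ∈ carpet N D) (hz : z ∈ carpet N D)
    (h : wordMap N D k v y = wordMap N D k w z) :
    (C.kw k v = C.kw k w ∧ C.κ y = C.κ z) ∨
      (C.kw k w = C.kw k v + 1 ∧ C.κ y = 1 ∧ C.κ z = 0) ∨
      (C.kw k v = C.kw k w + 1 ∧ C.κ y = 0 ∧ C.κ z = 1) := by
  have hy := carpet_subset_Icc N D hy
  have hz := carpet_subset_Icc N D hz
  exact nat_add_unit_cases (C.κ_nonneg y hy) (C.κ_le y hy) (C.κ_nonneg z hz) (C.κ_le z hz)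
    (by rw [← C.κ_wordMap, ← C.κ_wordMap, h])

theorem digitMap_eq_digitMap {N : ℕ} (hN : 2 ≤ N) (C : Chart N) {i j : Fin N × Fin N}
    {y z : ℝ × ℝ} (h : C.kd i + C.κ y = C.kd j + C.κ z) (h' : C.td i + C.τ y = C.td j + C.τ z) :
    digitMap N i y = digitMap N j z := by
  have hN0 : (N : ℝ) ≠ 0 := by positivity
  exact C.ext_point _ _ (mul_left_cancel₀ hN0 (by rw [C.κ_map, C.κ_map, h]))
    (mul_left_cancel₀ hN0 (by rw [C.τ_map, C.τ_map, h']))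

end Chart

/-! ### Paths avoiding a vertex, closed covers, and the size of the second component. -/

/-- `u` and `v` are joined by a path of `G` that avoids the vertex `w`. -/
def AvoidReach {V : Type*} (G : SimpleGraph V) (w u v : V) : Prop :=
  ∃ (hu : u ∈ ({w}ᶜ : Set V)) (hv : v ∈ ({w}ᶜ : Set V)),
    (deleteVertex G w).Reachable ⟨u, hu⟩ ⟨v, hv⟩

theorem AvoidReach.symm {V : Type*} {G : SimpleGraph V} {w u v : V} (h : AvoidReach G w u v) :
    AvoidReach G w v u := by
  obtain ⟨hu, hv, h⟩ := h
  exact ⟨hv, hu, h.symm⟩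

theorem AvoidReach.trans {V : Type*} {G : SimpleGraph V} {w u v x : V}
    (h : AvoidReach G w u v) (h' : AvoidReach G w v x) : AvoidReach G w u x := by
  obtain ⟨hu, hv, h⟩ := h
  obtain ⟨_, hx, h'⟩ := h'
  exact ⟨hu, hx, h.trans h'⟩

theorem AvoidReach.refl {V : Type*} {G : SimpleGraph V} {w u : V} (h : u ≠ w) :
    AvoidReach G w u u := ⟨h, h, SimpleGraph.Reachable.refl _⟩

theorem AvoidReach.of_adj {V : Type*} {G : SimpleGraph V} {w u v : V} (hu : u ≠ w) (hv : v ≠ w)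
    (h : G.Adj u v) : AvoidReach G w u v :=
  ⟨hu, hv, SimpleGraph.Adj.reachable (G := deleteVertex G w) (u := ⟨u, hu⟩) (v := ⟨v, hv⟩) h⟩

/-- A property that passes from a vertex to its neighbours passes along paths. -/
theorem SimpleGraph.Reachable.induct_mem {V : Type*} {G : SimpleGraph V} {S : Set V}
    (hS : ∀ u v, G.Adj u v → u ∈ S → v ∈ S) {u v : V} (h : G.Reachable u v) (hu : u ∈ S) :
    v ∈ S := by
  obtain ⟨p⟩ := h
  induction p with
  | nil => exact hu
  | cons hadj _ ih => exact ih (hS _ _ hadj hu)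

/-- The tool for proving separation: a set that is closed under adjacency off `w` and contains `u`
but not `v` rules out a path between them. -/
theorem AvoidReach.mem {V : Type*} {G : SimpleGraph V} {w : V} {S : Set V}
    (hS : ∀ u v, u ≠ w → v ≠ w → G.Adj u v → u ∈ S → v ∈ S) {u v : V} (h : AvoidReach G w u v)
    (hu : u ∈ S) : v ∈ S := by
  obtain ⟨hu', hv', h⟩ := h
  exact h.induct_mem (S := {x : ({w}ᶜ : Set V) | (x : V) ∈ S}) (fun a b hab ha => hS a b a.2 b.2 hab ha) hu

/-- If a preconnected set is covered by finitely many closed sets, then those which meet it are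
joined in the intersection graph. -/
theorem reachable_of_cover {V X : Type*} [Finite V] [TopologicalSpace X] (G : SimpleGraph V)
    (K : V → Set X) (hK : ∀ v, IsClosed (K v))
    (hadj : ∀ u v, u ≠ v → (K u ∩ K v).Nonempty → G.Adj u v) {C : Set X} (hC : IsPreconnected C)
    (hcov : C ⊆ ⋃ v, K v) {u v : V} (hu : (C ∩ K u).Nonempty) (hv : (C ∩ K v).Nonempty) :
    G.Reachable u v := by
  by_contra huv
  have hcl : ∀ S : Set V, IsClosed (⋃ a ∈ S, K a) := fun S =>
    S.toFinite.isClosed_biUnion fun a _ => hK a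
  let S : Set V := {a | G.Reachable u a}
  have := isPreconnected_closed_iff.1 hC _ _ (hcl S) (hcl Sᶜ)
    (fun x hx => by
      obtain ⟨a, ha⟩ := Set.mem_iUnion.1 (hcov hx)
      by_cases h : a ∈ S
      · exact Or.inl (Set.mem_biUnion h ha)
      · exact Or.inr (Set.mem_biUnion (show a ∈ Sᶜ from h) ha))
    (hu.mono (Set.inter_subset_inter_right _
      (Set.subset_biUnion_of_mem (u := K) (show u ∈ S from SimpleGraph.Reachable.refl _))))
    (hv.mono (Set.inter_subset_inter_right _
      (Set.subset_biUnion_of_mem (u := K) (show v ∈ Sᶜ from huv))))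
  obtain ⟨x, -, h1, h2⟩ := this
  obtain ⟨a, ha, hxa⟩ := Set.mem_iUnion₂.1 h1
  obtain ⟨b, hb, hxb⟩ := Set.mem_iUnion₂.1 h2
  have hab : a ≠ b := fun h => hb (h ▸ ha)
  exact hb (ha.trans (hadj a b hab ⟨x, hxa, hxb⟩).reachable)

theorem avoidReach_of_cover {V X : Type*} [Finite V] [TopologicalSpace X] (G : SimpleGraph V)
    (K : V → Set X) (hK : ∀ v, IsClosed (K v))
    (hadj : ∀ u v, u ≠ v → (K u ∩ K v).Nonempty → G.Adj u v) {C : Set X} (hC : IsPreconnected C)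
    (hcov : C ⊆ ⋃ v, K v) {w : V} (hw : Disjoint C (K w)) {u v : V}
    (hu : (C ∩ K u).Nonempty) (hv : (C ∩ K v).Nonempty) : AvoidReach G w u v := by
  have hne : ∀ a, (C ∩ K a).Nonempty → a ≠ w := by
    rintro a ha rfl
    exact (Set.disjoint_iff_inter_eq_empty.1 hw ▸ ha).ne_empty rfl
  refine ⟨hne u hu, hne v hv, ?_⟩
  refine reachable_of_cover _ (fun a : ({w}ᶜ : Set V) => K a) (fun a => hK a)
    (fun a b hab h => hadj a b (fun h => hab (Subtype.ext h)) h) hC ?_ hu hv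
  intro x hx
  obtain ⟨a, ha⟩ := Set.mem_iUnion.1 (hcov hx)
  exact Set.mem_iUnion.2 ⟨⟨a, hne a ⟨x, hx, ha⟩⟩, ha⟩

/-- The second largest entry of a multiset is at least `m` if and only if at least two entries are. -/
theorem le_getD_one_sort_iff (s : Multiset ℕ) {m : ℕ} (hm : 0 < m) :
    m ≤ (s.sort (· ≥ ·)).getD 1 0 ↔ 2 ≤ s.countP (m ≤ ·) := by
  have h1 : s.countP (m ≤ ·) = (s.sort (· ≥ ·)).countP (m ≤ ·) := by
    conv_lhs => rw [← Multiset.sort_eq s (· ≥ ·)]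
    rw [Multiset.coe_countP]
  have h2 : (s.sort (· ≥ ·)).Pairwise (· ≥ ·) := Multiset.pairwise_sort s (· ≥ ·)
  rw [h1]
  generalize s.sort (· ≥ ·) = l at h2
  match l, h2 with
  -- With fewer than two entries the default value `0` is below `m`, as `m` is positive.
  | [], _ => simp; omega
  | [a], _ =>
    simp only [List.getD_cons_succ, List.getD_nil, List.countP_cons, List.countP_nil]
    split_ifs <;> omega
  | a :: b :: t, h2 =>
    rw [List.pairwise_cons, List.pairwise_cons] at h2
    have hab : b ≤ a := h2.1 b (by simp)
    simp only [List.getD_cons_succ, List.getD_cons_zero, List.countP_cons, decide_eq_true_eq]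
    constructor
    · intro h
      rw [if_pos h, if_pos (h.trans hab)]
      omega
    · intro h
      by_contra hb
      have ht : t.countP (m ≤ ·) = 0 := by
        rw [List.countP_eq_zero]
        intro c hc
        have := h2.2.1 c hc
        simp only [decide_eq_true_eq]
        omega
      rw [ht, if_neg hb] at h
      split_ifs at h <;> omega

theorem le_componentSizes_iff {V : Type*} [Fintype V] (G : SimpleGraph V) {m : ℕ} (hm : 0 < m) :
    m ≤ (componentSizes G).getD 1 0 ↔
      ∃ c c' : G.ConnectedComponent, c ≠ c' ∧ m ≤ c.supp.ncard ∧ m ≤ c'.supp.ncard := by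
  classical
  rw [componentSizes, le_getD_one_sort_iff _ hm, Multiset.countP_map]
  rw [← Finset.filter_val, Finset.card_val, ← Nat.lt_iff_add_one_le, Finset.one_lt_card]
  simp only [Finset.mem_filter, Finset.mem_univ, true_and]
  constructor
  · rintro ⟨c, hc, c', hc', h⟩; exact ⟨c, c', h, hc, hc'⟩
  · rintro ⟨c, c', h, hc, hc'⟩; exact ⟨c, hc, c', hc', h⟩

/-- Two large vertex sets that are separated by a vertex bound `chi` from below. -/
theorem le_chi {V : Type*} [Fintype V] (G : SimpleGraph V) (w : V) {C C' : Set V} {m : ℕ}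
    (hm : m ≤ C.ncard) (hm' : m ≤ C'.ncard)
    (hC : ∀ u ∈ C, ∀ v ∈ C, AvoidReach G w u v) (hC' : ∀ u ∈ C', ∀ v ∈ C', AvoidReach G w u v)
    (hCC : ∀ u ∈ C, ∀ v ∈ C', ¬ AvoidReach G w u v) : m ≤ chi G := by
  classical
  rcases Nat.eq_zero_or_pos m with rfl | hpos
  · exact Nat.zero_le _
  have large : ∀ E : Set V, m ≤ E.ncard → (∀ u ∈ E, ∀ v ∈ E, AvoidReach G w u v) →
      ∃ u ∈ E, ∃ hu : u ∈ ({w}ᶜ : Set V),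
        m ≤ ((deleteVertex G w).connectedComponentMk ⟨u, hu⟩).supp.ncard := by
    intro E hE h
    obtain ⟨u, hu⟩ : E.Nonempty := by
      rw [← Set.ncard_pos]; omega
    obtain ⟨hu', -, -⟩ := h u hu u hu
    refine ⟨u, hu, hu', hE.trans ?_⟩
    rw [← Set.ncard_image_of_injective _ Subtype.val_injective]
    refine Set.ncard_le_ncard ?_
    intro v hv
    obtain ⟨hv', _, h3⟩ := h v hv u hu
    exact ⟨⟨v, hv'⟩, SimpleGraph.ConnectedComponent.sound h3, rfl⟩
  obtain ⟨u, hu, hu', h1⟩ := large C hm hC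
  obtain ⟨v, hv, hv', h2⟩ := large C' hm' hC'
  have hne : ¬ (deleteVertex G w).Reachable ⟨u, hu'⟩ ⟨v, hv'⟩ :=
    fun h => hCC u hu v hv ⟨hu', hv', h⟩
  have h3 : m ≤ (componentSizes (deleteVertex G w)).getD 1 0 :=
    (le_componentSizes_iff _ hpos).2
      ⟨_, _, fun h => hne (SimpleGraph.ConnectedComponent.exact h), h1, h2⟩
  refine h3.trans ?_
  rw [chi]
  exact Finset.le_sup (f := fun v => (componentSizes (deleteVertex G v)).getD 1 0)
    (Finset.mem_filter.2 ⟨Finset.mem_univ _, fun h => hne (h _ _)⟩)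

theorem exists_components_of_le_chi {V : Type*} [Fintype V] (G : SimpleGraph V) {m : ℕ}
    (hpos : 0 < m) (h : m ≤ chi G) :
    ∃ (w : V) (c c' : (deleteVertex G w).ConnectedComponent),
      c ≠ c' ∧ m ≤ c.supp.ncard ∧ m ≤ c'.supp.ncard := by
  classical
  rw [chi, Finset.le_sup_iff hpos] at h
  obtain ⟨w, -, hw⟩ := h
  obtain ⟨c, c', h⟩ := (le_componentSizes_iff _ hpos).1 hw
  exact ⟨w, c, c', h⟩

/-! ### Blocks of the Hata graph and lower bounds for `chi`. -/

/-- The Hata graph of a connected carpet is connected. -/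
theorem hataGraph_preconnected {N : ℕ} (hN : 2 ≤ N) {D : Finset (Fin N × Fin N)}
    (hD : D.Nonempty) (hF : IsConnected (carpet N D)) (k : ℕ) :
    (hataGraph N D k).Preconnected := by
  intro u v
  have hne : ∀ w : Fin k → D, (carpet N D ∩ cell N D k w).Nonempty := fun w => by
    rw [Set.inter_eq_right.2 (cell_subset_carpet hN D k w)]
    exact (isConnected_cell hF k w).nonempty
  refine reachable_of_cover (hataGraph N D k) (cell N D k) (fun w => (isCompact_cell N D k w).isClosed)
    (fun a b hab h => ⟨hab, h⟩) hF.isPreconnected ?_ (hne u) (hne v)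
  intro x hx
  exact Set.mem_iUnion.2 (exists_mem_cell hN hD k hx)

theorem hataGraph_adj_cons {N : ℕ} {D : Finset (Fin N × Fin N)} {k : ℕ} (i : D)
    {u v : Fin k → D} (h : (hataGraph N D k).Adj u v) :
    (hataGraph N D (k + 1)).Adj (Fin.cons i u : Fin (k + 1) → D) (Fin.cons i v) := by
  rw [hataGraph_adj] at h ⊢
  refine ⟨fun h' => h.1 (Fin.cons_right_injective (α := fun _ => (D : Type)) i h'), ?_⟩
  obtain ⟨x, hx, hx'⟩ := h.2
  rw [cell_cons, cell_cons]
  exact ⟨digitMap N i x, ⟨x, hx, rfl⟩, ⟨x, hx', rfl⟩⟩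

/-- The block of words with first letter `i` contains a copy of a connected Hata graph, and `w` lies
in another block. -/
theorem avoidReach_cons {N : ℕ} (hN : 2 ≤ N) {D : Finset (Fin N × Fin N)}
    (hD : D.Nonempty) (hF : IsConnected (carpet N D)) {k : ℕ} {w : Fin (k + 1) → D} {i : D}
    (hi : i ≠ w 0) (u v : Fin k → D) :
    AvoidReach (hataGraph N D (k + 1)) w (Fin.cons i u) (Fin.cons i v) := by
  have hne : ∀ u : Fin k → D, (Fin.cons i u : Fin (k + 1) → D) ≠ w := by
    rintro u rfl; exact hi (by simp)
  refine (hataGraph_preconnected hN hD hF k u v).induct_mem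
    (S := {a | AvoidReach (hataGraph N D (k + 1)) w (Fin.cons i u) (Fin.cons i a)}) ?_
    (AvoidReach.refl (hne u))
  intro a b hab ha
  exact ha.trans (AvoidReach.of_adj (hne a) (hne b) (hataGraph_adj_cons i hab))

theorem avoidReach_of_head_eq {N : ℕ} (hN : 2 ≤ N) {D : Finset (Fin N × Fin N)}
    (hD : D.Nonempty) (hF : IsConnected (carpet N D)) {k : ℕ} {w u v : Fin (k + 1) → D}
    (hu : u 0 ≠ w 0) (huv : v 0 = u 0) : AvoidReach (hataGraph N D (k + 1)) w u v := by
  rw [← Fin.cons_self_tail u, ← Fin.cons_self_tail v, huv]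
  exact avoidReach_cons hN hD hF hu _ _

theorem avoidReach_cons_of_avoidReach {N : ℕ} {D : Finset (Fin N × Fin N)} {k : ℕ}
    {i : D} {w u v : Fin k → D} (h : AvoidReach (hataGraph N D k) w u v) :
    AvoidReach (hataGraph N D (k + 1)) (Fin.cons i w) (Fin.cons i u) (Fin.cons i v) := by
  have hinj := Fin.cons_right_injective (α := fun _ : Fin (k + 1) => (D : Type)) i
  refine (h.mem (S := {a | a ≠ w ∧ AvoidReach (hataGraph N D (k + 1)) (Fin.cons i w)
    (Fin.cons i u) (Fin.cons i a)}) ?_ ⟨h.1, AvoidReach.refl (hinj.ne h.1)⟩).2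
  rintro a b ha hb hab ⟨-, h'⟩
  exact ⟨hb, h'.trans (AvoidReach.of_adj (hinj.ne ha) (hinj.ne hb) (hataGraph_adj_cons i hab))⟩

theorem ncard_head_eq {A : Type*} [Fintype A] (k : ℕ) (i : A) :
    {u : Fin (k + 1) → A | u 0 = i}.ncard = Fintype.card A ^ k := by
  have : {u : Fin (k + 1) → A | u 0 = i} =
      (fun u : Fin k → A => (Fin.cons i u : Fin (k + 1) → A)) '' Set.univ := by
    ext u
    simp only [Set.mem_ofPred_eq, Set.image_univ, Set.mem_range]
    constructor
    · rintro rfl; exact ⟨Fin.tail u, Fin.cons_self_tail u⟩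
    · rintro ⟨v, rfl⟩; simp
  rw [this, Set.ncard_image_of_injective _ (Fin.cons_right_injective (α := fun _ => A) i),
    Set.ncard_univ, Nat.card_eq_fintype_card]
  simp

/-- The blocks of `p` and `p'` do not contain `w`, so each of them stays connected with all its
|D|^k words. -/
theorem pow_le_chi_of_separation {N : ℕ} (hN : 2 ≤ N) {D : Finset (Fin N × Fin N)}
    (hF : IsConnected (carpet N D)) {k : ℕ} (w : Fin (k + 1) → D)
    (S : Set (Fin (k + 1) → D))
    (hS : ∀ u v, u ≠ w → v ≠ w → (hataGraph N D (k + 1)).Adj u v → u ∈ S → v ∈ S)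
    {p p' : D} (hp : p ≠ w 0) (hp' : p' ≠ w 0) (h : ∀ u : Fin (k + 1) → D, u 0 = p → u ∈ S)
    (h' : ∀ u : Fin (k + 1) → D, u 0 = p' → u ∉ S) :
    D.card ^ k ≤ chi (hataGraph N D (k + 1)) := by
  have hD : D.Nonempty := ⟨p, p.2⟩
  refine le_chi _ w (C := {u | u 0 = p}) (C' := {u | u 0 = p'}) ?_ ?_ ?_ ?_ ?_
  · rw [ncard_head_eq, Fintype.card_coe]
  · rw [ncard_head_eq, Fintype.card_coe]
  · intro u hu v hv
    exact avoidReach_of_head_eq hN hD hF (hu.trans_ne hp) (hv.trans hu.symm)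
  · intro u hu v hv
    exact avoidReach_of_head_eq hN hD hF (hu.trans_ne hp') (hv.trans hu.symm)
  · intro u hu v hv huv
    exact h' v hv (huv.mem hS (h u hu))

/-- Here the deleted word lies in one of the two blocks, which costs one vertex; connectedness of
the rest of that block comes from `ht`. -/
theorem pow_sub_one_le_chi_of_separation {N : ℕ} (hN : 2 ≤ N) {D : Finset (Fin N × Fin N)}
    (hF : IsConnected (carpet N D)) {k : ℕ} (i : D) (t : Fin k → D)
    (ht : (deleteVertex (hataGraph N D k) t).Preconnected)
    (S : Set (Fin (k + 1) → D))
    (hS : ∀ u v, u ≠ Fin.cons i t → v ≠ Fin.cons i t → (hataGraph N D (k + 1)).Adj u v →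
      u ∈ S → v ∈ S)
    {p : D} (hp : p ≠ i) (h : ∀ u : Fin (k + 1) → D, u 0 = i → u ∈ S)
    (h' : ∀ u : Fin (k + 1) → D, u 0 = p → u ∉ S) :
    D.card ^ k - 1 ≤ chi (hataGraph N D (k + 1)) := by
  have hD : D.Nonempty := ⟨p, p.2⟩
  refine le_chi _ (Fin.cons i t) (C := {u | u 0 = i} \ {Fin.cons i t}) (C' := {u | u 0 = p})
    ?_ ?_ ?_ ?_ ?_
  · rw [Set.ncard_sdiff_singleton_of_mem (by simp), ncard_head_eq, Fintype.card_coe]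
  · rw [ncard_head_eq, Fintype.card_coe]
    omega
  · have key : ∀ u : Fin (k + 1) → D, u ∈ {u : Fin (k + 1) → D | u 0 = i} \ {Fin.cons i t} →
        ∃ a, a ≠ t ∧ u = Fin.cons i a := by
      rintro u ⟨hu, hu'⟩
      have hu2 : u = Fin.cons i (Fin.tail u) := by
        rw [← show u 0 = i from hu, Fin.cons_self_tail]
      exact ⟨Fin.tail u, fun h => hu' (by rw [hu2, h]; rfl), hu2⟩
    intro u hu v hv
    obtain ⟨a, ha, rfl⟩ := key u hu
    obtain ⟨b, hb, rfl⟩ := key v hv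
    exact avoidReach_cons_of_avoidReach ⟨ha, hb, ht _ _⟩
  · intro u hu v hv
    exact avoidReach_of_head_eq hN hD hF (by simpa using hu.trans_ne hp) (hv.trans hu.symm)
  · intro u hu v hv huv
    exact h' v hv (huv.mem hS (h u hu.1))

/-! ### Large `chi` forces a cut point. -/

/-- The concatenation of two words. -/
def appendWord {A : Type*} {r : ℕ} : (m : ℕ) → (Fin m → A) → (Fin r → A) → Fin (r + m) → A
  | 0, _, u => u
  | m + 1, p, u => (Fin.cons (p 0) (appendWord m (Fin.tail p) u) : Fin (r + m + 1) → A)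

theorem exists_appendWord {A : Type*} {r : ℕ} (m : ℕ) (w : Fin (r + m) → A) :
    ∃ (p : Fin m → A) (u : Fin r → A), appendWord m p u = w := by
  induction m with
  | zero => exact ⟨Fin.elim0, w, rfl⟩
  | succ m ih =>
    obtain ⟨p, u, h⟩ := ih (Fin.tail (n := r + m) w)
    refine ⟨Fin.cons (w 0) p, u, ?_⟩
    rw [appendWord, Fin.tail_cons, h]
    exact Fin.cons_self_tail (n := r + m) w

theorem cell_appendWord_subset {N : ℕ} (hN : 2 ≤ N) (D : Finset (Fin N × Fin N)) {r : ℕ} (m : ℕ)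
    (p : Fin m → D) (u : Fin r → D) :
    cell N D (r + m) (appendWord m p u) ⊆ cell N D m p := by
  induction m with
  | zero => rw [cell_zero]; exact cell_subset_carpet hN D _ _
  | succ m ih =>
    rw [cell_succ N D m]
    exact (cell_cons N D (r + m) _ _).subset.trans (Set.image_mono (ih _))

/-- A point lies in at most four cells of each level. -/
theorem ncard_words_le_four {N : ℕ} (hN : 2 ≤ N) (D : Finset (Fin N × Fin N)) (m : ℕ)
    (x : ℝ × ℝ) : {v : Fin m → D | x ∈ cell N D m v}.ncard ≤ 4 := by
  have C := Chart.std hN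
  have h4 : (Set.univ : Set (Bool × Bool)).ncard = 4 := by
    rw [Set.ncard_univ, Nat.card_eq_fintype_card]; rfl
  rw [← h4]
  -- The corner coordinates of two cells through `x` differ by at most one, so their parities
  -- determine the word.
  refine Set.ncard_le_ncard_of_injOn
    (fun v => (decide (C.kw m v % 2 = 0), decide (C.swap.kw m v % 2 = 0)))
    (fun _ _ => Set.mem_univ _) ?_ Set.finite_univ
  rintro v ⟨y, hy, hyx⟩ w ⟨z, hz, hzx⟩ hvw
  have h := hyx.trans hzx.symm
  simp only [Prod.mk.injEq, decide_eq_decide] at hvw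
  refine C.word_ext ?_ ?_
  · rcases C.word_cases hy hz h with h | h | h <;> omega
  · rcases C.swap.word_cases hy hz h with h | h | h <;> omega

/-- If removing a point does not disconnect a connected carpet, then any two other points lie in
a connected compact subset avoiding this point. -/
theorem exists_compact_preconnected {N : ℕ} (hN : 2 ≤ N) {D : Finset (Fin N × Fin N)}
    (hD : D.Nonempty) (hF : IsConnected (carpet N D)) {x : ℝ × ℝ}
    (hx : IsPreconnected (carpet N D \ {x})) {y z : ℝ × ℝ} (hy : y ∈ carpet N D \ {x})
    (hz : z ∈ carpet N D \ {x}) :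
    ∃ C ⊆ carpet N D \ {x}, IsCompact C ∧ IsPreconnected C ∧ y ∈ C ∧ z ∈ C := by
  -- Being joined in this way is symmetric, transitive and true for nearby points, so it spreads
  -- over a connected set.
  refine hx.induction₂ (fun y z => ∃ C ⊆ carpet N D \ {x}, IsCompact C ∧ IsPreconnected C ∧
    y ∈ C ∧ z ∈ C) ?_ ?_ ?_ hy hz
  · intro y hy
    have hyx : 0 < dist y x := dist_pos.2 hy.2
    obtain ⟨m, hm⟩ := ((tendsto_inv_pow hN).eventually (gt_mem_nhds hyx)).exists
    -- Off the closed set `E` every point of the carpet shares a cell of level `m` with `y`, and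
    -- such a cell is too small to contain `x`.
    let E : Set (ℝ × ℝ) := ⋃ v ∈ {v : Fin m → D | y ∉ cell N D m v}, cell N D m v
    have hE : IsClosed E :=
      (Set.toFinite _).isClosed_biUnion fun v _ => (isCompact_cell N D m v).isClosed
    have hyE : y ∉ E := by
      intro h
      obtain ⟨v, hv, hv'⟩ := Set.mem_iUnion₂.1 h
      exact hv hv'
    filter_upwards [mem_nhdsWithin_of_mem_nhds (hE.isOpen_compl.mem_nhds hyE),
      self_mem_nhdsWithin] with z hzE hz
    obtain ⟨v, hv⟩ := exists_mem_cell hN hD m hz.1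
    have hyv : y ∈ cell N D m v := by
      by_contra h
      exact hzE (Set.mem_iUnion₂.2 ⟨v, h, hv⟩)
    refine ⟨cell N D m v, fun a ha => ⟨cell_subset_carpet hN D m v ha, ?_⟩,
      isCompact_cell N D m v, (isConnected_cell hF m v).isPreconnected, hyv, hv⟩
    rintro rfl
    exact absurd (dist_le_of_mem_cell hyv ha) (not_le.2 hm)
  · rintro a b c - - - ⟨C, hC, hC1, hC2, ha, hb⟩ ⟨C', hC', hC1', hC2', hb', hc⟩
    exact ⟨C ∪ C', Set.union_subset hC hC', hC1.union hC1', hC2.union b hb hb' hC2',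
      Or.inl ha, Or.inr hc⟩
  · rintro a b - - ⟨C, hC, hC1, hC2, ha, hb⟩
    exact ⟨C, hC, hC1, hC2, hb, ha⟩

/-- If `x` does not disconnect the carpet, then all cells of level `m` which miss `x` lie in a
compact set off `x` such that deep cells of these cells are joined avoiding any cell that misses
this compact set. -/
theorem exists_compact_avoidReach {N : ℕ} (hN : 2 ≤ N) {D : Finset (Fin N × Fin N)}
    (hD : D.Nonempty) (hF : IsConnected (carpet N D)) {x : ℝ × ℝ}
    (hx : IsPreconnected (carpet N D \ {x})) (m : ℕ) :
    ∃ Z : Set (ℝ × ℝ), IsCompact Z ∧ x ∉ Z ∧ ∀ (r : ℕ) (w : Fin (r + m) → D),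
      Disjoint Z (cell N D (r + m) w) → ∀ (p q : Fin m → D) (u v : Fin r → D),
        x ∉ cell N D m p → x ∉ cell N D m q →
        AvoidReach (hataGraph N D (r + m)) w (appendWord m p u) (appendWord m q v) := by
  classical
  have key : ∀ p q : Fin m → D, ∃ C : Set (ℝ × ℝ), x ∉ cell N D m p → x ∉ cell N D m q →
      C ⊆ carpet N D \ {x} ∧ IsCompact C ∧ IsPreconnected C ∧ cell N D m p ⊆ C ∧
        cell N D m q ⊆ C := by
    intro p q
    by_cases hpq : x ∉ cell N D m p ∧ x ∉ cell N D m q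
    · obtain ⟨hp, hq⟩ := hpq
      have hsub : ∀ p : Fin m → D, x ∉ cell N D m p → cell N D m p ⊆ carpet N D \ {x} :=
        fun p hp a ha => ⟨cell_subset_carpet hN D m p ha, fun h => hp (h ▸ ha)⟩
      obtain ⟨y, hy⟩ := (isConnected_cell hF m p).nonempty
      obtain ⟨z, hz⟩ := (isConnected_cell hF m q).nonempty
      obtain ⟨C, h1, h2, h3, h4, h5⟩ := exists_compact_preconnected hN hD hF hx
        (hsub p hp hy) (hsub q hq hz)
      -- Adding both cells makes the connecting set meet every deeper cell inside them.
      refine ⟨cell N D m p ∪ C ∪ cell N D m q, fun _ _ => ⟨Set.union_subset (Set.union_subset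
        (hsub p hp) h1) (hsub q hq), ((isCompact_cell N D m p).union h2).union
        (isCompact_cell N D m q), ?_, fun a ha => Or.inl (Or.inl ha), fun a ha => Or.inr ha⟩⟩
      exact ((isConnected_cell hF m p).isPreconnected.union y hy h4 h3).union z (Or.inr h5) hz
        (isConnected_cell hF m q).isPreconnected
    · exact ⟨∅, fun h1 h2 => absurd ⟨h1, h2⟩ hpq⟩
  choose K hK using key
  let good : Set ((Fin m → D) × (Fin m → D)) := {a | x ∉ cell N D m a.1 ∧ x ∉ cell N D m a.2}
  refine ⟨⋃ a ∈ good, K a.1 a.2, good.toFinite.isCompact_biUnion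
    fun a ha => (hK _ _ ha.1 ha.2).2.1, ?_, ?_⟩
  · intro h
    obtain ⟨a, ha, hxa⟩ := Set.mem_iUnion₂.1 h
    exact ((hK _ _ ha.1 ha.2).1 hxa).2 rfl
  · intro r w hw p q u v hp hq
    obtain ⟨h1, -, h3, h4, h5⟩ := hK p q hp hq
    have hsub : K p q ⊆ ⋃ a ∈ good, K a.1 a.2 :=
      Set.subset_biUnion_of_mem (u := fun a : (Fin m → D) × (Fin m → D) => K a.1 a.2)
        (show (p, q) ∈ good from ⟨hp, hq⟩)
    have hmeet : ∀ (p' : Fin m → D) (u' : Fin r → D), cell N D m p' ⊆ K p q →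
        (K p q ∩ cell N D (r + m) (appendWord m p' u')).Nonempty := by
      intro p' u' h
      obtain ⟨a, ha⟩ := (isConnected_cell hF (r + m) (appendWord m p' u')).nonempty
      exact ⟨a, h (cell_appendWord_subset hN D m p' u' ha), ha⟩
    refine avoidReach_of_cover (hataGraph N D (r + m)) (cell N D (r + m))
      (fun v => (isCompact_cell N D _ v).isClosed) (fun a b hab h => ⟨hab, h⟩) h3 ?_
      (hw.mono_left hsub) (hmeet p u h4) (hmeet q v h5)
    intro a ha
    exact Set.mem_iUnion.2 (exists_mem_cell hN hD _ (h1 ha).1)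

theorem exists_isCutPoint_of_le_chi {N : ℕ} (hN : 2 ≤ N) {D : Finset (Fin N × Fin N)}
    (hD1 : 1 < D.card) (hF : IsConnected (carpet N D))
    (h : ∀ k : ℕ, 2 ≤ k → D.card ^ (k - 1) - 1 ≤ chi (hataGraph N D k)) :
    ∃ x, IsCutPoint (carpet N D) x := by
  by_contra hcut
  have hD : D.Nonempty := Finset.card_pos.1 (by omega)
  have hpre : ∀ x ∈ carpet N D, IsPreconnected (carpet N D \ {x}) := by
    intro x hx
    by_contra h'
    exact hcut ⟨x, hx, h'⟩
  have hcomp : ∀ r : ℕ, ∃ (w : Fin (r + 5) → D)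
      (c c' : (deleteVertex (hataGraph N D (r + 5)) w).ConnectedComponent),
      c ≠ c' ∧ D.card ^ (r + 4) - 1 ≤ c.supp.ncard ∧ D.card ^ (r + 4) - 1 ≤ c'.supp.ncard := by
    intro r
    refine exists_components_of_le_chi _ ?_ (h (r + 5) (by omega))
    have : 1 < D.card ^ (r + 4) := Nat.one_lt_pow (by omega) hD1
    omega
  choose w c c' hcc hc hc' using hcomp
  choose y hy using fun r => (isConnected_cell hF (r + 5) (w r)).nonempty
  obtain ⟨x, hx, φ, hφ, hlim⟩ := (isCompact_carpet N D).tendsto_subseq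
    fun r => cell_subset_carpet hN D _ _ (hy r)
  obtain ⟨Z, hZ, hxZ, hreach⟩ := exists_compact_avoidReach hN hD hF (hpre x hx) 5
  obtain ⟨ε, hε, hball⟩ := Metric.isOpen_iff.1 hZ.isClosed.isOpen_compl x hxZ
  have h1 := (Metric.tendsto_nhds.1 hlim) (ε / 2) (half_pos hε)
  have h2 : ∀ᶠ n in Filter.atTop, ((N : ℝ)⁻¹) ^ (φ n + 5) < ε / 2 :=
    (((tendsto_inv_pow hN).comp (Filter.tendsto_add_atTop_nat 5)).comp
      hφ.tendsto_atTop).eventually (gt_mem_nhds (half_pos hε))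
  obtain ⟨n, hn1, hn2⟩ := (h1.and h2).exists
  rw [Function.comp_apply] at hn1
  generalize φ n = r at hn1 hn2
  have hdisj : Disjoint Z (cell N D (r + 5) (w r)) := by
    rw [Set.disjoint_left]
    intro a haZ ha
    refine hball ?_ haZ
    rw [Metric.mem_ball]
    linarith [dist_triangle a (y r) x, dist_le_of_mem_cell ha (hy r)]
  -- At most 4|D|^r words lie below the cells of level 5 through `x`, while |D|^(r+4) - 1 is at
  -- least 16|D|^r - 1; so a component of this size leaves them.
  have hfew : ∀ e : (deleteVertex (hataGraph N D (r + 5)) (w r)).ConnectedComponent,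
      D.card ^ (r + 4) - 1 ≤ e.supp.ncard →
      ∃ (p : Fin 5 → D) (u : Fin r → D) (hpu : appendWord 5 p u ∈ ({w r}ᶜ : Set _)),
        x ∉ cell N D 5 p ∧
        (deleteVertex (hataGraph N D (r + 5)) (w r)).connectedComponentMk ⟨_, hpu⟩ = e := by
    intro e he
    by_contra hno
    push Not at hno
    have hsub : Subtype.val '' e.supp ⊆
        (fun a : (Fin 5 → D) × (Fin r → D) => appendWord 5 a.1 a.2) ''
          ({p : Fin 5 → D | x ∈ cell N D 5 p} ×ˢ Set.univ) := by
      rintro _ ⟨⟨v, hv⟩, hve, rfl⟩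
      obtain ⟨p, u, hpu⟩ := exists_appendWord 5 v
      subst hpu
      refine ⟨(p, u), ⟨?_, Set.mem_univ _⟩, rfl⟩
      by_contra hp
      exact hno p u hv hp hve
    have hcard := Set.ncard_le_ncard hsub
    rw [Set.ncard_image_of_injective _ Subtype.val_injective] at hcard
    have h3 := hcard.trans (Set.ncard_image_le (Set.toFinite _))
    rw [Set.ncard_prod, Set.ncard_univ, Nat.card_eq_fintype_card] at h3
    have h4 := ncard_words_le_four hN D 5 x
    simp only [Fintype.card_pi, Fintype.card_coe, Finset.prod_const, Finset.card_univ,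
      Fintype.card_fin] at h3
    have h5 := h3.trans (Nat.mul_le_mul_right _ h4)
    have h6 : 2 ^ 4 ≤ D.card ^ 4 := Nat.pow_le_pow_left hD1 4
    have h7 : 0 < D.card ^ r := Nat.pow_pos (by omega)
    have h8 : D.card ^ (r + 4) = D.card ^ r * D.card ^ 4 := pow_add _ _ _
    have h9 : D.card ^ r * 2 ^ 4 ≤ D.card ^ r * D.card ^ 4 := Nat.mul_le_mul_left _ h6
    omega
  obtain ⟨p, u, hpu, hp, he⟩ := hfew _ (hc r)
  obtain ⟨q, v, hqv, hq, he'⟩ := hfew _ (hc' r)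
  obtain ⟨_, _, h3⟩ := hreach r (w r) hdisj p q u v hp hq
  exact hcc r (by rw [← he, ← he']; exact SimpleGraph.ConnectedComponent.sound h3)

/-! ### Contacts between opposite sides and pinched cells. -/

theorem exists_fixed_point {N : ℕ} (hN : 2 ≤ N) {D : Finset (Fin N × Fin N)}
    {i : Fin N × Fin N} (hi : i ∈ D) : ∃ p ∈ carpet N D, digitMap N i p = p := by
  have hN' : (2 : ℝ) ≤ N := by exact_mod_cast hN
  have hN1 : (0 : ℝ) < N - 1 := by linarith
  have hle : ∀ j : Fin N, (0 : ℝ) ≤ ((N : ℝ) - 1)⁻¹ * (j : ℕ) ∧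
      ((N : ℝ) - 1)⁻¹ * (j : ℕ) ≤ 1 := by
    intro j
    have : ((j : ℕ) : ℝ) + 1 ≤ N := by exact_mod_cast j.isLt
    refine ⟨by positivity, ?_⟩
    rw [inv_mul_le_iff₀ hN1]; linarith
  have hfix : digitMap N i (((N : ℝ) - 1)⁻¹ * (i.1 : ℕ), ((N : ℝ) - 1)⁻¹ * (i.2 : ℕ)) =
      (((N : ℝ) - 1)⁻¹ * (i.1 : ℕ), ((N : ℝ) - 1)⁻¹ * (i.2 : ℕ)) := by
    have hN0 : (N : ℝ) ≠ 0 := by positivity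
    ext <;> simp only [digitMap, Prod.smul_fst, Prod.smul_snd, Prod.fst_add, Prod.snd_add,
      smul_eq_mul] <;> field_simp <;> ring
  exact ⟨_, mem_carpet_of_fixed hi ⟨⟨(hle _).1, (hle _).1⟩, (hle _).2, (hle _).2⟩ hfix, hfix⟩

/-- A bounded set of reals that is invariant under an expanding affine map reduces to the fixed
point of this map. -/
theorem eq_fixed_of_expanding {N : ℕ} (hN : 2 ≤ N) {H : Set ℝ} {q : ℝ}
    (hH : ∀ t ∈ H, 0 ≤ t ∧ t ≤ 1) (hexp : ∀ t ∈ H, N * t - q ∈ H) {t : ℝ} (ht : t ∈ H) :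
    ((N : ℝ) - 1) * t = q := by
  have hN' : (2 : ℝ) ≤ N := by exact_mod_cast hN
  -- Each application multiplies the deviation from the fixed point q/(N-1) by N, which boundedness
  -- allows only for deviation zero.
  have key : ∀ n : ℕ, ∃ s ∈ H, ((N : ℝ) - 1) * s - q = N ^ n * (((N : ℝ) - 1) * t - q) := by
    intro n
    induction n with
    | zero => exact ⟨t, ht, by simp⟩
    | succ n ih =>
      obtain ⟨s, hs, h⟩ := ih
      exact ⟨_, hexp s hs, by rw [pow_succ]; linear_combination (N : ℝ) * h⟩
  by_contra hne
  have hpos : 0 < |((N : ℝ) - 1) * t - q| := abs_pos.2 (sub_ne_zero.2 hne)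
  obtain ⟨n, hn⟩ := pow_unbounded_of_one_lt ((N + |q|) / |((N : ℝ) - 1) * t - q|)
    (show (1 : ℝ) < N by linarith)
  rw [div_lt_iff₀ hpos] at hn
  obtain ⟨s, hs, h⟩ := key n
  have h2 : |((N : ℝ) - 1) * s - q| = N ^ n * |((N : ℝ) - 1) * t - q| := by
    rw [h, abs_mul, abs_of_nonneg (by positivity : (0 : ℝ) ≤ N ^ n)]
  have h3 : |((N : ℝ) - 1) * s - q| ≤ |((N : ℝ) - 1) * s| + |q| := abs_sub _ _
  have h4 : |((N : ℝ) - 1) * s| ≤ N := by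
    obtain ⟨h5, h6⟩ := hH s hs
    rw [abs_of_nonneg (by nlinarith)]; nlinarith
  linarith

/-- The points of the carpet which the digit map of `a` sends into another cell of level one. -/
def touchSet (N : ℕ) (D : Finset (Fin N × Fin N)) (a : Fin N × Fin N) : Set (ℝ × ℝ) :=
  {y | y ∈ carpet N D ∧ ∃ i ∈ D, i ≠ a ∧ ∃ z ∈ carpet N D, digitMap N i z = digitMap N a y}

namespace Chart

section

variable {N : ℕ} {D : Finset (Fin N × Fin N)} (C : Chart N)

theorem κ_mem {y : ℝ × ℝ} (hy : y ∈ carpet N D) : 0 ≤ C.κ y ∧ C.κ y ≤ 1 :=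
  ⟨C.κ_nonneg y (carpet_subset_Icc N D hy), C.κ_le y (carpet_subset_Icc N D hy)⟩

theorem τ_mem {y : ℝ × ℝ} (hy : y ∈ carpet N D) : 0 ≤ C.τ y ∧ C.τ y ≤ 1 :=
  C.swap.κ_mem hy

theorem of_κ_map_eq_zero {i : Fin N × Fin N} {z : ℝ × ℝ} (hz : z ∈ carpet N D)
    (h : C.κ (digitMap N i z) = 0) : C.kd i = 0 ∧ C.κ z = 0 := by
  have h1 := C.κ_map i z
  rw [h, mul_zero] at h1
  have h2 := (C.κ_mem hz).1
  have h3 : (0 : ℝ) ≤ C.kd i := by positivity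
  have h4 : (C.kd i : ℝ) = 0 := by linarith
  exact ⟨by exact_mod_cast h4, by linarith⟩

theorem of_κ_map_eq_one {i : Fin N × Fin N} {z : ℝ × ℝ} (hz : z ∈ carpet N D)
    (h : C.κ (digitMap N i z) = 1) : C.kd i + 1 = N ∧ C.κ z = 1 := by
  have h1 := C.κ_map i z
  rw [h, mul_one] at h1
  have h2 := (C.κ_mem hz).2
  have h3 : (C.kd i : ℝ) + 1 ≤ N := by exact_mod_cast C.kd_lt i
  have h4 : (C.kd i : ℝ) + 1 = N := by linarith
  exact ⟨by exact_mod_cast h4, by linarith⟩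

theorem of_τ_map_eq_zero {i : Fin N × Fin N} {z : ℝ × ℝ} (hz : z ∈ carpet N D)
    (h : C.τ (digitMap N i z) = 0) : C.td i = 0 ∧ C.τ z = 0 :=
  C.swap.of_κ_map_eq_zero hz h

theorem of_τ_map_eq_one {i : Fin N × Fin N} {z : ℝ × ℝ} (hz : z ∈ carpet N D)
    (h : C.τ (digitMap N i z) = 1) : C.td i + 1 = N ∧ C.τ z = 1 :=
  C.swap.of_κ_map_eq_one hz h

theorem td_cases {i j : Fin N × Fin N} {y z : ℝ × ℝ} (hy : y ∈ carpet N D)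
    (hz : z ∈ carpet N D) (h : digitMap N i y = digitMap N j z) :
    (C.td i = C.td j ∧ C.τ y = C.τ z) ∨ (C.td j = C.td i + 1 ∧ C.τ y = 1 ∧ C.τ z = 0) ∨
      (C.td i = C.td j + 1 ∧ C.τ y = 0 ∧ C.τ z = 1) :=
  C.swap.digit_cases hy hz h

/-- `y` lies on the right side and `z` on the left side of the carpet, at the same height. -/
def Pair (C : Chart N) (D : Finset (Fin N × Fin N)) (y z : ℝ × ℝ) : Prop :=
  y ∈ carpet N D ∧ z ∈ carpet N D ∧ C.κ y = 1 ∧ C.κ z = 0 ∧ C.τ y = C.τ z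

variable {C}

theorem Pair.digitMap_eq (hN : 2 ≤ N) {y z : ℝ × ℝ} (h : C.Pair D y z) {a a' : Fin N × Fin N}
    (hk : C.kd a' = C.kd a + 1) (ht : C.td a' = C.td a) :
    digitMap N a y = digitMap N a' z := by
  obtain ⟨hy, hz, h1, h2, h3⟩ := h
  refine C.digitMap_eq_digitMap hN ?_ ?_
  · rw [hk, h1, h2]; push_cast; ring
  · rw [ht, h3]

theorem Pair.left_mem_touchSet (hN : 2 ≤ N) {y z : ℝ × ℝ} (h : C.Pair D y z)
    {a a' : Fin N × Fin N} (ha' : a' ∈ D) (hk : C.kd a' = C.kd a + 1) (ht : C.td a' = C.td a) :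
    y ∈ touchSet N D a :=
  ⟨h.1, a', ha', fun h' => by rw [h'] at hk; omega, z, h.2.1, (h.digitMap_eq hN hk ht).symm⟩

theorem Pair.right_mem_touchSet (hN : 2 ≤ N) {y z : ℝ × ℝ} (h : C.Pair D y z)
    {a a' : Fin N × Fin N} (ha : a ∈ D) (hk : C.kd a' = C.kd a + 1) (ht : C.td a' = C.td a) :
    z ∈ touchSet N D a' :=
  ⟨h.2.1, a, ha, fun h' => by rw [h'] at hk; omega, y, h.1, h.digitMap_eq hN hk ht⟩

theorem Pair.flip {y z : ℝ × ℝ} (h : C.Pair D y z) : C.flip.Pair D z y :=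
  ⟨h.2.1, h.1, by simp [Chart.flip, h.2.2.2.1], by simp [Chart.flip, h.2.2.1], h.2.2.2.2.symm⟩

theorem Pair.flipSnd {y z : ℝ × ℝ} (h : C.Pair D y z) : C.flipSnd.Pair D y z :=
  ⟨h.1, h.2.1, h.2.2.1, h.2.2.2.1, by
    show 1 - C.τ y = 1 - C.τ z
    rw [h.2.2.2.2]⟩

variable (C)

theorem exists_fixed (hN : 2 ≤ N) {i : Fin N × Fin N} (hi : i ∈ D) :
    ∃ p ∈ carpet N D, digitMap N i p = p ∧ ((N : ℝ) - 1) * C.κ p = C.kd i ∧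
      ((N : ℝ) - 1) * C.τ p = C.td i := by
  obtain ⟨p, hp, hfix⟩ := exists_fixed_point hN hi
  have h1 := C.κ_map i p
  have h2 := C.τ_map i p
  rw [hfix] at h1 h2
  exact ⟨p, hp, hfix, by linarith, by linarith⟩

/-- A digit that occurs on the left and on the right side gives a pair of opposite points. -/
theorem exists_pair_of_common_digit (hN : 2 ≤ N) {m m' : Fin N × Fin N} (hm : m ∈ D)
    (hm' : m' ∈ D) (hk : C.kd m + 1 = N) (hk' : C.kd m' = 0) (ht : C.td m = C.td m') :
    ∃ y z, C.Pair D y z ∧ ((N : ℝ) - 1) * C.τ y = C.td m := by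
  have hN' : (2 : ℝ) ≤ N := by exact_mod_cast hN
  have hN1 : (N : ℝ) - 1 ≠ 0 := by linarith
  have hk2 : (C.kd m : ℝ) = N - 1 := by rw [eq_sub_iff_add_eq]; exact_mod_cast hk
  obtain ⟨y, hy, -, h1, h2⟩ := C.exists_fixed hN hm
  obtain ⟨z, hz, -, h3, h4⟩ := C.exists_fixed hN hm'
  refine ⟨y, z, ⟨hy, hz, mul_left_cancel₀ hN1 (by rw [h1, hk2, mul_one]), ?_, ?_⟩, h2⟩
  · exact mul_left_cancel₀ hN1 (by rw [h3, hk']; simp)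
  · exact mul_left_cancel₀ hN1 (by rw [h2, h4, ht])

/-- The number q/(N-1) has the base-N expansion qqq... and no other: a carry would need remainder 1
with q = N-1 or remainder 0 with q = 0, and then the other digit would be N or -1. -/
theorem td_eq_of_fixed {e : Fin N × Fin N} {y : ℝ × ℝ} (hy : y ∈ carpet N D)
    {q : ℕ} (h : ((N : ℝ) - 1) * C.τ (digitMap N e y) = q)
    (hey : digitMap N e y ∈ carpet N D) :
    C.td e = q ∧ ((N : ℝ) - 1) * C.τ y = q := by
  have h1 := C.τ_map e y
  have h2 : (q : ℝ) + C.τ (digitMap N e y) = C.td e + C.τ y := by linarith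
  have h3 := C.τ_mem hy
  have h4 := C.τ_mem hey
  rcases nat_add_unit_cases h4.1 h4.2 h3.1 h3.2 h2 with ⟨h5, h6⟩ | ⟨h5, h6, -⟩ | ⟨h5, h6, -⟩
  · exact ⟨h5.symm, by rw [← h6, h]⟩
  · rw [h6] at h
    have h7 : (N : ℝ) = q + 1 := by linarith
    have h8 : N = q + 1 := by exact_mod_cast h7
    have := C.td_lt e
    omega
  · rw [h6, mul_zero] at h
    have h8 : q = 0 := by exact_mod_cast h.symm
    omega

theorem td_eq_of_fixed_of_mem_cell (hN : 2 ≤ N) {k : ℕ} {w : Fin k → D} {y : ℝ × ℝ}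
    (hy : y ∈ cell N D k w) {q : ℕ} (h : ((N : ℝ) - 1) * C.τ y = q) (m : Fin k) :
    C.td (w m) = q := by
  induction k generalizing y with
  | zero => exact m.elim0
  | succ k ih =>
    rw [cell_succ] at hy
    obtain ⟨z, hz, rfl⟩ := hy
    have hzF := cell_subset_carpet hN D k _ hz
    obtain ⟨h1, h2⟩ := C.td_eq_of_fixed hzF h (digitMap_mem_carpet hN (w 0).2 hzF)
    refine Fin.cases h1 (fun m => ih hz h2 m) m

/-- If no row has digits in both outer columns, every contact height is an end of the row of `e`.
The upper end puts the upper right corner into the carpet, the lower end the upper left one. Two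
heights give both corners, and then the top row has digits in both outer columns. -/
theorem exists_common_digit (hN : 2 ≤ N) (hD : D.Nonempty) {e : Fin N × Fin N}
    (he : e ∈ D) (hk : C.kd e + 1 = N)
    (hpin : ∀ y z, C.Pair D y z → y ∈ digitMap N e '' carpet N D) {y z y' z' : ℝ × ℝ}
    (h : C.Pair D y z) (h' : C.Pair D y' z') (hne : C.τ y ≠ C.τ y') :
    ∃ m ∈ D, ∃ m' ∈ D, C.kd m + 1 = N ∧ C.kd m' = 0 ∧ C.td m = C.td m' := by
  by_contra hno
  have key : ∀ y z, C.Pair D y z → ∃ u ∈ carpet N D, ∃ v ∈ carpet N D, C.κ u = 1 ∧ C.κ v = 0 ∧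
      ((N * C.τ y = C.td e + 1 ∧ C.τ u = 1) ∨ (N * C.τ y = C.td e ∧ C.τ v = 1)) := by
    intro y z hyz
    obtain ⟨u, hu, rfl⟩ := hpin y z hyz
    obtain ⟨-, hz, h1, h2, h3⟩ := hyz
    obtain ⟨m, hm, v, hv, rfl⟩ := exists_digitMap_eq hN hD hz
    have hmk := C.of_κ_map_eq_zero hv h2
    have h4 := C.τ_map e u
    have h5 := C.τ_map m v
    have h6 := C.τ_mem hu
    have h7 := C.τ_mem hv
    refine ⟨u, hu, v, hv, (C.of_κ_map_eq_one hu h1).2, hmk.2, ?_⟩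
    rcases nat_add_unit_cases h6.1 h6.2 h7.1 h7.2 (by rw [← h4, ← h5, h3]) with
      ⟨h8, -⟩ | ⟨-, h8, -⟩ | ⟨-, h8, h9⟩
    · exact absurd ⟨e, he, m, hm, hk, hmk.1, h8⟩ hno
    · exact Or.inl ⟨by rw [h4, h8], h8⟩
    · exact Or.inr ⟨by rw [h4, h8, add_zero], h9⟩
  have hcorner : ∀ u ∈ carpet N D, ∀ v ∈ carpet N D, C.κ u = 1 → C.κ v = 0 → C.τ u = 1 →
      C.τ v = 1 → False := by
    intro u hu v hv h1 h2 h3 h4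
    obtain ⟨m, hm, u', hu', rfl⟩ := exists_digitMap_eq hN hD hu
    obtain ⟨m', hm', v', hv', rfl⟩ := exists_digitMap_eq hN hD hv
    have h5 := (C.of_τ_map_eq_one hu' h3).1
    have h6 := (C.of_τ_map_eq_one hv' h4).1
    exact hno ⟨m, hm, m', hm', (C.of_κ_map_eq_one hu' h1).1, (C.of_κ_map_eq_zero hv' h2).1,
      by omega⟩
  have hN0 : (N : ℝ) ≠ 0 := by positivity
  obtain ⟨u, hu, v, hv, h1, h2, h3⟩ := key y z h
  obtain ⟨u', hu', v', hv', h1', h2', h3'⟩ := key y' z' h'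
  rcases h3 with ⟨h3, h4⟩ | ⟨h3, h4⟩ <;> rcases h3' with ⟨h3', h4'⟩ | ⟨h3', h4'⟩
  · exact hne (mul_left_cancel₀ hN0 (h3.trans h3'.symm))
  · exact hcorner u hu v' hv' h1 h2' h4 h4'
  · exact hcorner u' hu' v hv h1' h2 h4' h4
  · exact hne (mul_left_cancel₀ hN0 (h3.trans h3'.symm))

/-- If all points at which the right side is touched are at the same height, then a pinched cell
is touched by a cell of another row. -/
theorem exists_touch_off_row {a e : Fin N × Fin N} (hN : 2 ≤ N)
    (hnd : ∀ y, ∃ y' ∈ touchSet N D a, y' ≠ y)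
    (hpin : touchSet N D a ⊆ digitMap N e '' carpet N D) (hk : C.kd e + 1 = N) {y₀ : ℝ × ℝ}
    (h0 : C.κ y₀ = 1) (huniq : ∀ y z, C.Pair D y z → C.τ y = C.τ y₀) :
    ∃ y ∈ touchSet N D a, y ≠ y₀ ∧ ∃ n ∈ D, ∃ z ∈ carpet N D, digitMap N n z = digitMap N a y ∧
      C.td n ≠ C.td a ∧
      ((C.kd n = C.kd a ∧ C.κ z = C.κ y) ∨ (C.kd n = C.kd a + 1 ∧ C.κ y = 1 ∧ C.κ z = 0)) := by
  obtain ⟨y, hy, hne⟩ := hnd y₀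
  obtain ⟨hyF, n, hn, hna, z, hz, hzy⟩ := id hy
  have hkap : C.κ y ≠ 0 := by
    obtain ⟨u, hu, rfl⟩ := hpin hy
    intro h
    have := (C.of_κ_map_eq_zero hu h).1
    omega
  have hcase : (C.kd n = C.kd a ∧ C.κ z = C.κ y) ∨
      (C.kd n = C.kd a + 1 ∧ C.κ y = 1 ∧ C.κ z = 0) := by
    rcases C.digit_cases hz hyF hzy with h | h | h
    · exact Or.inl h
    · exact absurd h.2.2 hkap
    · exact Or.inr ⟨h.1, h.2.2, h.2.1⟩
  refine ⟨y, hy, hne, n, hn, z, hz, hzy, ?_, hcase⟩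
  intro ht
  rcases hcase with h | h
  · exact hna (C.ext_digit _ _ h.1 ht)
  · rcases C.td_cases hz hyF hzy with h' | h' | h'
    · exact hne (C.ext_point _ _ (h.2.1.trans h0.symm)
        (huniq y z ⟨hyF, hz, h.2.1, h.2.2, h'.2.symm⟩))
    · omega
    · omega

/-- A point in the bottom row and one in the top row have the same height only if N = 2. Then `y` is
the upper right corner and supplies the fourth digit, so that `D` is everything. -/
theorem not_opposite_corner (hN : 2 ≤ N) (hD2 : D.card < N ^ 2) {b b' c : Fin N × Fin N}
    (hb : b ∈ D) (hb' : b' ∈ D) (hc : c ∈ D) (hkb : C.kd b + 1 = N)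
    (hkb' : C.kd b = C.kd b' + 1) (htb' : C.td b' = C.td b) (htb : C.td b = 0)
    (htc : C.td c + 1 = N) (hkc : C.kd c = 0) {y z : ℝ × ℝ} (hy : y ∈ carpet N D)
    (hz : z ∈ carpet N D) (hyκ : C.κ y = 1)
    (h : C.τ (digitMap N b y) = C.τ (digitMap N c z)) : False := by
  have h1 := C.τ_map b y
  have h2 := C.τ_map c z
  have h3 := C.τ_mem hy
  have h4 := C.τ_mem hz
  rw [h, h2, htb, Nat.cast_zero, zero_add] at h1
  have h5 : (C.td c : ℝ) ≤ 1 := by linarith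
  have h6 : C.td c ≤ 1 := by exact_mod_cast h5
  have hN2 : N = 2 := by omega
  have h7 : C.td c = 1 := by omega
  rw [h7] at h1
  have h8 : C.τ y = 1 := by push_cast at h1; linarith
  obtain ⟨d, hd, u, hu, rfl⟩ := exists_digitMap_eq hN ⟨b, hb⟩ hy
  have h9 := (C.of_κ_map_eq_one hu hyκ).1
  have h10 := (C.of_τ_map_eq_one hu h8).1
  have hsub : ({b, b', c, d} : Finset (Fin N × Fin N)) ⊆ D := by
    intro x hx
    simp only [Finset.mem_insert, Finset.mem_singleton] at hx
    rcases hx with rfl | rfl | rfl | rfl <;> assumption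
  have hcard : ({b, b', c, d} : Finset (Fin N × Fin N)).card = 4 := by
    have e1 : b ≠ b' := by rintro rfl; omega
    have e2 : b ≠ c := by rintro rfl; omega
    have e3 : b ≠ d := by rintro rfl; omega
    have e4 : b' ≠ c := by rintro rfl; omega
    have e5 : b' ≠ d := by rintro rfl; omega
    have e6 : c ≠ d := by rintro rfl; omega
    simp [*]
  have := Finset.card_le_card hsub
  rw [hcard] at this
  have h11 : N ^ 2 = 4 := by rw [hN2]; rfl
  omega

/-- A cell pinched on the right side cannot contain a cell pinched on the left side. -/
theorem not_opposite (hN : 2 ≤ N) (hD2 : D.card < N ^ 2)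
    (hnd : ∀ a ∈ D, ∀ y, ∃ y' ∈ touchSet N D a, y' ≠ y) {a a' b b' c : Fin N × Fin N}
    (ha : a ∈ D) (ha' : a' ∈ D) (hb : b ∈ D) (hb' : b' ∈ D) (hc : c ∈ D)
    (hka : C.kd a' = C.kd a + 1) (hta : C.td a' = C.td a) (hkb : C.kd b = C.kd b' + 1)
    (htb : C.td b' = C.td b) {y₀ z₀ : ℝ × ℝ} (h0 : C.Pair D y₀ z₀)
    (hab : touchSet N D a ⊆ digitMap N b '' carpet N D)
    (hbc : touchSet N D b ⊆ digitMap N c '' carpet N D) : False := by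
  have hsub : ∀ y z, C.Pair D y z → ∃ y' ∈ carpet N D, ∃ z' ∈ carpet N D, digitMap N b y' = y ∧
      digitMap N c z' = z ∧ C.kd b + 1 = N ∧ C.κ y' = 1 ∧ C.kd c = 0 ∧ C.κ z' = 0 := by
    intro y z h
    obtain ⟨y', hy', rfl⟩ := hab (h.left_mem_touchSet hN ha' hka hta)
    obtain ⟨z', hz', rfl⟩ := hbc (h.right_mem_touchSet hN hb' hkb htb.symm)
    obtain ⟨h1, h2⟩ := C.of_κ_map_eq_one hy' h.2.2.1
    obtain ⟨h3, h4⟩ := C.of_κ_map_eq_zero hz' h.2.2.2.1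
    exact ⟨y', hy', z', hz', rfl, rfl, h1, h2, h3, h4⟩
  obtain ⟨y', hy', z', hz', hby, hcz, hb1, hy'1, hc0, hz'0⟩ := hsub y₀ z₀ h0
  have hN0 : (N : ℝ) ≠ 0 := by positivity
  have hN1 : (N : ℝ) - 1 ≠ 0 := by
    have : (2 : ℝ) ≤ N := by exact_mod_cast hN
    linarith
  -- If `b` and `c` are in one row, the contact heights are invariant under t ↦ Nt - td b; otherwise
  -- they lie on the line between the two rows. Either way there is one height only.
  have huniq : ∀ y z, C.Pair D y z → C.τ y = C.τ y₀ := by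
    by_cases hq : C.td b = C.td c
    · have key : ∀ t ∈ {t | ∃ y z, C.Pair D y z ∧ C.τ y = t}, ((N : ℝ) - 1) * t = C.td b := by
        intro t ht
        refine eq_fixed_of_expanding hN ?_ ?_ ht
        · rintro _ ⟨y, z, h, rfl⟩
          exact C.τ_mem h.1
        · rintro _ ⟨y, z, h, rfl⟩
          obtain ⟨u, hu, v, hv, rfl, rfl, -, hu1, -, hv0⟩ := hsub y z h
          have h5 := h.2.2.2.2
          have h6 := C.τ_map b u
          have h7 := C.τ_map c v
          rw [← h5, ← hq, h6] at h7
          exact ⟨u, v, ⟨hu, hv, hu1, hv0, by linarith⟩, by linarith⟩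
      intro y z h
      exact mul_left_cancel₀ hN1 ((key _ ⟨y, z, h, rfl⟩).trans (key _ ⟨y₀, z₀, h0, rfl⟩).symm)
    · have key : ∀ y z, C.Pair D y z → N * C.τ y = max (C.td b) (C.td c) := by
        intro y z h
        obtain ⟨u, hu, v, hv, rfl, rfl, -, hu1, -, hv0⟩ := hsub y z h
        have h5 := h.2.2.2.2
        have h6 := C.τ_map b u
        have h7 := C.τ_map c v
        have h8 := C.τ_mem hu
        have h9 := C.τ_mem hv
        rcases nat_add_unit_cases h8.1 h8.2 h9.1 h9.2 (by rw [← h6, ← h7, h5]) with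
          ⟨h10, -⟩ | ⟨h10, h11, -⟩ | ⟨h10, h11, -⟩
        · exact absurd h10 hq
        · rw [h6, h11, h10, max_eq_right (by omega)]; push_cast; ring
        · rw [h6, h11, add_zero, max_eq_left (by omega)]
      intro y z h
      exact mul_left_cancel₀ hN0 ((key y z h).trans (key y₀ z₀ h0).symm)
  have huniq' : ∀ z y, C.flip.Pair D z y → C.flip.τ z = C.flip.τ z₀ := by
    intro z y h
    have h1 : C.Pair D y z := by
      have h2 : 1 - C.κ z = 1 := h.2.2.1
      have h3 : 1 - C.κ y = 0 := h.2.2.2.1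
      exact ⟨h.2.1, h.1, by linarith, by linarith, h.2.2.2.2.symm⟩
    have h4 := huniq y z h1
    rw [h1.2.2.2.2, h0.2.2.2.2] at h4
    exact h4
  obtain ⟨y₁, hy₁, -, n, hn, v, hv, hnv, htn, -⟩ :=
    C.exists_touch_off_row hN (hnd a ha) hab hb1 h0.2.2.1 huniq
  obtain ⟨z₁, hz₁, -, n', hn', v', hv', hnv', htn', -⟩ :=
    C.flip.exists_touch_off_row hN (hnd b hb) hbc (by show N - 1 - C.kd c + 1 = N; omega)
      h0.flip.2.2.1 huniq'
  have htn' : C.td n' ≠ C.td b := htn'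
  -- Contacts off the row put `b` and `c` into extreme rows. Unless these rows are opposite, a
  -- neighbour of `b` would stick out of the square; the two surviving cases are mirror images.
  have hbcases : C.td b = 0 ∨ C.td b + 1 = N := by
    obtain ⟨u, hu, hu'⟩ := hab hy₁
    rcases C.td_cases hv hy₁.1 hnv with h | h | h
    · exact absurd h.1 htn
    · left; exact (C.of_τ_map_eq_zero hu (by rw [hu', h.2.2])).1
    · right; exact (C.of_τ_map_eq_one hu (by rw [hu', h.2.2])).1
  have hccases : (C.td b = C.td n' + 1 ∧ C.td c = 0) ∨ (C.td n' = C.td b + 1 ∧ C.td c + 1 = N) := by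
    obtain ⟨u, hu, hu'⟩ := hbc hz₁
    rcases C.td_cases hv' hz₁.1 hnv' with h | h | h
    · exact absurd h.1 htn'
    · left; exact ⟨h.1, (C.of_τ_map_eq_zero hu (by rw [hu', h.2.2])).1⟩
    · right; exact ⟨h.1, (C.of_τ_map_eq_one hu (by rw [hu', h.2.2])).1⟩
  have hτ : C.τ (digitMap N b y') = C.τ (digitMap N c z') := by rw [hby, hcz, h0.2.2.2.2]
  rcases hbcases with hb0 | hbN
  · rcases hccases with h | h
    · omega
    · exact C.not_opposite_corner hN hD2 hb hb' hc hb1 hkb htb hb0 h.2 hc0 hy' hz' hy'1 hτ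
  · have hlt := C.td_lt n'
    rcases hccases with h | h
    · refine C.flipSnd.not_opposite_corner hN hD2 hb hb' hc hb1 hkb
        (show N - 1 - C.td b' = N - 1 - C.td b by rw [htb])
        (show N - 1 - C.td b = 0 by omega) (show N - 1 - C.td c + 1 = N by omega) hc0 hy' hz'
        hy'1 (show 1 - C.τ _ = 1 - C.τ _ by rw [hτ])
    · omega

end

end Chart

namespace Chart

section

variable {N : ℕ} {D : Finset (Fin N × Fin N)} (C : Chart N)

/-- A cell pinched on the right side cannot contain a cell with a neighbour above it which is
pinched as well. -/
theorem not_perpendicular (hN : 2 ≤ N) (hD2 : D.card < N ^ 2)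
    (hnd : ∀ a ∈ D, ∀ y, ∃ y' ∈ touchSet N D a, y' ≠ y) {a a' b c n : Fin N × Fin N}
    (ha : a ∈ D) (ha' : a' ∈ D) (hb : b ∈ D) (hc : c ∈ D) (hn : n ∈ D)
    (hka : C.kd a' = C.kd a + 1) (hta : C.td a' = C.td a) (hkn : C.kd n = C.kd b)
    (htn : C.td n = C.td b + 1) {y₀ z₀ : ℝ × ℝ} (h0 : C.Pair D y₀ z₀)
    (hab : touchSet N D a ⊆ digitMap N b '' carpet N D)
    (hbc : touchSet N D b ⊆ digitMap N c '' carpet N D) : False := by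
  have hN2 : (2 : ℝ) ≤ N := by exact_mod_cast hN
  have hN0 : (N : ℝ) ≠ 0 := by positivity
  have hN1 : (N : ℝ) - 1 ≠ 0 := by linarith
  have hD : D.Nonempty := ⟨a, ha⟩
  have hpin : ∀ y z, C.Pair D y z → y ∈ digitMap N b '' carpet N D :=
    fun y z h => hab (h.left_mem_touchSet hN ha' hka hta)
  have hb1 : C.kd b + 1 = N := by
    obtain ⟨u, hu, hu'⟩ := hpin y₀ z₀ h0
    exact (C.of_κ_map_eq_one hu (by rw [hu', h0.2.2.1])).1
  -- A row with digits in both outer columns has a contact of height td m/(N-1); it is pinned in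
  -- `b`, so `b` lies in that row.
  have hcommon : ∀ m ∈ D, ∀ m' ∈ D, C.kd m + 1 = N → C.kd m' = 0 → C.td m = C.td m' →
      C.td m = C.td b ∧ ∃ y z, C.Pair D y z ∧ ((N : ℝ) - 1) * C.τ y = C.td m := by
    intro m hm m' hm' h1 h2 h3
    obtain ⟨y, z, hyz, h4⟩ := C.exists_pair_of_common_digit hN hm hm' h1 h2 h3
    refine ⟨?_, y, z, hyz, h4⟩
    obtain ⟨u, hu, rfl⟩ := hpin y z hyz
    exact (C.td_eq_of_fixed hu h4 hyz.1).1.symm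
  have hnN := C.td_lt n
  by_cases huniq : ∀ y z, C.Pair D y z → C.τ y = C.τ y₀
  · obtain ⟨y₁, hy₁, hne, m, hm, z₁, hz₁, hmz, htm, hcase⟩ :=
      C.exists_touch_off_row hN (hnd a ha) hab hb1 h0.2.2.1 huniq
    obtain ⟨u, hu, hu'⟩ := hab hy₁
    -- A contact from above would put `b` into the top row, leaving no room for `n`.
    have hcorner : C.td a = C.td m + 1 ∧ C.td b = 0 ∧ C.τ y₁ = 0 ∧ C.τ z₁ = 1 := by
      rcases C.td_cases hz₁ hy₁.1 hmz with h | h | h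
      · exact absurd h.1 htm
      · exact ⟨h.1, (C.of_τ_map_eq_zero hu (by rw [hu', h.2.2])).1, h.2.2, h.2.1⟩
      · have := (C.of_τ_map_eq_one hu (by rw [hu', h.2.2])).1
        omega
    obtain ⟨h1, h2, h3, h4⟩ := hcorner
    rcases hcase with ⟨h5, h6⟩ | ⟨h5, h6, h7⟩
    -- The contact comes from straight below: with the axes exchanged this is the situation of
    -- `not_opposite`.
    · have hma := C.td_lt a
      refine C.swap.flip.not_opposite hN hD2 hnd ha hm hb hn hc
        (show N - 1 - C.td m = N - 1 - C.td a + 1 by omega) h5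
        (show N - 1 - C.td b = N - 1 - C.td n + 1 by omega) hkn (y₀ := y₁) (z₀ := z₁)
        ⟨hy₁.1, hz₁, ?_, ?_, h6.symm⟩ hab hbc
      · show 1 - C.τ y₁ = 1
        rw [h3, sub_zero]
      · show 1 - C.τ z₁ = 0
        rw [h4, sub_self]
    -- The contact is diagonal: `z₁` is the upper left corner and gives a digit `s` there. Each
    -- possible row for the left-hand cell of the pair `y₀`, `z₀` then contradicts `huniq`,
    -- `hcommon` or td b = 0.
    · have hy₀ : C.τ y₀ ≠ 0 := fun h =>
        hne (C.ext_point _ _ (h6.trans h0.2.2.1.symm) (h3.trans h.symm))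
      obtain ⟨s, hs, v, hv, rfl⟩ := exists_digitMap_eq hN hD hz₁
      have hs1 := (C.of_κ_map_eq_zero hv h7).1
      have hs2 := (C.of_τ_map_eq_one hv h4).1
      obtain ⟨y', hy', hby⟩ := hpin y₀ z₀ h0
      obtain ⟨m', hm', z', hz', hmz'⟩ := exists_digitMap_eq hN hD h0.2.1
      have hm'0 := (C.of_κ_map_eq_zero hz' (by rw [hmz', h0.2.2.2.1])).1
      have hy'1 := (C.of_κ_map_eq_one hy' (by rw [hby, h0.2.2.1])).2
      have h8 := C.τ_map b y'
      have h9 := C.τ_map m' z'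
      have h10 := C.τ_mem hy'
      have h11 := C.τ_mem hz'
      rw [hby] at h8
      rw [hmz', ← h0.2.2.2.2] at h9
      rcases nat_add_unit_cases h10.1 h10.2 h11.1 h11.2 (h8.symm.trans h9) with
        ⟨h12, -⟩ | ⟨h12, h13, -⟩ | ⟨h12, -⟩
      · obtain ⟨-, y, z, hyz, h13⟩ := hcommon b hb m' hm' hb1 hm'0 h12
        rw [huniq y z hyz, h2, Nat.cast_zero] at h13
        exact hy₀ ((mul_eq_zero.1 h13).resolve_left hN1)
      · obtain ⟨d, hd, x, hx, rfl⟩ := exists_digitMap_eq hN hD hy'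
        have h14 := (C.of_κ_map_eq_one hx hy'1).1
        have h15 := (C.of_τ_map_eq_one hx h13).1
        have := (hcommon d hd s hs h14 hs1 (by omega)).1
        omega
      · omega
  · push Not at huniq
    obtain ⟨y₁, z₁, h1, hne⟩ := huniq
    obtain ⟨m, hm, e, he, hm1, he0, hme⟩ :=
      C.exists_common_digit hN hD hb hb1 hpin h1 h0 hne
    have hmb := (hcommon m hm e he hm1 he0 hme).1
    -- If each contact came from a contact one level deeper within the row of `b`, the expanding map
    -- would leave only one height.
    by_cases hcross : ∀ y z, C.Pair D y z → ∃ y' z', C.Pair D y' z' ∧ N * C.τ y = C.td b + C.τ y'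
    · have key : ∀ t ∈ {t | ∃ y z, C.Pair D y z ∧ C.τ y = t}, ((N : ℝ) - 1) * t = C.td b := by
        intro t ht
        refine eq_fixed_of_expanding hN ?_ ?_ ht
        · rintro _ ⟨y, z, h, rfl⟩
          exact C.τ_mem h.1
        · rintro _ ⟨y, z, h, rfl⟩
          obtain ⟨y', z', h', h2⟩ := hcross y z h
          exact ⟨y', z', h', by linarith⟩
      exact hne (mul_left_cancel₀ hN1
        ((key _ ⟨y₁, z₁, h1, rfl⟩).trans (key _ ⟨y₀, z₀, h0, rfl⟩).symm))
    · push Not at hcross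
      obtain ⟨y, z, hyz, hno⟩ := hcross
      obtain ⟨y', hy', hby⟩ := hpin y z hyz
      obtain ⟨r, hr, z', hz', hrz⟩ := exists_digitMap_eq hN hD hyz.2.1
      have hy'1 := (C.of_κ_map_eq_one hy' (by rw [hby, hyz.2.2.1])).2
      have hr0 := C.of_κ_map_eq_zero hz' (by rw [hrz, hyz.2.2.2.1])
      have h8 := C.τ_map b y'
      have h9 := C.τ_map r z'
      have h10 := C.τ_mem hy'
      have h11 := C.τ_mem hz'
      rw [hby] at h8
      rw [hrz, ← hyz.2.2.2.2] at h9
      rcases nat_add_unit_cases h10.1 h10.2 h11.1 h11.2 (h8.symm.trans h9) with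
        ⟨-, h12⟩ | ⟨h12, -⟩ | ⟨-, h12, h13⟩
      · exact hno y' z' ⟨hy', hz', hy'1, hr0.2, h12⟩ h8
      · have := (hcommon n hn r hr (by omega) hr0.1 (by omega)).1
        omega
      · obtain ⟨s, hs, v, hv, rfl⟩ := exists_digitMap_eq hN hD hz'
        have hs0 := (C.of_κ_map_eq_zero hv hr0.2).1
        have hs1 := (C.of_τ_map_eq_one hv h13).1
        -- The contact of `b` and `r`, raised by one row, is a contact of `n` and `e`. Pinning it in
        -- `b` puts the upper right corner into the carpet; together with `s` the top row then has
        -- both outer columns, so `b` would be in the top row, below `n`.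
        have hkey : C.Pair D (digitMap N n y') (digitMap N e (digitMap N s v)) := by
          refine ⟨digitMap_mem_carpet hN hn hy', digitMap_mem_carpet hN he hz', ?_, ?_, ?_⟩
          · apply mul_left_cancel₀ hN0
            rw [C.κ_map, hy'1, mul_one]
            have : C.kd n + 1 = N := by omega
            exact_mod_cast this
          · apply mul_left_cancel₀ hN0
            rw [C.κ_map, hr0.2, he0]; simp
          · apply mul_left_cancel₀ hN0
            rw [C.τ_map, C.τ_map, h12, h13, htn, ← hme, hmb]; push_cast; ring
        obtain ⟨x, hx, hbx⟩ := hpin _ _ hkey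
        have h14 := C.td_cases hx hy' hbx
        have hx1 : C.τ x = 1 := by
          rcases h14 with h | h | h
          · omega
          · exact h.2.1
          · omega
        have hxκ := (C.of_κ_map_eq_one hx (by rw [hbx, hkey.2.2.1])).2
        obtain ⟨d, hd, x', hx', rfl⟩ := exists_digitMap_eq hN hD hx
        have h15 := (C.of_κ_map_eq_one hx' hxκ).1
        have h16 := (C.of_τ_map_eq_one hx' hx1).1
        have := (hcommon d hd s hs h15 hs0 (by omega)).1
        omega

/-- If all contacts were diagonal they would be corners. The subcell `e` cannot reach two opposite
sides, so only one corner would remain, against `hnd`. -/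
theorem exists_edge_touch (hN : 2 ≤ N) {a e : Fin N × Fin N}
    (hnd : ∀ y, ∃ y' ∈ touchSet N D a, y' ≠ y)
    (hpin : touchSet N D a ⊆ digitMap N e '' carpet N D) :
    ∃ n ∈ D, ∃ y ∈ carpet N D, ∃ z ∈ carpet N D, digitMap N n z = digitMap N a y ∧
      ((C.kd n = C.kd a ∧ C.td n ≠ C.td a) ∨ (C.td n = C.td a ∧ C.kd n ≠ C.kd a)) := by
  by_contra hno
  have hcorner : ∀ y ∈ touchSet N D a, (C.κ y = 0 ∨ C.κ y = 1) ∧ (C.τ y = 0 ∨ C.τ y = 1) := by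
    rintro y ⟨hy, n, hn, hna, z, hz, hzy⟩
    have h1 := C.digit_cases hz hy hzy
    have h2 := C.td_cases hz hy hzy
    have h3 : C.kd n ≠ C.kd a := fun h => hno ⟨n, hn, y, hy, z, hz, hzy,
      Or.inl ⟨h, fun h' => hna (C.ext_digit _ _ h h')⟩⟩
    have h4 : C.td n ≠ C.td a := fun h => hno ⟨n, hn, y, hy, z, hz, hzy,
      Or.inr ⟨h, h3⟩⟩
    constructor
    · rcases h1 with h | h | h
      · exact absurd h.1 h3
      · exact Or.inl h.2.2
      · exact Or.inr h.2.2
    · rcases h2 with h | h | h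
      · exact absurd h.1 h4
      · exact Or.inl h.2.2
      · exact Or.inr h.2.2
  have key : ∀ C' : Chart N, ∀ y ∈ touchSet N D a, ∀ y' ∈ touchSet N D a,
      C'.κ y = 0 → C'.κ y' = 1 → False := by
    intro C' y hy y' hy' h h'
    obtain ⟨u, hu, rfl⟩ := hpin hy
    obtain ⟨u', hu', rfl⟩ := hpin hy'
    have h1 := (C'.of_κ_map_eq_zero hu h).1
    have h2 := (C'.of_κ_map_eq_one hu' h').1
    omega
  obtain ⟨y, hy, -⟩ := hnd 0
  obtain ⟨y', hy', hne⟩ := hnd y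
  obtain ⟨h1, h2⟩ := hcorner y hy
  obtain ⟨h3, h4⟩ := hcorner y' hy'
  refine hne (C.ext_point _ _ ?_ ?_)
  · rcases h1 with h1 | h1 <;> rcases h3 with h3 | h3
    · rw [h1, h3]
    · exact (key C y hy y' hy' h1 h3).elim
    · exact (key C y' hy' y hy h3 h1).elim
    · rw [h1, h3]
  · rcases h2 with h2 | h2 <;> rcases h4 with h4 | h4
    · rw [h2, h4]
    · exact (key C.swap y hy y' hy' h2 h4).elim
    · exact (key C.swap y' hy' y hy h4 h2).elim
    · rw [h2, h4]

/-- The height of a pinched touching set determines a digit. -/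
theorem exists_touch_fixed (hN : 2 ≤ N) {a a' e : Fin N × Fin N}
    (hnd : ∀ y, ∃ y' ∈ touchSet N D a, y' ≠ y) (ha' : a' ∈ D) (he : e ∈ D)
    (hka : C.kd a' = C.kd a + 1) (hta : C.td a' = C.td a) {y₀ z₀ : ℝ × ℝ}
    (h0 : C.Pair D y₀ z₀) (hae : touchSet N D a ⊆ digitMap N e '' carpet N D) :
    ∃ y ∈ touchSet N D a, ((N : ℝ) - 1) * C.τ y = C.td e := by
  have hpin : ∀ y z, C.Pair D y z → y ∈ digitMap N e '' carpet N D :=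
    fun y z h => hae (h.left_mem_touchSet hN ha' hka hta)
  have he1 : C.kd e + 1 = N := by
    obtain ⟨u, hu, hu'⟩ := hpin y₀ z₀ h0
    exact (C.of_κ_map_eq_one hu (by rw [hu', h0.2.2.1])).1
  by_cases huniq : ∀ y z, C.Pair D y z → C.τ y = C.τ y₀
  · obtain ⟨y, hy, -, m, hm, z, hz, hmz, htm, -⟩ :=
      C.exists_touch_off_row hN hnd hae he1 h0.2.2.1 huniq
    obtain ⟨u, hu, hu'⟩ := hae hy
    refine ⟨y, hy, ?_⟩
    rcases C.td_cases hz hy.1 hmz with h | h | h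
    · exact absurd h.1 htm
    · rw [h.2.2, (C.of_τ_map_eq_zero hu (by rw [hu', h.2.2])).1]; simp
    · rw [h.2.2, mul_one, sub_eq_iff_eq_add]
      have := (C.of_τ_map_eq_one hu (by rw [hu', h.2.2])).1
      exact_mod_cast this.symm
  · push Not at huniq
    obtain ⟨y₁, z₁, h1, hne⟩ := huniq
    obtain ⟨m, hm, m', hm', h2, h3, h4⟩ :=
      C.exists_common_digit hN ⟨e, he⟩ he he1 hpin h1 h0 hne
    obtain ⟨y, z, hyz, h5⟩ := C.exists_pair_of_common_digit hN hm hm' h2 h3 h4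
    refine ⟨y, hyz.left_mem_touchSet hN ha' hka hta, ?_⟩
    obtain ⟨u, hu, rfl⟩ := hpin y z hyz
    rw [(C.td_eq_of_fixed hu h5 hyz.1).1, h5]

/-- The contact on the right side puts all letters of `w` into the last column, and
`exists_touch_fixed` puts them into one row. So `w` is constant and its last letter pins `a` as
well. The neighbour of this letter along an edge is then opposite or perpendicular to the contact of
`a`. -/
theorem not_pinched_of_pair (hN : 2 ≤ N) (hD2 : D.card < N ^ 2)
    (hnd : ∀ a ∈ D, ∀ y, ∃ y' ∈ touchSet N D a, y' ≠ y) {a a' c : Fin N × Fin N}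
    (ha : a ∈ D) (ha' : a' ∈ D) (hc : c ∈ D)
    (hka : C.kd a' = C.kd a + 1) (hta : C.td a' = C.td a) {y₀ z₀ : ℝ × ℝ}
    (h0 : C.Pair D y₀ z₀) {k : ℕ} (w : Fin (k + 1) → D)
    (haw : touchSet N D a ⊆ cell N D (k + 1) w)
    (hbc : touchSet N D (w (Fin.last k)) ⊆ digitMap N c '' carpet N D) : False := by
  have hae : touchSet N D a ⊆ digitMap N (w 0) '' carpet N D := by
    refine haw.trans ?_
    rw [cell_succ]
    exact Set.image_mono (cell_subset_carpet hN D _ _)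
  obtain ⟨y, hy, hyτ⟩ := C.exists_touch_fixed hN (hnd a ha) ha' (w 0).2 hka hta h0 hae
  have h1 : C.td (w (Fin.last k)) = C.td (w 0) :=
    C.td_eq_of_fixed_of_mem_cell hN (haw hy) hyτ (Fin.last k)
  have h2 : ∀ m, C.kd (w m) = N - 1 := by
    refine fun m => C.swap.td_eq_of_fixed_of_mem_cell hN
      (haw (h0.left_mem_touchSet hN ha' hka hta)) ?_ m
    show _ * C.κ y₀ = _
    rw [h0.2.2.1, Nat.cast_sub (by omega)]; simp
  have hb : w (Fin.last k) = w 0 := Subtype.ext (C.ext_digit _ _ ((h2 _).trans (h2 _).symm) h1)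
  have hbD := (w (Fin.last k)).2
  have hkb := h2 (Fin.last k)
  rw [← hb] at hae
  generalize ((w (Fin.last k) : D) : Fin N × Fin N) = b at *
  obtain ⟨n, hn, y, hy, z, hz, hnz, h | h⟩ := C.exists_edge_touch hN (hnd b hbD) hbc
  · rcases C.td_cases hz hy hnz with h' | h' | h'
    · exact h.2 h'.1
    · have hbN := C.td_lt b
      refine C.flipSnd.not_perpendicular hN hD2 hnd ha ha' hbD hc hn hka
        (show N - 1 - C.td a' = N - 1 - C.td a by rw [hta]) h.1
        (show N - 1 - C.td n = N - 1 - C.td b + 1 by omega) h0.flipSnd hae hbc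
    · exact C.not_perpendicular hN hD2 hnd ha ha' hbD hc hn hka hta h.1 h'.1 h0 hae hbc
  · have hnN := C.kd_lt n
    rcases C.digit_cases hz hy hnz with h' | h' | h'
    · exact h.2 h'.1
    · exact C.not_opposite hN hD2 hnd ha ha' hbD hn hc hka hta h'.1 h.1 h0 hae hbc
    · omega

end

end Chart

/-- Two consecutive pinched cells do not occur if every cell is touched in two points. -/
theorem not_pinched_pinched {N : ℕ} (hN : 2 ≤ N) {D : Finset (Fin N × Fin N)}
    (hD2 : D.card < N ^ 2) (hnd : ∀ a ∈ D, ∀ y, ∃ y' ∈ touchSet N D a, y' ≠ y)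
    {a c : Fin N × Fin N} (ha : a ∈ D) (hc : c ∈ D) {k : ℕ} (w : Fin (k + 1) → D)
    (haw : touchSet N D a ⊆ cell N D (k + 1) w)
    (hbc : touchSet N D (w (Fin.last k)) ⊆ digitMap N c '' carpet N D) : False := by
  have hae : touchSet N D a ⊆ digitMap N (w 0) '' carpet N D := by
    refine haw.trans ?_
    rw [cell_succ]
    exact Set.image_mono (cell_subset_carpet hN D _ _)
  obtain ⟨C⟩ : Nonempty (Chart N) := ⟨Chart.std hN⟩
  have key : ∀ C : Chart N, ∀ n ∈ D, ∀ y ∈ carpet N D, ∀ z ∈ carpet N D,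
      digitMap N n z = digitMap N a y → C.td n = C.td a → C.kd n ≠ C.kd a → False := by
    intro C n hn y hy z hz hnz ht hk
    have hτ : C.τ z = C.τ y := by
      rcases C.td_cases hz hy hnz with h | h | h
      · exact h.2
      · omega
      · omega
    rcases C.digit_cases hz hy hnz with h | h | h
    · exact hk h.1
    · have hka := C.kd_lt a
      refine C.flip.not_pinched_of_pair hN hD2 hnd ha hn hc
        (show N - 1 - C.kd n = N - 1 - C.kd a + 1 by omega) ht (y₀ := y) (z₀ := z)
        ⟨hy, hz, ?_, ?_, hτ.symm⟩ w haw hbc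
      · show 1 - C.κ y = 1
        rw [h.2.2, sub_zero]
      · show 1 - C.κ z = 0
        rw [h.2.1, sub_self]
    · exact C.not_pinched_of_pair hN hD2 hnd ha hn hc h.1 ht
        ⟨hy, hz, h.2.2, h.2.1, hτ.symm⟩ w haw hbc
  obtain ⟨n, hn, y, hy, z, hz, hnz, h | h⟩ := C.exists_edge_touch hN (hnd a ha) hae
  · exact key C.swap n hn y hy z hz hnz h.1 h.2
  · exact key C n hn y hy z hz hnz h.1 h.2

/-! ### Unique addresses and the digit graph. -/

/-- The point `z` lies in at most one cell of each level. -/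
def UniqueAddress (N : ℕ) (D : Finset (Fin N × Fin N)) (z : ℝ × ℝ) : Prop :=
  ∀ (k : ℕ) (v v' : Fin k → D), z ∈ cell N D k v → z ∈ cell N D k v' → v = v'

/-- The graph on the digits in which two digits are joined if their cells meet. -/
def digitGraph (N : ℕ) (D : Finset (Fin N × Fin N)) : SimpleGraph D where
  Adj i j := i ≠ j ∧ (digitMap N i '' carpet N D ∩ digitMap N j '' carpet N D).Nonempty
  symm := ⟨fun _ _ h => ⟨h.1.symm, by rw [Set.inter_comm]; exact h.2⟩⟩
  loopless := ⟨fun _ h => h.1 rfl⟩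

theorem digitGraph_preconnected {N : ℕ} (hN : 2 ≤ N) {D : Finset (Fin N × Fin N)}
    (hD : D.Nonempty) (hF : IsConnected (carpet N D)) : (digitGraph N D).Preconnected := by
  intro u v
  have hne : ∀ d : D, (carpet N D ∩ digitMap N d '' carpet N D).Nonempty := fun d => by
    obtain ⟨y, hy⟩ := hF.nonempty
    exact ⟨_, digitMap_mem_carpet hN d.2 hy, y, hy, rfl⟩
  refine reachable_of_cover (digitGraph N D) (fun d => digitMap N d '' carpet N D)
    (fun d => ((isCompact_carpet N D).image (digitMap_continuous N d)).isClosed)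
    (fun a b hab h => ⟨hab, h⟩) hF.isPreconnected ?_ (hne u) (hne v)
  intro x hx
  obtain ⟨i, hi, z, hz, rfl⟩ := exists_digitMap_eq hN hD hx
  exact Set.mem_iUnion.2 ⟨⟨i, hi⟩, z, hz, rfl⟩

/-- In a connected graph, each part that is left after deleting a vertex is joined to it. -/
theorem exists_avoidReach_adj {V : Type*} {G : SimpleGraph V} (hG : G.Preconnected) {c u : V}
    (hu : u ≠ c) : ∃ d, AvoidReach G c u d ∧ G.Adj d c := by
  by_contra hno
  push Not at hno
  have : c ∈ {d | AvoidReach G c u d} := by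
    refine (hG u c).induct_mem ?_ (AvoidReach.refl hu)
    intro d e hde hd
    have hec : e ≠ c := by rintro rfl; exact hno d hd hde
    exact hd.trans (AvoidReach.of_adj hd.2.1 hec hde)
  exact this.2.1 rfl

namespace Chart

section

variable {N : ℕ} {D : Finset (Fin N × Fin N)} (C : Chart N)

theorem of_κ_wordMap_eq_zero {k : ℕ} {w : Fin k → D} {z : ℝ × ℝ} (hz : z ∈ carpet N D)
    (h : C.κ (wordMap N D k w z) = 0) : C.kw k w = 0 ∧ C.κ z = 0 := by
  have h1 := C.κ_wordMap k w z
  rw [h, mul_zero] at h1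
  have h2 := (C.κ_mem hz).1
  have h3 : (0 : ℝ) ≤ C.kw k w := by positivity
  have h4 : (C.kw k w : ℝ) = 0 := by linarith
  exact ⟨by exact_mod_cast h4, by linarith⟩

theorem of_κ_wordMap_eq_one {k : ℕ} {w : Fin k → D} {z : ℝ × ℝ} (hz : z ∈ carpet N D)
    (h : C.κ (wordMap N D k w z) = 1) : C.kw k w + 1 = N ^ k ∧ C.κ z = 1 := by
  have h1 := C.κ_wordMap k w z
  rw [h, mul_one] at h1
  have h2 := (C.κ_mem hz).2
  have h3 : (C.kw k w : ℝ) + 1 ≤ (N : ℝ) ^ k := by exact_mod_cast C.kw_lt k w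
  have h4 : (C.kw k w : ℝ) + 1 = (N : ℝ) ^ k := by linarith
  exact ⟨by exact_mod_cast h4, by linarith⟩

/-- The numbers 0 and 1 have a single expansion with digits below N: all digits 0, or all digits
N-1. -/
theorem kw_eq_of_side {y : ℝ × ℝ} (h : C.κ y = 0 ∨ C.κ y = 1) {k : ℕ}
    {v v' : Fin k → D} (hv : y ∈ cell N D k v) (hv' : y ∈ cell N D k v') :
    C.kw k v = C.kw k v' := by
  obtain ⟨a, ha, rfl⟩ := hv
  obtain ⟨b, hb, hba⟩ := hv'
  rcases h with h | h
  · rw [(C.of_κ_wordMap_eq_zero ha h).1, (C.of_κ_wordMap_eq_zero hb (by rw [hba, h])).1]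
  · have h1 := (C.of_κ_wordMap_eq_one ha h).1
    have h2 := (C.of_κ_wordMap_eq_one hb (by rw [hba, h])).1
    omega

theorem uniqueAddress_of_corner {y : ℝ × ℝ} (h : C.κ y = 0 ∨ C.κ y = 1)
    (h' : C.τ y = 0 ∨ C.τ y = 1) : UniqueAddress N D y :=
  fun _ _ _ hv hv' => C.word_ext (C.kw_eq_of_side h hv hv') (C.swap.kw_eq_of_side h' hv hv')

theorem exists_digit_fixing_corner (hN : 2 ≤ N) (hD : D.Nonempty) {y : ℝ × ℝ}
    (hy : y ∈ carpet N D) (h : C.κ y = 0 ∨ C.κ y = 1) (h' : C.τ y = 0 ∨ C.τ y = 1) :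
    ∃ c ∈ D, digitMap N c y = y := by
  obtain ⟨c, hc, z, hz, hzy⟩ := exists_digitMap_eq hN hD hy
  refine ⟨c, hc, ?_⟩
  have key : ∀ C' : Chart N, (C'.κ y = 0 ∨ C'.κ y = 1) → C'.κ z = C'.κ y := by
    rintro C' (h | h)
    · rw [(C'.of_κ_map_eq_zero hz (by rw [hzy, h])).2, h]
    · rw [(C'.of_κ_map_eq_one hz (by rw [hzy, h])).2, h]
  rw [← C.ext_point z y (key C h) (key C.swap h'), hzy,
    C.ext_point z y (key C h) (key C.swap h')]

end

end Chart

section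

variable {N : ℕ} {D : Finset (Fin N × Fin N)}

/-- A cell of level one does not meet the subcell of another one with the same digit twice. -/
theorem not_mem_same_subcell (hN : 2 ≤ N) {c n : Fin N × Fin N} (hnc : n ≠ c) {y z : ℝ × ℝ}
    (hy : y ∈ carpet N D) (hz : z ∈ carpet N D) (hnz : digitMap N n z = digitMap N c y) :
    y ∉ digitMap N c '' carpet N D := by
  rintro ⟨u, hu, rfl⟩
  obtain ⟨C⟩ : Nonempty (Chart N) := ⟨Chart.std hN⟩
  -- If `y` lay in the subcell of `c`, a contact across a side would put `c` next to that side of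
  -- the square, leaving no room for `n`.
  have key : ∀ C' : Chart N, C'.kd n = C'.kd c := by
    intro C'
    have hlt := C'.kd_lt n
    rcases C'.digit_cases hz hy hnz with h1 | h1 | h1
    · exact h1.1
    · have h2 := (C'.of_κ_map_eq_zero hu h1.2.2).1
      omega
    · have h2 := (C'.of_κ_map_eq_one hu h1.2.2).1
      omega
  exact hnc (C.ext_digit _ _ (key C) (key C.swap))

/-- From length two on, contacts between different blocks never use the word c...c, by
`not_mem_same_subcell`; so the blocks stay linked, and inside the block of `c` the induction
applies. The hypothesis on the digit graph is needed for length one. -/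
theorem deleteVertex_const_preconnected (hN : 2 ≤ N) (hF : IsConnected (carpet N D)) {c : D}
    (hc : (deleteVertex (digitGraph N D) c).Preconnected) (k : ℕ) :
    (deleteVertex (hataGraph N D k) (fun _ => c)).Preconnected := by
  have hD : D.Nonempty := ⟨c, c.2⟩
  induction k with
  | zero =>
    rintro ⟨u, hu⟩ -
    exact absurd (Subsingleton.elim u _) hu
  | succ k ih =>
    have hw : (fun _ => c : Fin (k + 1) → D) = Fin.cons c (fun _ => c) := by
      funext m; refine Fin.cases ?_ (fun m => ?_) m <;> simp
    suffices hsuff : ∀ u v : Fin (k + 1) → D, u ≠ (fun _ => c) → v ≠ (fun _ => c) →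
        AvoidReach (hataGraph N D (k + 1)) (fun _ => c) u v by
      rintro ⟨u, hu⟩ ⟨v, hv⟩
      obtain ⟨_, _, h⟩ := hsuff u v hu hv
      exact h
    intro u v hu hv
    cases k with
    | zero =>
      have hone : ∀ a : Fin (0 + 1) → D, a = fun _ => a 0 := by
        intro a; funext m; rw [Fin.fin_one_eq_zero m]
      have hne : ∀ a : Fin (0 + 1) → D, a ≠ (fun _ => c) → a 0 ≠ c := by
        intro a ha h0
        exact ha (by rw [hone a, h0])
      have hne' : ∀ d : D, d ≠ c → (fun _ => d : Fin (0 + 1) → D) ≠ (fun _ => c) :=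
        fun d hd h => hd (congrFun h 0)
      have hr : AvoidReach (digitGraph N D) c (u 0) (v 0) := ⟨hne u hu, hne v hv, hc _ _⟩
      have := (hr.mem (S := {d | d ≠ c ∧
        AvoidReach (hataGraph N D (0 + 1)) (fun _ => c) u (fun _ => d)}) ?_
        ⟨hne u hu, by rw [← hone u]; exact AvoidReach.refl hu⟩).2
      · rwa [← hone v] at this
      · rintro a b ha hb hab ⟨-, hra⟩
        refine ⟨hb, hra.trans (AvoidReach.of_adj (hne' a ha) (hne' b hb) ?_)⟩
        rw [hataGraph_adj, cell_succ, cell_succ, cell_zero, cell_zero]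
        exact ⟨fun h => hab.1 (congrFun h 0), hab.2⟩
    | succ k =>
      have same : ∀ a b : Fin (k + 1 + 1) → D, a ≠ (fun _ => c) → b ≠ (fun _ => c) → b 0 = a 0 →
          AvoidReach (hataGraph N D (k + 1 + 1)) (fun _ => c) a b := by
        intro a b ha hb hab
        by_cases hac : a 0 = c
        · have htail : ∀ e : Fin (k + 1 + 1) → D, e ≠ (fun _ => c) → e 0 = c →
              e = Fin.cons c (Fin.tail e) ∧ Fin.tail e ≠ (fun _ => c) := by
            intro e he hec
            have h1 : e = Fin.cons c (Fin.tail e) := by rw [← hec, Fin.cons_self_tail]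
            exact ⟨h1, fun h2 => he (by rw [h1, h2, hw])⟩
          obtain ⟨h1, h2⟩ := htail a ha hac
          obtain ⟨h3, h4⟩ := htail b hb (hab.trans hac)
          rw [h1, h3, hw]
          exact avoidReach_cons_of_avoidReach ⟨h2, h4, ih _ _⟩
        · exact avoidReach_of_head_eq hN hD hF hac hab
      have hword : ∀ d e : D, d ≠ e → ∀ y ∈ carpet N D, ∀ z ∈ carpet N D,
          digitMap N d y = digitMap N e z → ∃ a : Fin (k + 1 + 1) → D, a 0 = d ∧
            a ≠ (fun _ => c) ∧ digitMap N d y ∈ cell N D (k + 1 + 1) a := by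
        intro d e hde y hy z hz hyz
        obtain ⟨t, ht⟩ := exists_mem_cell hN hD (k + 1) hy
        refine ⟨Fin.cons d t, by simp, ?_, by rw [cell_cons]; exact ⟨y, ht, rfl⟩⟩
        intro h1
        have hdc : d = c := by simpa using congrFun h1 0
        have htc : t 0 = c := by simpa using congrFun h1 1
        subst hdc
        refine not_mem_same_subcell hN (n := e)
          (fun h => hde (Subtype.ext h.symm)) hy hz hyz.symm ?_
        rw [cell_succ, htc] at ht
        exact Set.image_mono (cell_subset_carpet hN D _ _) ht
      refine (digitGraph_preconnected hN hD hF (u 0) (v 0)).induct_mem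
        (S := {d | ∀ a : Fin (k + 1 + 1) → D, a 0 = d → a ≠ (fun _ => c) →
          AvoidReach (hataGraph N D (k + 1 + 1)) (fun _ => c) u a}) ?_
        (fun a ha hac => same u a hu hac ha) v rfl hv
      rintro d e ⟨hde, _, ⟨y, hy, rfl⟩, z, hz, hzy⟩ hd b hb hbc
      obtain ⟨a₁, h1, h2, h3⟩ := hword d e hde y hy z hz hzy.symm
      obtain ⟨a₂, h4, h5, h6⟩ := hword e d hde.symm z hz y hy hzy
      rw [hzy] at h6
      refine ((hd a₁ h1 h2).trans (AvoidReach.of_adj h2 h5 ?_)).trans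
        (same a₂ b h5 hbc (hb.trans h4.symm))
      exact ⟨fun h => hde (by rw [← h1, ← h4, h]), _, h3, h6⟩

end

/-! ### Fragile carpets. -/

/-- `P` splits the digits into two parts whose cells have at most the point `x` in common. -/
structure IsFragileAt (N : ℕ) (D : Finset (Fin N × Fin N)) (P : Set (Fin N × Fin N))
    (x : ℝ × ℝ) : Prop where
  exists_mem : ∃ i ∈ D, i ∈ P
  exists_notMem : ∃ i ∈ D, i ∉ P
  eq_of_touch : ∀ i ∈ D, ∀ j ∈ D, i ∈ P → j ∉ P → ∀ y ∈ carpet N D, ∀ z ∈ carpet N D,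
    digitMap N i y = digitMap N j z → digitMap N i y = x

theorem IsFragileAt.compl {N : ℕ} {D : Finset (Fin N × Fin N)} {P : Set (Fin N × Fin N)}
    {x : ℝ × ℝ} (h : IsFragileAt N D P x) : IsFragileAt N D Pᶜ x where
  exists_mem := h.exists_notMem
  exists_notMem := by
    obtain ⟨i, hi, hiP⟩ := h.exists_mem
    exact ⟨i, hi, fun h => h hiP⟩
  eq_of_touch i hi j hj hiP hjP y hy z hz hyz := by
    rw [hyz]
    exact h.eq_of_touch j hj i hi (not_not.1 hjP) hiP z hz y hy hyz.symm

section

variable {N : ℕ} {D : Finset (Fin N × Fin N)} {P : Set (Fin N × Fin N)} {x : ℝ × ℝ}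

/-- All contacts between the classes run through `x`. Outside `P` only the cell of `i` contains `x`,
and since `z` has a unique address a single word there does; deleting it cuts off the block of `j`
from `P`. -/
theorem IsFragileAt.pow_le_chi (h : IsFragileAt N D P x) (hN : 2 ≤ N)
    (hF : IsConnected (carpet N D)) {i j : Fin N × Fin N} (hi : i ∈ D) (hj : j ∈ D)
    (hjP : j ∉ P) (hji : j ≠ i) {z : ℝ × ℝ} (hz : z ∈ carpet N D)
    (hx : digitMap N i z = x) (hzu : UniqueAddress N D z)
    (hu : ∀ m ∈ D, m ∉ P → x ∈ digitMap N m '' carpet N D → m = i) (hiP : i ∉ P) (k : ℕ) :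
    D.card ^ k - 1 ≤ chi (hataGraph N D (k + 1)) := by
  refine (Nat.sub_le _ _).trans ?_
  have hD : D.Nonempty := ⟨i, hi⟩
  obtain ⟨p, hp, hpP⟩ := h.exists_mem
  obtain ⟨t, ht⟩ := exists_mem_cell hN hD k hz
  refine pow_le_chi_of_separation hN hF (Fin.cons ⟨i, hi⟩ t) {v | ((v 0 : D) : Fin N × Fin N) ∈ P}
    ?_ (p := ⟨p, hp⟩) (p' := ⟨j, hj⟩) ?_ ?_ ?_ ?_
  · rintro u v - hv ⟨-, _, hu', hv'⟩ huP
    by_contra hvP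
    replace huP : ((u 0 : D) : Fin N × Fin N) ∈ P := huP
    replace hvP : ((v 0 : D) : Fin N × Fin N) ∉ P := hvP
    change _ ∈ cell N D (k + 1) u at hu'
    change _ ∈ cell N D (k + 1) v at hv'
    rw [cell_succ] at hu' hv'
    obtain ⟨a, ha, rfl⟩ := hu'
    obtain ⟨b, hb, hba⟩ := hv'
    have haF := cell_subset_carpet hN D _ _ ha
    have hbF := cell_subset_carpet hN D _ _ hb
    have h1 := h.eq_of_touch _ (u 0).2 _ (v 0).2 huP hvP a haF b hbF hba.symm
    rw [← hba] at h1
    have h2 := hu _ (v 0).2 hvP ⟨b, hbF, h1⟩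
    rw [h2, ← hx] at h1
    rw [digitMap_injective hN i h1] at hb
    apply hv
    rw [← Fin.cons_self_tail v, hzu k _ _ ht hb]
    congr 1
    exact Subtype.ext h2
  · intro h1
    rw [Fin.cons_zero] at h1
    exact hiP (Subtype.mk.inj h1 ▸ hpP)
  · intro h1
    rw [Fin.cons_zero] at h1
    exact hji (congrArg Subtype.val h1)
  · intro u hu
    show ((u 0 : D) : Fin N × Fin N) ∈ P
    rw [hu]; exact hpP
  · intro u hu
    show ((u 0 : D) : Fin N × Fin N) ∉ P
    rw [hu]; exact hjP

/-- The case in which the class of the deleted word is the single digit `i`. The address of the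
corner `z` is constant, so the rest of the block is connected by `deleteVertex_const_preconnected`.
-/
theorem IsFragileAt.pow_le_chi_of_corner (h : IsFragileAt N D P x) (C : Chart N) (hN : 2 ≤ N)
    (hF : IsConnected (carpet N D)) {i j : Fin N × Fin N} (hi : i ∈ D) (hj : j ∈ D)
    (hiP : i ∈ P) (hjP : j ∉ P) (hall : ∀ m ∈ D, m ∈ P → m = i) {z : ℝ × ℝ}
    (hz : z ∈ carpet N D) (hx : digitMap N i z = x) (hκ : C.κ z = 0 ∨ C.κ z = 1)
    (hτ : C.τ z = 0 ∨ C.τ z = 1) {c : D} (hcz : digitMap N c z = z)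
    (hc : (deleteVertex (digitGraph N D) c).Preconnected) (k : ℕ) :
    D.card ^ k - 1 ≤ chi (hataGraph N D (k + 1)) := by
  have ht : ∀ k, z ∈ cell N D k (fun _ => c) := by
    intro k
    induction k with
    | zero => rwa [cell_zero]
    | succ k ih => rw [cell_succ]; exact ⟨z, ih, hcz⟩
  refine pow_sub_one_le_chi_of_separation hN hF ⟨i, hi⟩ (fun _ => c)
    (deleteVertex_const_preconnected hN hF hc k)
    {v | ((v 0 : D) : Fin N × Fin N) ∈ P} ?_ (p := ⟨j, hj⟩) ?_ ?_ ?_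
  · rintro u v hu - ⟨-, _, hu', hv'⟩ huP
    by_contra hvP
    replace huP : ((u 0 : D) : Fin N × Fin N) ∈ P := huP
    replace hvP : ((v 0 : D) : Fin N × Fin N) ∉ P := hvP
    change _ ∈ cell N D (k + 1) u at hu'
    change _ ∈ cell N D (k + 1) v at hv'
    rw [cell_succ] at hu' hv'
    obtain ⟨a, ha, rfl⟩ := hu'
    obtain ⟨b, hb, hba⟩ := hv'
    have haF := cell_subset_carpet hN D _ _ ha
    have hbF := cell_subset_carpet hN D _ _ hb
    have h1 := h.eq_of_touch _ (u 0).2 _ (v 0).2 huP hvP a haF b hbF hba.symm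
    have h2 := hall _ (u 0).2 huP
    rw [h2, ← hx] at h1
    rw [digitMap_injective hN i h1] at ha
    apply hu
    rw [← Fin.cons_self_tail u, C.uniqueAddress_of_corner hκ hτ k _ _ ha (ht k)]
    congr 1
    exact Subtype.ext h2
  · intro h1
    exact hjP (Subtype.mk.inj h1 ▸ hiP)
  · intro u hu
    show ((u 0 : D) : Fin N × Fin N) ∈ P
    rw [hu]; exact hiP
  · intro u hu
    show ((u 0 : D) : Fin N × Fin N) ∉ P
    rw [hu]; exact hjP

end

namespace Chart

section

variable {N : ℕ} {D : Finset (Fin N × Fin N)} {P : Set (Fin N × Fin N)} {x : ℝ × ℝ}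
  (C : Chart N)

/-- The part of the digit graph that is cut off by the digit `c` of the corner `(1, 0)`, and that
does not contain the neighbour above `c`, is attached to the cell of `c` in one corner of it. -/
theorem pow_le_chi_of_cut_digit (hN : 2 ≤ N) (hF : IsConnected (carpet N D)) {c u v : D}
    (huc : u ≠ c) (hvc : v ≠ c) (huv : ¬ AvoidReach (digitGraph N D) c u v)
    (hkc : C.kd c + 1 = N) (htc : C.td c = 0) {y z : ℝ × ℝ} (hyz : C.Pair D y z)
    (hz0 : C.τ z = 0) (huniq : ∀ y' z', C.Pair D y' z' → z' = z)
    (hfree : ∀ d, AvoidReach (digitGraph N D) c u d → C.kd d = C.kd c → C.td d ≠ 1) (k : ℕ) :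
    D.card ^ k - 1 ≤ chi (hataGraph N D (k + 1)) := by
  have hD : D.Nonempty := ⟨c, c.2⟩
  have hG := digitGraph_preconnected hN hD hF
  have hneg : ∀ d : D, d ≠ c → C.kd d = C.kd c → C.td d ≠ C.td c :=
    fun d hd h h' => hd (Subtype.ext (C.ext_digit _ _ h h'))
  -- The corner cell `c` has at most three neighbours: above, to the left, and diagonally above
  -- left.
  have hcase : ∀ d : D, d ≠ c → ∀ a ∈ carpet N D, ∀ b ∈ carpet N D,
      digitMap N d a = digitMap N c b →
      (C.kd d = C.kd c ∧ C.td d = 1) ∨ (C.kd c = C.kd d + 1 ∧ C.td d = 0 ∧ b = z) ∨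
        (C.kd c = C.kd d + 1 ∧ C.td d = 1 ∧ C.κ b = 0 ∧ C.τ b = 1) := by
    intro d hd a ha b hb hab
    have hlt := C.kd_lt d
    rcases C.digit_cases ha hb hab with h | h | h
    · left
      rcases C.td_cases ha hb hab with h' | h' | h'
      · exact absurd h'.1 (hneg d hd h.1)
      · omega
      · exact ⟨h.1, by omega⟩
    · right
      rcases C.td_cases ha hb hab with h' | h' | h'
      · exact Or.inl ⟨h.1, by omega, huniq a b ⟨ha, hb, h.2.1, h.2.2, h'.2⟩⟩
      · omega
      · exact Or.inr ⟨h.1, by omega, h.2.2, h'.2.2⟩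
    · omega
  -- If the part of `u` contained both the left and the diagonal neighbour, then the neighbour
  -- through which the part of `v` reaches `c` would be one of these, or the cell above `c`, which
  -- touches the diagonal one through the pair `y`, `z`.
  have hnot : ∀ d₁ d₃ : D, AvoidReach (digitGraph N D) c u d₁ →
      AvoidReach (digitGraph N D) c u d₃ → C.kd c = C.kd d₁ + 1 → C.td d₁ = 0 →
      C.kd c = C.kd d₃ + 1 → C.td d₃ = 1 → False := by
    intro d₁ d₃ h1 h3 hk1 ht1 hk3 ht3
    obtain ⟨e, he, hec, _, ⟨a, ha, rfl⟩, b, hb, hba⟩ := exists_avoidReach_adj hG hvc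
    rcases hcase e hec a ha b hb hba.symm with h | h | h
    · refine huv ((h3.trans (AvoidReach.of_adj h3.2.1 hec ⟨?_, ?_⟩)).trans he.symm)
      · rintro rfl; omega
      · refine ⟨digitMap N d₃ y, ⟨y, hyz.1, rfl⟩, z, hyz.2.1, ?_⟩
        exact (hyz.digitMap_eq hN (by omega) (by omega)).symm
    · have : e = d₁ := Subtype.ext (C.ext_digit _ _ (by omega) (by omega))
      exact huv (h1.trans (this ▸ he.symm))
    · have : e = d₃ := Subtype.ext (C.ext_digit _ _ (by omega) (by omega))
      exact huv (h3.trans (this ▸ he.symm))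
  obtain ⟨d₀, hd₀, hd₀c, _, ⟨a₀, ha₀, rfl⟩, b₀, hb₀, hab₀⟩ := exists_avoidReach_adj hG huc
  have h0 := hcase d₀ hd₀c a₀ ha₀ b₀ hb₀ hab₀.symm
  have hcorner : C.κ b₀ = 0 ∧ (C.τ b₀ = 0 ∨ C.τ b₀ = 1) := by
    rcases h0 with h | h | h
    · exact absurd h.2 (hfree d₀ hd₀ h.1)
    · rw [h.2.2]; exact ⟨hyz.2.2.2.1, Or.inl hz0⟩
    · exact ⟨h.2.2.1, Or.inr h.2.2.2⟩
  have hall : ∀ d : D, AvoidReach (digitGraph N D) c u d → ∀ a ∈ carpet N D, ∀ b ∈ carpet N D,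
      digitMap N d a = digitMap N c b → b = b₀ := by
    intro d hd a ha b hb hab
    rcases h0 with h | h | h
    · exact absurd h.2 (hfree d₀ hd₀ h.1)
    · rcases hcase d hd.2.1 a ha b hb hab with h' | h' | h'
      · exact absurd h'.2 (hfree d hd h'.1)
      · rw [h.2.2, h'.2.2]
      · exact (hnot d₀ d hd₀ hd h.1 h.2.1 h'.1 h'.2.1).elim
    · rcases hcase d hd.2.1 a ha b hb hab with h' | h' | h'
      · exact absurd h'.2 (hfree d hd h'.1)
      · exact (hnot d d₀ hd hd₀ h'.1 h'.2.1 h.1 h.2.1).elim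
      · exact C.ext_point _ _ (h'.2.2.1.trans h.2.2.1.symm) (h'.2.2.2.trans h.2.2.2.symm)
  let Q : Set (Fin N × Fin N) := {d | ∃ hd : d ∈ D, AvoidReach (digitGraph N D) c u ⟨d, hd⟩}
  have hQ : ∀ d ∈ Q, ∀ m (hm : m ∈ D), m ∉ Q → ∀ a ∈ carpet N D, ∀ b ∈ carpet N D,
      digitMap N d a = digitMap N m b → m = c := by
    rintro d ⟨hd, hud⟩ m hm hmQ a ha b hb hab
    by_contra hmc
    refine hmQ ⟨hm, hud.trans (AvoidReach.of_adj hud.2.1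
      (fun h => hmc (congrArg Subtype.val h)) ⟨?_, digitMap N d a, ⟨a, ha, rfl⟩, b, hb, hab.symm⟩)⟩
    intro h
    have hdm : d = m := congrArg Subtype.val h
    subst hdm
    exact hmQ ⟨hd, hud⟩
  have hcQ : (c : Fin N × Fin N) ∉ Q := fun ⟨_, h⟩ => h.2.1 rfl
  have hvQ : (v : Fin N × Fin N) ∉ Q := fun ⟨_, h⟩ => huv h
  have hfrag : IsFragileAt N D Q (digitMap N c b₀) := by
    refine ⟨⟨u, u.2, u.2, AvoidReach.refl huc⟩, ⟨c, c.2, hcQ⟩, ?_⟩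
    intro d hd m hm hdQ hmQ a ha b hb hab
    have hmc := hQ d hdQ m hm hmQ a ha b hb hab
    rw [hmc] at hab
    rw [hab, hall ⟨d, hd⟩ hdQ.2 a ha b hb hab]
  refine hfrag.pow_le_chi hN hF c.2 v.2 hvQ (fun h => hvc (Subtype.ext h)) hb₀ rfl
    (C.uniqueAddress_of_corner (Or.inl hcorner.1) hcorner.2) ?_ hcQ k
  rintro m hm hmQ ⟨b, hb, hbm⟩
  exact hQ d₀ ⟨d₀.2, hd₀⟩ m hm hmQ a₀ ha₀ b hb (hab₀.symm.trans hbm.symm)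

/-- If `P` has a second digit, the word through `x` in the block of `i` separates full blocks. If P
= {i}, the corner digit `c` decides: the block of `i` survives the deletion when `c` is no cut
vertex of the digit graph, and otherwise `c` itself gives a fragile splitting. -/
theorem pow_le_chi_of_alone (hN : 2 ≤ N) (hF : IsConnected (carpet N D))
    (h : IsFragileAt N D P x) {i j : Fin N × Fin N} (hi : i ∈ D) (hj : j ∈ D) (hiP : i ∈ P)
    (hjP : j ∉ P) (hk : C.kd j = C.kd i + 1) (ht : C.td j = C.td i) {y z : ℝ × ℝ}
    (hyz : C.Pair D y z) (hx : digitMap N i y = x) (hy0 : C.τ y = 0)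
    (halone : ∀ m ∈ D, m ∈ P → x ∈ digitMap N m '' carpet N D → m = i) (k : ℕ) :
    D.card ^ k - 1 ≤ chi (hataGraph N D (k + 1)) := by
  have hD : D.Nonempty := ⟨i, hi⟩
  have hz0 : C.τ z = 0 := by rw [← hyz.2.2.2.2, hy0]
  have huniq : ∀ y' z', C.Pair D y' z' → z' = z := by
    intro y' z' hyz'
    have h1 := hyz'.digitMap_eq hN hk ht
    have h2 := h.eq_of_touch i hi j hj hiP hjP y' hyz'.1 z' hyz'.2.1 h1
    rw [h1, ← hx, hyz.digitMap_eq hN hk ht] at h2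
    exact digitMap_injective hN j h2
  by_cases hp : ∃ p ∈ D, p ∈ P ∧ p ≠ i
  · obtain ⟨p, hp, hpP, hpi⟩ := hp
    exact h.compl.pow_le_chi hN hF hi hp (fun h => h hpP) hpi hyz.1 hx
      (C.uniqueAddress_of_corner (Or.inr hyz.2.2.1) (Or.inl hy0))
      (fun m hm hmP => halone m hm (not_not.1 hmP)) (fun h => h hiP) k
  · have hall : ∀ m ∈ D, m ∈ P → m = i := by
      intro m hm hmP
      by_contra hmi
      exact hp ⟨m, hm, hmP, hmi⟩
    obtain ⟨c, hc, hcy⟩ := C.exists_digit_fixing_corner hN hD hyz.1 (Or.inr hyz.2.2.1)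
      (Or.inl hy0)
    have hkc := (C.of_κ_map_eq_one hyz.1 (by rw [hcy, hyz.2.2.1])).1
    have htc := (C.of_τ_map_eq_zero hyz.1 (by rw [hcy, hy0])).1
    by_cases hconn : (deleteVertex (digitGraph N D) ⟨c, hc⟩).Preconnected
    · exact h.pow_le_chi_of_corner C hN hF hi hj hiP hjP hall hyz.1 hx (Or.inr hyz.2.2.1)
        (Or.inl hy0) (c := ⟨c, hc⟩) hcy hconn k
    · have : ∃ u v : ({⟨c, hc⟩}ᶜ : Set D),
          ¬ (deleteVertex (digitGraph N D) ⟨c, hc⟩).Reachable u v := by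
        by_contra hno
        push Not at hno
        exact hconn hno
      obtain ⟨⟨u, hu⟩, ⟨v, hv⟩, huv⟩ := this
      have huv' : ¬ AvoidReach (digitGraph N D) ⟨c, hc⟩ u v := fun ⟨_, _, h⟩ => huv h
      by_cases hfree : ∀ d, AvoidReach (digitGraph N D) ⟨c, hc⟩ u d → C.kd d = C.kd c → C.td d ≠ 1
      · exact C.pow_le_chi_of_cut_digit hN hF hu hv huv' hkc htc hyz hz0 huniq hfree k
      -- Only one of the two parts can contain the digit above `c`; the other one is used.
      · push Not at hfree
        obtain ⟨d, hd, hd1, hd2⟩ := hfree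
        refine C.pow_le_chi_of_cut_digit hN hF hv hu (fun h => huv' h.symm) hkc htc hyz hz0
          huniq ?_ k
        intro e he he1 he2
        have : d = e := Subtype.ext (C.ext_digit _ _ (hd1.trans he1.symm) (hd2.trans he2.symm))
        exact huv' (hd.trans (this ▸ he.symm))

theorem pow_le_chi_of_alone' (hN : 2 ≤ N) (hF : IsConnected (carpet N D))
    (h : IsFragileAt N D P x) {i j : Fin N × Fin N} (hi : i ∈ D) (hj : j ∈ D) (hiP : i ∈ P)
    (hjP : j ∉ P) (hk : C.kd j = C.kd i + 1) (ht : C.td j = C.td i) {y z : ℝ × ℝ}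
    (hyz : C.Pair D y z) (hx : digitMap N i y = x) (hy0 : C.τ y = 0 ∨ C.τ y = 1)
    (halone : ∀ m ∈ D, m ∈ P → x ∈ digitMap N m '' carpet N D → m = i) (k : ℕ) :
    D.card ^ k - 1 ≤ chi (hataGraph N D (k + 1)) := by
  rcases hy0 with hy0 | hy1
  · exact C.pow_le_chi_of_alone hN hF h hi hj hiP hjP hk ht hyz hx hy0 halone k
  · exact C.flipSnd.pow_le_chi_of_alone hN hF h hi hj hiP hjP hk
      (show N - 1 - C.td j = N - 1 - C.td i by rw [ht]) hyz.flipSnd hx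
      (show 1 - C.τ y = 0 by rw [hy1, sub_self]) halone k

/-- If the right and the left side have a single point in common, and it is not a corner, then
this point has a unique address on the right side. -/
theorem uniqueAddress_of_unique_pair (hN : 2 ≤ N) (hD : D.Nonempty) {y z : ℝ × ℝ}
    (hyz : C.Pair D y z) (huniq : ∀ y' z', C.Pair D y' z' → y' = y) (h0 : C.τ y ≠ 0)
    (h1 : C.τ y ≠ 1) : UniqueAddress N D y := by
  intro k v v' hv hv'
  have hkw := C.kw_eq_of_side (Or.inr hyz.2.2.1) hv hv'
  obtain ⟨a, ha, hav⟩ := hv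
  obtain ⟨b, hb, hbv⟩ := hv'
  obtain ⟨w, e, he, hew⟩ := exists_mem_cell hN hD k hyz.2.1
  have ha1 := (C.of_κ_wordMap_eq_one ha (by rw [hav, hyz.2.2.1])).2
  have hb1 := (C.of_κ_wordMap_eq_one hb (by rw [hbv, hyz.2.2.1])).2
  have he0 := (C.of_κ_wordMap_eq_zero he (by rw [hew, hyz.2.2.2.1])).2
  have hτ : C.swap.κ (wordMap N D k v a) = C.swap.κ (wordMap N D k w e) := by
    rw [hav, hew]; exact hyz.2.2.2.2
  have ha2 := C.τ_mem ha
  have he2 := C.τ_mem he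
  have hno : ∀ s ∈ carpet N D, C.κ s = 1 → C.τ s = C.τ e → (C.τ e = 0 ∨ C.τ e = 1) → False := by
    intro s hs hs1 hse h
    have := huniq s e ⟨hs, he, hs1, he0, hse⟩
    subst this
    rw [← hse] at h
    rcases h with h | h
    · exact h0 h
    · exact h1 h
  -- If `y` were the common end of two stacked cells, `e` would have height 0 or 1, and one of the
  -- two right corners would form with it a pair at that height.
  have key : ∀ s ∈ carpet N D, ∀ s' ∈ carpet N D, C.κ s = 1 → C.κ s' = 1 → C.τ s = 1 →
      C.τ s' = 0 → C.τ a = 0 ∨ C.τ a = 1 → False := by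
    intro s hs s' hs' h1 h2 h3 h4 h5
    have h6 := C.swap.κ_wordMap k v a
    have h7 := C.swap.κ_wordMap k w e
    rw [hτ, h7] at h6
    have h8 : C.τ e = 0 ∨ C.τ e = 1 := by
      rcases nat_add_unit_cases he2.1 he2.2 ha2.1 ha2.2 h6 with h | h | h
      · rw [h.2]; exact h5
      · exact Or.inr h.2.1
      · exact Or.inl h.2.1
    rcases h8 with h8 | h8
    · exact hno s' hs' h2 (h4.trans h8.symm) (Or.inl h8)
    · exact hno s hs h1 (h3.trans h8.symm) (Or.inr h8)
  rcases C.swap.word_cases ha hb (hav.trans hbv.symm) with h | h | h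
  · exact C.word_ext hkw h.1
  · exact (key a ha b hb ha1 hb1 h.2.1 h.2.2 (Or.inr h.2.1)).elim
  · exact (key b hb a ha hb1 ha1 h.2.2 h.2.1 (Or.inl h.2.1)).elim

/-- Fragility leaves one contact between opposite sides. At a corner, one of the two classes has
only one cell through `x`; away from the corners only `i` and `j` contain `x` and the contact has a
unique address. -/
theorem pow_le_chi_of_edge (hN : 2 ≤ N) (hF : IsConnected (carpet N D))
    (h : IsFragileAt N D P x) {i j : Fin N × Fin N} (hi : i ∈ D) (hj : j ∈ D) (hiP : i ∈ P)
    (hjP : j ∉ P) (hk : C.kd j = C.kd i + 1) (ht : C.td j = C.td i) {y z : ℝ × ℝ}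
    (hy : y ∈ carpet N D) (hz : z ∈ carpet N D) (hx : digitMap N i y = x)
    (hx' : digitMap N j z = x) (k : ℕ) :
    D.card ^ k - 1 ≤ chi (hataGraph N D (k + 1)) := by
  have hD : D.Nonempty := ⟨i, hi⟩
  have hyz : C.Pair D y z := by
    have h1 : C.κ y = 1 ∧ C.κ z = 0 := by
      rcases C.digit_cases hy hz (hx.trans hx'.symm) with h | h | h
      · omega
      · exact h.2
      · omega
    have h2 : C.τ y = C.τ z := by
      rcases C.td_cases hy hz (hx.trans hx'.symm) with h | h | h
      · exact h.2
      · omega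
      · omega
    exact ⟨hy, hz, h1.1, h1.2, h2⟩
  have huniq : ∀ y' z', C.Pair D y' z' → y' = y ∧ z' = z := by
    intro y' z' hyz'
    have h1 := hyz'.digitMap_eq hN hk ht
    have h2 := h.eq_of_touch i hi j hj hiP hjP y' hyz'.1 z' hyz'.2.1 h1
    exact ⟨digitMap_injective hN i (h2.trans hx.symm),
      digitMap_injective hN j ((h1.symm.trans h2).trans hx'.symm)⟩
  have hki := C.kd_lt i
  have hkj := C.kd_lt j
  have hkflip : C.flip.kd i = C.flip.kd j + 1 := by
    show N - 1 - C.kd i = N - 1 - C.kd j + 1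
    omega
  have hκm : ∀ m ∈ D, ∀ a ∈ carpet N D, digitMap N m a = x →
      (C.kd m = C.kd i ∧ C.κ a = 1) ∨ (C.kd m = C.kd j ∧ C.κ a = 0) := by
    intro m hm a ha ham
    rcases C.digit_cases ha hy (ham.trans hx.symm) with h' | h' | h'
    · exact Or.inl ⟨h'.1, by rw [h'.2, hyz.2.2.1]⟩
    · have := hyz.2.2.1
      rw [h'.2.2] at this
      norm_num at this
    · exact Or.inr ⟨by omega, h'.2.1⟩
  by_cases hcor : C.τ y = 0 ∨ C.τ y = 1
  · by_cases hA : ∀ m ∈ D, m ∈ P → x ∈ digitMap N m '' carpet N D → m = i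
    · exact C.pow_le_chi_of_alone' hN hF h hi hj hiP hjP hk ht hyz hx hcor hA k
    by_cases hB : ∀ m ∈ D, m ∉ P → x ∈ digitMap N m '' carpet N D → m = j
    · exact C.flip.pow_le_chi_of_alone' hN hF h.compl hj hi hjP (fun h => h hiP)
        hkflip ht.symm hyz.flip hx' (show C.τ z = 0 ∨ C.τ z = 1 from hyz.2.2.2.2 ▸ hcor) hB k
    exfalso
    -- Second cells through `x` in both classes would be neighbours in the adjacent row and touch at
    -- the other end of their common side, which is a second pair.
    push Not at hA hB
    obtain ⟨m, hm, hmP, ⟨a, ha, ham⟩, hmi⟩ := hA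
    obtain ⟨m', hm', hmP', ⟨b, hb, hbm⟩, hmj⟩ := hB
    have hmm : m ≠ m' := fun h => hmP' (h ▸ hmP)
    have hmj' : m ≠ j := fun h => hjP (h ▸ hmP)
    have hmi' : m' ≠ i := fun h => hmP' (h ▸ hiP)
    have hτm : ∀ m ∈ D, m ≠ i → m ≠ j → ∀ a ∈ carpet N D, digitMap N m a = x →
        (C.td i = C.td m + 1 ∧ C.τ a = 1 ∧ C.τ y = 0) ∨
          (C.td m = C.td i + 1 ∧ C.τ a = 0 ∧ C.τ y = 1) := by
      intro m hm hmi hmj a ha ham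
      rcases C.td_cases ha hy (ham.trans hx.symm) with h' | h' | h'
      · rcases hκm m hm a ha ham with h'' | h''
        · exact absurd (C.ext_digit _ _ h''.1 h'.1) hmi
        · exact absurd (C.ext_digit _ _ h''.1 (h'.1.trans ht.symm)) hmj
      · exact Or.inl h'
      · exact Or.inr h'
    have h3 : C.td m = C.td m' ∧ C.τ a = C.τ b ∧ C.τ a ≠ C.τ y := by
      rcases hτm m hm hmi hmj' a ha ham with h1 | h1 <;>
        rcases hτm m' hm' hmi' hmj b hb hbm with h2 | h2
      · exact ⟨by omega, by rw [h1.2.1, h2.2.1], by rw [h1.2.1, h1.2.2]; norm_num⟩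
      · have := h1.2.2.symm.trans h2.2.2
        norm_num at this
      · have := h1.2.2.symm.trans h2.2.2
        norm_num at this
      · exact ⟨by omega, by rw [h1.2.1, h2.2.1], by rw [h1.2.1, h1.2.2]; norm_num⟩
    rcases hκm m hm a ha ham with h1 | h1 <;> rcases hκm m' hm' b hb hbm with h2 | h2
    · exact hmm (C.ext_digit _ _ (h1.1.trans h2.1.symm) h3.1)
    · exact h3.2.2 (by rw [(huniq a b ⟨ha, hb, h1.2, h2.2, h3.2.1⟩).1])
    · exact h3.2.2 (by rw [h3.2.1, (huniq b a ⟨hb, ha, h2.2, h1.2, h3.2.1.symm⟩).1])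
    · exact hmm (C.ext_digit _ _ (h1.1.trans h2.1.symm) h3.1)
  · have hy0 : C.τ y ≠ 0 := fun h => hcor (Or.inl h)
    have hy1 : C.τ y ≠ 1 := fun h => hcor (Or.inr h)
    have hm : ∀ m ∈ D, x ∈ digitMap N m '' carpet N D → m = i ∨ m = j := by
      rintro m hm ⟨a, ha, ham⟩
      have htd : C.td m = C.td i := by
        rcases C.td_cases ha hy (ham.trans hx.symm) with h' | h' | h'
        · exact h'.1
        · exact absurd h'.2.2 hy0
        · exact absurd h'.2.2 hy1
      rcases hκm m hm a ha ham with h' | h'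
      · exact Or.inl (C.ext_digit _ _ h'.1 htd)
      · exact Or.inr (C.ext_digit _ _ h'.1 (htd.trans ht.symm))
    by_cases hp : ∃ p ∈ D, p ∈ P ∧ p ≠ i
    · obtain ⟨p, hp, hpP, hpi⟩ := hp
      refine h.compl.pow_le_chi hN hF hi hp (fun h => h hpP) hpi hy hx
        (C.uniqueAddress_of_unique_pair hN hD hyz (fun a b hab => (huniq a b hab).1) hy0 hy1)
        (fun m hmD hmP hmx => (hm m hmD hmx).resolve_right ?_) (fun h => h hiP) k
      rintro rfl
      exact hmP hjP
    by_cases hq : ∃ p ∈ D, p ∉ P ∧ p ≠ j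
    · obtain ⟨p, hp, hpP, hpj⟩ := hq
      refine h.pow_le_chi hN hF hj hp hpP hpj hz hx'
        (C.flip.uniqueAddress_of_unique_pair hN hD hyz.flip ?_
          (show C.τ z ≠ 0 from hyz.2.2.2.2 ▸ hy0) (show C.τ z ≠ 1 from hyz.2.2.2.2 ▸ hy1))
        (fun m hmD hmP hmx => (hm m hmD hmx).resolve_left ?_) hjP k
      · intro a b hab
        have h1 : 1 - C.κ a = 1 := hab.2.2.1
        have h2 : 1 - C.κ b = 0 := hab.2.2.2.1
        exact (huniq b a ⟨hab.2.1, hab.1, by linarith, by linarith, hab.2.2.2.2.symm⟩).2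
      · rintro rfl
        exact hmP hiP
    -- Now D = {i, j}, which forces N = 2. The pair is its own preimage under the digit maps, so 2τ
    -- = td + τ and the contact is at a corner.
    exfalso
    have hij : ∀ m ∈ D, m = i ∨ m = j := by
      intro m hm
      by_cases hmP : m ∈ P
      · left; by_contra hmi; exact hp ⟨m, hm, hmP, hmi⟩
      · right; by_contra hmj; exact hq ⟨m, hm, hmP, hmj⟩
    obtain ⟨m, hm, y', hy', hmy⟩ := exists_digitMap_eq hN hD hy
    obtain ⟨n, hn, z', hz', hnz⟩ := exists_digitMap_eq hN hD hz
    obtain ⟨hm1, hy'1⟩ := C.of_κ_map_eq_one hy' (by rw [hmy, hyz.2.2.1])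
    obtain ⟨hn0, hz'0⟩ := C.of_κ_map_eq_zero hz' (by rw [hnz, hyz.2.2.2.1])
    have hmj : m = j := by
      rcases hij m hm with rfl | rfl
      · omega
      · rfl
    have hni : n = i := by
      rcases hij n hn with rfl | rfl
      · rfl
      · omega
    subst hmj hni
    have h1 := C.τ_map m y'
    have h2 := C.τ_map n z'
    rw [hmy] at h1
    rw [hnz, ← hyz.2.2.2.2, ← ht] at h2
    have h3 := (huniq y' z' ⟨hy', hz', hy'1, hz'0, by linarith⟩).1
    rw [h3] at h1
    have hN2 : N = 2 := by omega
    have h4 := C.td_lt m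
    have h5 : (N : ℝ) = 2 := by rw [hN2]; norm_num
    rw [h5] at h1
    have h6 : C.τ y = C.td m := by linarith
    have h7 : C.td m = 0 ∨ C.td m = 1 := by omega
    rcases h7 with h7 | h7
    · exact hy0 (by rw [h6, h7]; simp)
    · exact hy1 (by rw [h6, h7]; simp)

theorem pow_le_chi_of_row (hN : 2 ≤ N) (hF : IsConnected (carpet N D))
    (h : IsFragileAt N D P x) {i j : Fin N × Fin N} (hi : i ∈ D) (hj : j ∈ D) (hiP : i ∈ P)
    (hjP : j ∉ P) (ht : C.td j = C.td i) {y z : ℝ × ℝ}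
    (hy : y ∈ carpet N D) (hz : z ∈ carpet N D) (hx : digitMap N i y = x)
    (hx' : digitMap N j z = x) (k : ℕ) :
    D.card ^ k - 1 ≤ chi (hataGraph N D (k + 1)) := by
  rcases C.digit_cases hy hz (hx.trans hx'.symm) with h' | h' | h'
  · exact absurd hiP (by rw [C.ext_digit _ _ h'.1 ht.symm]; exact hjP)
  · exact C.pow_le_chi_of_edge hN hF h hi hj hiP hjP h'.1 ht hy hz hx hx' k
  · have := C.kd_lt i
    exact C.flip.pow_le_chi_of_edge hN hF h hi hj hiP hjP
      (show N - 1 - C.kd j = N - 1 - C.kd i + 1 by omega) ht hy hz hx hx' k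

theorem kd_eq_or_eq {i j m : Fin N × Fin N} {y z a : ℝ × ℝ} (hy : y ∈ carpet N D)
    (hz : z ∈ carpet N D) (ha : a ∈ carpet N D) (hyz : digitMap N i y = digitMap N j z)
    (hay : digitMap N m a = digitMap N i y) (hij : C.kd i ≠ C.kd j) :
    (C.κ y = 0 ∨ C.κ y = 1) ∧ (C.kd m = C.kd i ∨ C.kd m = C.kd j) := by
  rcases C.digit_cases hy hz hyz with h | h | h
  · exact absurd h.1 hij
  · refine ⟨Or.inr h.2.1, ?_⟩
    rcases C.digit_cases ha hy hay with h' | h' | h'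
    · exact Or.inl h'.1
    · have := h.2.1.symm.trans h'.2.2
      norm_num at this
    · right; omega
  · refine ⟨Or.inl h.2.1, ?_⟩
    rcases C.digit_cases ha hy hay with h' | h' | h'
    · exact Or.inl h'.1
    · right; omega
    · have := h.2.1.symm.trans h'.2.2
      norm_num at this

end

end Chart

/-- A fragile carpet has Hata graphs with long tails. -/
theorem IsFragileAt.pow_sub_one_le_chi {N : ℕ} {D : Finset (Fin N × Fin N)}
    {P : Set (Fin N × Fin N)} {x : ℝ × ℝ} (h : IsFragileAt N D P x) (hN : 2 ≤ N)
    (hF : IsConnected (carpet N D)) (k : ℕ) :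
    D.card ^ k - 1 ≤ chi (hataGraph N D (k + 1)) := by
  obtain ⟨C⟩ : Nonempty (Chart N) := ⟨Chart.std hN⟩
  obtain ⟨i₀, hi₀, hi₀P⟩ := h.exists_mem
  obtain ⟨j₀, hj₀, hj₀P⟩ := h.exists_notMem
  have hD : D.Nonempty := ⟨i₀, hi₀⟩
  have htouch : ∃ i ∈ D, ∃ j ∈ D, i ∈ P ∧ j ∉ P ∧ ∃ y ∈ carpet N D, ∃ z ∈ carpet N D,
      digitMap N i y = digitMap N j z := by
    by_contra hno
    refine hj₀P ((digitGraph_preconnected hN hD hF ⟨i₀, hi₀⟩ ⟨j₀, hj₀⟩).induct_mem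
      (S := {d : D | (d : Fin N × Fin N) ∈ P}) ?_ hi₀P)
    rintro d e ⟨-, _, ⟨y, hy, rfl⟩, z, hz, hzy⟩ hd
    by_contra he
    exact hno ⟨d, d.2, e, e.2, hd, he, y, hy, z, hz, hzy.symm⟩
  obtain ⟨i, hi, j, hj, hiP, hjP, y, hy, z, hz, hyz⟩ := htouch
  have hx := h.eq_of_touch i hi j hj hiP hjP y hy z hz hyz
  by_cases hedge : ∃ i ∈ D, ∃ j ∈ D, i ∈ P ∧ j ∉ P ∧ x ∈ digitMap N i '' carpet N D ∧
      x ∈ digitMap N j '' carpet N D ∧ (C.td j = C.td i ∨ C.kd j = C.kd i)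
  · obtain ⟨i, hi, j, hj, hiP, hjP, ⟨y, hy, hx⟩, ⟨z, hz, hx'⟩, ht | ht⟩ := hedge
    · exact C.pow_le_chi_of_row hN hF h hi hj hiP hjP ht hy hz hx hx' k
    · exact C.swap.pow_le_chi_of_row hN hF h hi hj hiP hjP ht hy hz hx hx' k
  -- The classes now meet only diagonally at `x`, so just two cells contain `x`, each of them in a
  -- corner.
  push Not at hedge
  have hx' : digitMap N j z = x := hyz ▸ hx
  have hij := hedge i hi j hj hiP hjP ⟨y, hy, hx⟩ ⟨z, hz, hx'⟩
  have hm : ∀ m ∈ D, x ∈ digitMap N m '' carpet N D → m = i ∨ m = j := by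
    rintro m hm ⟨a, ha, hax⟩
    have h1 := (C.kd_eq_or_eq hy hz ha hyz (hax.trans hx.symm) hij.2.symm).2
    have h2 := (C.swap.kd_eq_or_eq hy hz ha hyz (hax.trans hx.symm) hij.1.symm).2
    by_cases hmP : m ∈ P
    · have h3 := hedge m hm j hj hmP hjP ⟨a, ha, hax⟩ ⟨z, hz, hx'⟩
      exact Or.inl (C.ext_digit _ _ (h1.resolve_right h3.2.symm) (h2.resolve_right h3.1.symm))
    · have h3 := hedge i hi m hm hiP hmP ⟨y, hy, hx⟩ ⟨a, ha, hax⟩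
      exact Or.inr (C.ext_digit _ _ (h1.resolve_left h3.2) (h2.resolve_left h3.1))
  have hyκ := (C.kd_eq_or_eq hy hz hy hyz rfl hij.2.symm).1
  have hyτ := (C.swap.kd_eq_or_eq hy hz hy hyz rfl hij.1.symm).1
  have hzκ := (C.kd_eq_or_eq hz hy hz hyz.symm rfl hij.2).1
  have hzτ := (C.swap.kd_eq_or_eq hz hy hz hyz.symm rfl hij.1).1
  by_cases hp : ∃ p ∈ D, p ∈ P ∧ p ≠ i
  · obtain ⟨p, hp, hpP, hpi⟩ := hp
    refine h.compl.pow_le_chi hN hF hi hp (fun h => h hpP) hpi hy hx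
      (C.uniqueAddress_of_corner hyκ hyτ)
      (fun m hmD hmP hmx => (hm m hmD hmx).resolve_right ?_) (fun h => h hiP) k
    rintro rfl
    exact hmP hjP
  by_cases hq : ∃ p ∈ D, p ∉ P ∧ p ≠ j
  · obtain ⟨p, hp, hpP, hpj⟩ := hq
    refine h.pow_le_chi hN hF hj hp hpP hpj hz hx' (C.uniqueAddress_of_corner hzκ hzτ)
      (fun m hmD hmP hmx => (hm m hmD hmx).resolve_left ?_) hjP k
    rintro rfl
    exact hmP hiP
  have hPi : ∀ m ∈ D, m ∈ P → m = i := by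
    intro m hm hmP
    by_contra hmi
    exact hp ⟨m, hm, hmP, hmi⟩
  have hPj : ∀ m ∈ D, m ∉ P → m = j := by
    intro m hm hmP
    by_contra hmi
    exact hq ⟨m, hm, hmP, hmi⟩
  obtain ⟨c, hc, hcy⟩ := C.exists_digit_fixing_corner hN hD hy hyκ hyτ
  refine h.pow_le_chi_of_corner C hN hF hi hj hiP hjP hPi hy hx hyκ hyτ (c := ⟨c, hc⟩) hcy ?_ k
  -- As D = {i, j}, the digit graph without `c` has at most one vertex.
  rintro ⟨⟨u, hu⟩, huc⟩ ⟨⟨v, hv⟩, hvc⟩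
  have huc' : u ≠ c := fun h => huc (Subtype.ext h)
  have hvc' : v ≠ c := fun h => hvc (Subtype.ext h)
  have huv : u = v := by
    by_cases hcP : c ∈ P <;> by_cases huP : u ∈ P <;> by_cases hvP : v ∈ P
    · exact (hPi u hu huP).trans (hPi v hv hvP).symm
    · exact absurd ((hPi u hu huP).trans (hPi c hc hcP).symm) huc'
    · exact absurd ((hPi v hv hvP).trans (hPi c hc hcP).symm) hvc'
    · exact (hPj u hu huP).trans (hPj v hv hvP).symm
    · exact (hPi u hu huP).trans (hPi v hv hvP).symm
    · exact absurd ((hPj v hv hvP).trans (hPj c hc hcP).symm) hvc'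
    · exact absurd ((hPj u hu huP).trans (hPj c hc hcP).symm) huc'
    · exact (hPj u hu huP).trans (hPj v hv hvP).symm
  subst huv
  exact SimpleGraph.Reachable.refl _

/-! ### Carpets that are not fragile: zooming in at a cut point. -/

/-- The open sets `u` and `v` separate the carpet without the point `x`. -/
structure Separates (N : ℕ) (D : Finset (Fin N × Fin N)) (x : ℝ × ℝ) (u v : Set (ℝ × ℝ)) :
    Prop where
  mem : x ∈ carpet N D
  isOpen_left : IsOpen u
  isOpen_right : IsOpen v
  cover : ∀ y ∈ carpet N D, y ≠ x → y ∈ u ∨ y ∈ v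
  disjoint : ∀ y ∈ carpet N D, y ≠ x → y ∈ u → y ∉ v
  left : ∃ y ∈ carpet N D, y ≠ x ∧ y ∈ u
  right : ∃ y ∈ carpet N D, y ≠ x ∧ y ∈ v

theorem IsCutPoint.exists_separates {N : ℕ} {D : Finset (Fin N × Fin N)} {x : ℝ × ℝ}
    (h : IsCutPoint (carpet N D) x) : ∃ u v, Separates N D x u v := by
  obtain ⟨hx, h⟩ := h
  unfold IsPreconnected at h
  push Not at h
  obtain ⟨u, v, hu, hv, hcov, ⟨y, hy, hyu⟩, ⟨z, hz, hzv⟩, hno⟩ := h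
  refine ⟨u, v, hx, hu, hv, fun y hy hyx => hcov ⟨hy, hyx⟩, fun y hy hyx hyu hyv => ?_,
    ⟨y, hy.1, hy.2, hyu⟩, ⟨z, hz.1, hz.2, hzv⟩⟩
  have : y ∈ (carpet N D \ {x}) ∩ (u ∩ v) := ⟨⟨hy, hyx⟩, hyu, hyv⟩
  rw [hno] at this
  exact this

namespace Separates

variable {N : ℕ} {D : Finset (Fin N × Fin N)} {x : ℝ × ℝ} {u v : Set (ℝ × ℝ)}

theorem symm (h : Separates N D x u v) : Separates N D x v u :=
  ⟨h.mem, h.isOpen_right, h.isOpen_left, fun y hy hyx => (h.cover y hy hyx).symm,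
    fun y hy hyx hyv hyu => h.disjoint y hy hyx hyu hyv, h.right, h.left⟩

theorem subset_or_subset (h : Separates N D x u v) {C : Set (ℝ × ℝ)} (hC : IsPreconnected C)
    (hCF : C ⊆ carpet N D) (hxC : x ∉ C) : C ⊆ u ∨ C ⊆ v := by
  have hne : ∀ y ∈ C, y ≠ x := fun y hy hyx => hxC (hyx ▸ hy)
  refine isPreconnected_iff_subset_of_disjoint.1 hC u v h.isOpen_left h.isOpen_right
    (fun y hy => h.cover y (hCF hy) (hne y hy)) ?_
  rw [Set.eq_empty_iff_forall_notMem]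
  rintro y ⟨hy, hyu, hyv⟩
  exact h.disjoint y (hCF hy) (hne y hy) hyu hyv

theorem image_subset_or (h : Separates N D x u v) (hN : 2 ≤ N) (hF : IsConnected (carpet N D))
    {i : Fin N × Fin N} (hi : i ∈ D) (hx : x ∉ digitMap N i '' carpet N D) :
    digitMap N i '' carpet N D ⊆ u ∨ digitMap N i '' carpet N D ⊆ v := by
  refine h.subset_or_subset
    (hF.isPreconnected.image _ (digitMap_continuous N i).continuousOn) ?_ hx
  rintro _ ⟨y, hy, rfl⟩
  exact digitMap_mem_carpet hN hi hy

/-- In a carpet that is not fragile, the separation persists in a cell of level one. -/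
theorem exists_zoom (h : Separates N D x u v) (hN : 2 ≤ N) (hF : IsConnected (carpet N D))
    (hnf : ∀ P x, ¬ IsFragileAt N D P x) :
    ∃ (i : D) (x' : ℝ × ℝ), digitMap N i x' = x ∧
      Separates N D x' (digitMap N i ⁻¹' u) (digitMap N i ⁻¹' v) := by
  by_contra hno
  have hD : D.Nonempty := by
    by_contra hD
    rw [Finset.not_nonempty_iff_eq_empty] at hD
    obtain ⟨y, hy⟩ := hF.nonempty
    have := Set.mem_iInter.1 hy 1
    simp [carpetApprox, hD] at this
  have pure : ∀ i ∈ D, ∀ y ∈ carpet N D, ∀ z ∈ carpet N D, digitMap N i y ≠ x →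
      digitMap N i z ≠ x → digitMap N i y ∈ u → digitMap N i z ∈ v → False := by
    intro i hi y hy z hz hyx hzx hyu hzv
    by_cases hxi : x ∈ digitMap N i '' carpet N D
    · obtain ⟨x', hx', rfl⟩ := hxi
      have hne : ∀ {a}, a ≠ x' → digitMap N i a ≠ digitMap N i x' :=
        fun h => (digitMap_injective hN i).ne h
      exact hno ⟨⟨i, hi⟩, x', rfl, hx', h.isOpen_left.preimage (digitMap_continuous N i),
        h.isOpen_right.preimage (digitMap_continuous N i),
        fun a ha hax => h.cover _ (digitMap_mem_carpet hN hi ha) (hne hax),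
        fun a ha hax => h.disjoint _ (digitMap_mem_carpet hN hi ha) (hne hax),
        ⟨y, hy, fun h => hyx (h ▸ rfl), hyu⟩, ⟨z, hz, fun h => hzx (h ▸ rfl), hzv⟩⟩
    · rcases h.image_subset_or hN hF hi hxi with h' | h'
      · exact h.disjoint _ (digitMap_mem_carpet hN hi hz) hzx (h' ⟨z, hz, rfl⟩) hzv
      · exact h.disjoint _ (digitMap_mem_carpet hN hi hy) hyx hyu (h' ⟨y, hy, rfl⟩)
  -- If no cell were split, the digits whose cells lie on the side `u` would form a fragile
  -- splitting at `x`.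
  refine hnf {i | ∀ y ∈ carpet N D, digitMap N i y ≠ x → digitMap N i y ∈ u} x ⟨?_, ?_, ?_⟩
  · obtain ⟨_, hy, hyx, hyu⟩ := h.left
    obtain ⟨i, hi, y, hyF, rfl⟩ := exists_digitMap_eq hN hD hy
    refine ⟨i, hi, fun z hz hzx => ?_⟩
    exact (h.cover _ (digitMap_mem_carpet hN hi hz) hzx).resolve_right
      fun hzv => pure i hi y hyF z hz hyx hzx hyu hzv
  · obtain ⟨_, hy, hyx, hyv⟩ := h.right
    obtain ⟨i, hi, y, hyF, rfl⟩ := exists_digitMap_eq hN hD hy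
    exact ⟨i, hi, fun h' => h.disjoint _ hy hyx (h' y hyF hyx) hyv⟩
  · intro i hi j hj hiP hjP y hy z hz hyz
    by_contra hyx
    have hju : ¬ ∀ y ∈ carpet N D, digitMap N j y ≠ x → digitMap N j y ∈ u := hjP
    push Not at hju
    obtain ⟨a, ha, hax, hau⟩ := hju
    have hav := (h.cover _ (digitMap_mem_carpet hN hj ha) hax).resolve_left hau
    refine pure j hj z hz a ha (hyz ▸ hyx) hax ?_ hav
    rw [← hyz]
    exact hiP y hy hyx

end Separates

/-- A separated point of the carpet together with the digits of its address, such that the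
separation persists in all the cells of this address and the address is unique. -/
structure IsCutSequence (N : ℕ) (D : Finset (Fin N × Fin N)) (w : ℕ → D) (x : ℕ → ℝ × ℝ)
    (u v : ℕ → Set (ℝ × ℝ)) : Prop where
  separates : ∀ n, Separates N D (x n) (u n) (v n)
  map_eq : ∀ n, digitMap N (w n) (x (n + 1)) = x n
  left_eq : ∀ n, u (n + 1) = digitMap N (w n) ⁻¹' u n
  right_eq : ∀ n, v (n + 1) = digitMap N (w n) ⁻¹' v n
  unique : ∀ n, ∀ m ∈ D, x n ∈ digitMap N m '' carpet N D → m = w n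

namespace Chart

open Classical in
/-- The number of coordinates of `x` which are equal to `0` or `1`. -/
noncomputable def sideCount {N : ℕ} (C : Chart N) (x : ℝ × ℝ) : ℕ :=
  (if C.κ x = 0 ∨ C.κ x = 1 then 1 else 0) + (if C.τ x = 0 ∨ C.τ x = 1 then 1 else 0)

theorem sideCount_le_two {N : ℕ} (C : Chart N) (x : ℝ × ℝ) : C.sideCount x ≤ 2 := by
  unfold sideCount
  split_ifs <;> omega

theorem side_of_map {N : ℕ} {D : Finset (Fin N × Fin N)} (C : Chart N) {i : Fin N × Fin N}
    {x : ℝ × ℝ} (hx : x ∈ carpet N D)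
    (h : C.κ (digitMap N i x) = 0 ∨ C.κ (digitMap N i x) = 1) : C.κ x = 0 ∨ C.κ x = 1 :=
  h.imp (fun h => (C.of_κ_map_eq_zero hx h).2) (fun h => (C.of_κ_map_eq_one hx h).2)

theorem side_of_ne {N : ℕ} {D : Finset (Fin N × Fin N)} (C : Chart N) {i m : Fin N × Fin N}
    {x y : ℝ × ℝ} (hx : x ∈ carpet N D) (hy : y ∈ carpet N D)
    (h : digitMap N m y = digitMap N i x) (hne : C.kd m ≠ C.kd i) :
    (C.κ x = 0 ∨ C.κ x = 1) ∧
      ¬ (C.κ (digitMap N i x) = 0 ∨ C.κ (digitMap N i x) = 1) := by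
  constructor
  · rcases C.digit_cases hy hx h with h' | h' | h'
    · exact absurd h'.1 hne
    · exact Or.inl h'.2.2
    · exact Or.inr h'.2.2
  · rintro (h' | h')
    · have h1 := (C.of_κ_map_eq_zero hx h').1
      have h2 := (C.of_κ_map_eq_zero hy (by rw [h, h'])).1
      omega
    · have h1 := (C.of_κ_map_eq_one hx h').1
      have h2 := (C.of_κ_map_eq_one hy (by rw [h, h'])).1
      omega

theorem sideCount_le_map {N : ℕ} {D : Finset (Fin N × Fin N)} (C : Chart N)
    {i : Fin N × Fin N} {x : ℝ × ℝ} (hx : x ∈ carpet N D) :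
    C.sideCount (digitMap N i x) ≤ C.sideCount x := by
  have h1 := C.side_of_map (i := i) hx
  have h2 : _ → (C.τ x = 0 ∨ C.τ x = 1) := C.swap.side_of_map (i := i) hx
  change (C.τ (digitMap N i x) = 0 ∨ C.τ (digitMap N i x) = 1) → _ at h2
  unfold sideCount
  split_ifs <;> first | omega | tauto

theorem sideCount_lt_map {N : ℕ} {D : Finset (Fin N × Fin N)} (C : Chart N)
    {i m : Fin N × Fin N} {x y : ℝ × ℝ} (hx : x ∈ carpet N D) (hy : y ∈ carpet N D)
    (h : digitMap N m y = digitMap N i x) (hne : m ≠ i) :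
    C.sideCount (digitMap N i x) < C.sideCount x := by
  have h1 := C.side_of_map (i := i) hx
  have h2 : _ → (C.τ x = 0 ∨ C.τ x = 1) := C.swap.side_of_map (i := i) hx
  change (C.τ (digitMap N i x) = 0 ∨ C.τ (digitMap N i x) = 1) → _ at h2
  by_cases hk : C.kd m = C.kd i
  · have ht : C.td m ≠ C.td i := fun h' => hne (C.ext_digit _ _ hk h')
    obtain ⟨h3, h4⟩ := C.swap.side_of_ne hx hy h ht
    change C.τ x = 0 ∨ C.τ x = 1 at h3
    change ¬ (C.τ (digitMap N i x) = 0 ∨ C.τ (digitMap N i x) = 1) at h4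
    unfold sideCount
    rw [if_pos h3, if_neg h4]
    split_ifs <;> first | omega | tauto
  · obtain ⟨h3, h4⟩ := C.side_of_ne hx hy h hk
    unfold sideCount
    rw [if_pos h3, if_neg h4]
    split_ifs <;> first | omega | tauto

end Chart

/-- The separated point is chosen with the maximal side count. Zooming in never lowers this count
and raises it at a point of two cells; hence no point of the sequence lies in two cells of level
one. -/
theorem exists_isCutSequence {N : ℕ} (hN : 2 ≤ N) {D : Finset (Fin N × Fin N)}
    (hF : IsConnected (carpet N D)) (hnf : ∀ P x, ¬ IsFragileAt N D P x)
    (hcut : ∃ x, IsCutPoint (carpet N D) x) : ∃ w x u v, IsCutSequence N D w x u v := by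
  classical
  obtain ⟨C⟩ : Nonempty (Chart N) := ⟨Chart.std hN⟩
  let T := {s : (ℝ × ℝ) × Set (ℝ × ℝ) × Set (ℝ × ℝ) // Separates N D s.1 s.2.1 s.2.2}
  have hT : Nonempty T := by
    obtain ⟨x, hx⟩ := hcut
    obtain ⟨u, v, h⟩ := hx.exists_separates
    exact ⟨⟨(x, u, v), h⟩⟩
  obtain ⟨s₀, hs₀⟩ : ∃ s₀ : T, ∀ s : T, C.sideCount s.1.1 ≤ C.sideCount s₀.1.1 := by
    have hex : ∃ n, ∃ s : T, 2 - C.sideCount s.1.1 = n := ⟨_, hT.some, rfl⟩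
    obtain ⟨s₀, h0⟩ := Nat.find_spec hex
    refine ⟨s₀, fun s => ?_⟩
    have h1 := Nat.find_min' hex ⟨s, rfl⟩
    have h2 := C.sideCount_le_two s.1.1
    have h3 := C.sideCount_le_two s₀.1.1
    omega
  let M := {s : T // ∀ s' : T, C.sideCount s'.1.1 ≤ C.sideCount s.1.1}
  have step : ∀ s : M, ∃ (i : D) (s' : M), digitMap N i s'.1.1.1 = s.1.1.1 ∧
      s'.1.1.2.1 = digitMap N i ⁻¹' s.1.1.2.1 ∧ s'.1.1.2.2 = digitMap N i ⁻¹' s.1.1.2.2 ∧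
      ∀ m ∈ D, s.1.1.1 ∈ digitMap N m '' carpet N D → m = i := by
    rintro ⟨⟨⟨x, u, v⟩, h⟩, hmax⟩
    obtain ⟨i, x', hx, h'⟩ := h.exists_zoom hN hF hnf
    change digitMap N i x' = x at hx
    have hle : C.sideCount x ≤ C.sideCount x' := by
      simpa only [hx] using C.sideCount_le_map (i := i) h'.mem
    refine ⟨i, ⟨⟨(x', _, _), h'⟩, fun s' => (hmax s').trans hle⟩, hx, rfl, rfl, ?_⟩
    rintro m hm ⟨y, hy, hyx⟩
    by_contra hne
    have hlt := C.sideCount_lt_map h'.mem hy (hyx.trans hx.symm) hne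
    rw [hx] at hlt
    have := hmax ⟨(x', _, _), h'⟩
    exact absurd this (not_le.2 hlt)
  choose f g h1 h2 h3 h4 using step
  let S : ℕ → M := fun n => Nat.rec ⟨s₀, hs₀⟩ (fun _ s => g s) n
  exact ⟨fun n => f (S n), fun n => (S n).1.1.1, fun n => (S n).1.1.2.1, fun n => (S n).1.1.2.2,
    fun n => (S n).1.2, fun n => h1 (S n), fun n => h2 (S n), fun n => h3 (S n),
    fun n => h4 (S n)⟩

namespace IsCutSequence

variable {N : ℕ} {D : Finset (Fin N × Fin N)} {w : ℕ → D} {x : ℕ → ℝ × ℝ}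
  {u v : ℕ → Set (ℝ × ℝ)}

theorem symm (h : IsCutSequence N D w x u v) : IsCutSequence N D w x v u :=
  ⟨fun n => (h.separates n).symm, h.map_eq, h.right_eq, h.left_eq, h.unique⟩

theorem eq_of_mem_cell (h : IsCutSequence N D w x u v) (hN : 2 ≤ N) {k n : ℕ} {t : Fin k → D}
    (ht : x n ∈ cell N D k t) (m : Fin k) : t m = w (n + m) := by
  induction k generalizing n with
  | zero => exact m.elim0
  | succ k ih =>
    rw [cell_succ] at ht
    obtain ⟨y, hy, hyx⟩ := ht
    have h0 : t 0 = w n :=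
      Subtype.ext (h.unique n _ (t 0).2 ⟨y, cell_subset_carpet hN D _ _ hy, hyx⟩)
    rw [h0, ← h.map_eq n] at hyx
    rw [digitMap_injective hN _ hyx] at hy
    refine Fin.cases (by simpa using h0) (fun m => ?_) m
    have := ih hy m
    rw [Fin.tail] at this
    rw [this, Fin.val_succ]
    congr 1
    omega

theorem image_subset_or (h : IsCutSequence N D w x u v) (hN : 2 ≤ N)
    (hF : IsConnected (carpet N D)) (n : ℕ) {i : Fin N × Fin N} (hi : i ∈ D) (hne : i ≠ w n) :
    digitMap N i '' carpet N D ⊆ u n ∨ digitMap N i '' carpet N D ⊆ v n :=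
  (h.separates n).image_subset_or hN hF hi fun hx => hne (h.unique n i hi hx)

/-- By uniqueness of the address only one word of each length has `x n` in its cell; every other
cell is connected off `x n` and lies on one side. -/
theorem pow_le_chi (h : IsCutSequence N D w x u v) (hN : 2 ≤ N) (hF : IsConnected (carpet N D))
    {n : ℕ} {p q : D} (hp : p ≠ w n) (hq : q ≠ w n) (hpu : digitMap N p '' carpet N D ⊆ u n)
    (hqv : digitMap N q '' carpet N D ⊆ v n) (k : ℕ) :
    D.card ^ k ≤ chi (hataGraph N D (k + 1)) := by
  have hD : D.Nonempty := ⟨p, p.2⟩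
  obtain ⟨t, ht⟩ := exists_mem_cell hN hD (k + 1) (h.separates n).mem
  have ht0 : t 0 = w n := h.eq_of_mem_cell hN ht 0
  have hcell : ∀ s : Fin (k + 1) → D, cell N D (k + 1) s ⊆ digitMap N (s 0) '' carpet N D := by
    intro s
    rw [cell_succ]
    exact Set.image_mono (cell_subset_carpet hN D _ _)
  refine pow_le_chi_of_separation hN hF t {s | cell N D (k + 1) s ⊆ u n} ?_ (p := p) (p' := q)
    (ht0 ▸ hp) (ht0 ▸ hq) ?_ ?_
  · rintro a b - hb ⟨-, y, hya, hyb⟩ ha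
    have hx : x n ∉ cell N D (k + 1) b := by
      intro hxb
      apply hb
      funext m
      rw [h.eq_of_mem_cell hN hxb m, h.eq_of_mem_cell hN ht m]
    refine ((h.separates n).subset_or_subset (isConnected_cell hF _ b).isPreconnected
      (cell_subset_carpet hN D _ b) hx).resolve_right fun hbv => ?_
    exact (h.separates n).disjoint y (cell_subset_carpet hN D _ b hyb)
      (fun hyx => hx (hyx ▸ hyb)) (ha hya) (hbv hyb)
  · rintro s rfl
    exact (hcell s).trans hpu
  · rintro s rfl hs
    obtain ⟨y, hy⟩ := (isConnected_cell hF (k + 1) s).nonempty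
    refine (h.separates n).disjoint y (cell_subset_carpet hN D _ s hy) ?_ (hs hy)
      (hqv (hcell s hy))
    rintro rfl
    exact hq (Subtype.ext (h.unique n _ (s 0).2 (hcell s hy)))

/-- The cells of level one beside the address cannot belong to the same side at all levels. -/
theorem exists_not_subset (h : IsCutSequence N D w x u v) (hN : 2 ≤ N) (n₀ : ℕ) :
    ∃ n ≥ n₀, ¬ ∀ i ∈ D, i ≠ w n → digitMap N i '' carpet N D ⊆ u n := by
  by_contra hno
  push Not at hno
  have hD : D.Nonempty := ⟨w 0, (w 0).2⟩
  -- The side `v` is confined to the cells of the address, hence to arbitrarily small neighbourhoods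
  -- of `x n`.
  have key : ∀ k n, n₀ ≤ n → ∀ y ∈ carpet N D, y ≠ x n → y ∈ v n →
      dist y (x n) ≤ ((N : ℝ)⁻¹) ^ k := by
    intro k
    induction k with
    | zero =>
      intro n _ y hy _ _
      refine dist_le_of_mem_cell (N := N) (D := D) (w := Fin.elim0) ?_ ?_
      · rwa [cell_zero]
      · rw [cell_zero]; exact (h.separates n).mem
    | succ k ih =>
      intro n hn _ hyF hyx hyv
      obtain ⟨i, hi, y, hy, rfl⟩ := exists_digitMap_eq hN hD hyF
      have hiw : i = w n := by
        by_contra hne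
        exact (h.separates n).disjoint _ hyF hyx (hno n hn i hi hne ⟨y, hy, rfl⟩) hyv
      subst hiw
      rw [← h.map_eq n, dist_digitMap, pow_succ, mul_comm]
      refine mul_le_mul_of_nonneg_right (ih (n + 1) (by omega) y hy ?_ ?_) (by positivity)
      · rintro rfl; exact hyx (h.map_eq n)
      · rw [h.right_eq n]; exact hyv
  obtain ⟨y, hy, hyx, hyv⟩ := (h.separates n₀).right
  have := ge_of_tendsto' (tendsto_inv_pow hN) fun k => key k n₀ le_rfl y hy hyx hyv
  exact hyx (dist_le_zero.1 this)

/-- While all cells beside the address lie on the side `v`, the side `u` has room only along the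
address. -/
theorem mem_cell_of_subset (h : IsCutSequence N D w x u v) (hN : 2 ≤ N) (k : ℕ) :
    ∀ n, (∀ j < k, ∀ i ∈ D, i ≠ w (n + j) → digitMap N i '' carpet N D ⊆ v (n + j)) →
      ∀ y ∈ carpet N D, y ≠ x n → y ∈ u n → y ∈ cell N D k (fun j => w (n + j)) := by
  have hD : D.Nonempty := ⟨w 0, (w 0).2⟩
  induction k with
  | zero => intro n _ y hy _ _; rwa [cell_zero]
  | succ k ih =>
    intro n hv _ hyF hyx hyu
    obtain ⟨i, hi, y, hy, rfl⟩ := exists_digitMap_eq hN hD hyF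
    have hiw : i = w n := by
      by_contra hne
      exact (h.separates n).disjoint _ hyF hyx hyu
        (hv 0 (by omega) i hi hne ⟨y, hy, rfl⟩)
    subst hiw
    rw [cell_succ]
    refine ⟨y, ?_, rfl⟩
    have htail : Fin.tail (fun j : Fin (k + 1) => w (n + j)) =
        fun j : Fin k => w (n + 1 + j) := by
      funext j
      rw [Fin.tail, Fin.val_succ]
      congr 1
      omega
    rw [htail]
    refine ih (n + 1) (fun j hj => ?_) y hy ?_ ?_
    · have := hv (j + 1) (by omega)
      rwa [show n + (j + 1) = n + 1 + j by omega] at this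
    · rintro rfl; exact hyx (h.map_eq n)
    · rw [h.left_eq n]; exact hyu

theorem exists_pow_le_chi (h : IsCutSequence N D w x u v) (hN : 2 ≤ N)
    (hF : IsConnected (carpet N D)) (hD2 : D.card < N ^ 2)
    (hnd : ∀ a ∈ D, ∀ y, ∃ y' ∈ touchSet N D a, y' ≠ y) (k : ℕ) :
    D.card ^ k ≤ chi (hataGraph N D (k + 1)) := by
  by_contra hk
  have hD : D.Nonempty := ⟨w 0, (w 0).2⟩
  let A : ℕ → Prop := fun n => ∀ i ∈ D, i ≠ w n → digitMap N i '' carpet N D ⊆ u n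
  let B : ℕ → Prop := fun n => ∀ i ∈ D, i ≠ w n → digitMap N i '' carpet N D ⊆ v n
  have hAB : ∀ n, ¬ A n → B n := by
    intro n hA i hi hiw
    have hA' : ∃ p ∈ D, p ≠ w n ∧ ¬ digitMap N p '' carpet N D ⊆ u n := by
      by_contra hno
      push Not at hno
      exact hA hno
    obtain ⟨p, hp, hpw, hpu⟩ := hA'
    have hpv := (h.image_subset_or hN hF n hp hpw).resolve_left hpu
    refine (h.image_subset_or hN hF n hi hiw).resolve_left fun hiu => hk ?_
    exact h.pow_le_chi hN hF (n := n) (p := ⟨i, hi⟩) (q := ⟨p, hp⟩)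
      (fun h => hiw (congrArg Subtype.val h)) (fun h => hpw (congrArg Subtype.val h)) hiu hpv k
  have hA : ∀ n₀, ∃ n ≥ n₀, A n := by
    intro n₀
    obtain ⟨n, hn, hB⟩ := h.symm.exists_not_subset hN n₀
    exact ⟨n, hn, by_contra fun hA => hB (hAB n hA)⟩
  -- A level with `A` is followed by a run of l+1 levels with `B`, and then by `A` again.
  obtain ⟨n, hAn, hAn1⟩ : ∃ n, A n ∧ ¬ A (n + 1) := by
    by_contra hno
    push Not at hno
    obtain ⟨n₀, -, h0⟩ := hA 0
    obtain ⟨n, hn, hnA⟩ := h.exists_not_subset hN n₀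
    exact hnA (Nat.le_induction h0 (fun m _ => hno m) n hn)
  have hex : ∃ j, A (n + 1 + j) := by
    obtain ⟨m, hm, hAm⟩ := hA (n + 1)
    exact ⟨m - (n + 1), by rwa [Nat.add_sub_cancel' hm]⟩
  classical
  obtain ⟨l, hl⟩ : ∃ l, Nat.find hex = l + 1 := by
    refine Nat.exists_eq_succ_of_ne_zero fun h0 => hAn1 ?_
    have := Nat.find_spec hex
    rwa [h0] at this
  have hAl : A (n + 1 + (l + 1)) := hl ▸ Nat.find_spec hex
  have hBj : ∀ j < l + 1, B (n + 1 + j) := fun j hj =>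
    hAB _ (Nat.find_min hex (by omega))
  -- The contacts of `w n` lie on the side `u`, which the run of `B` confines to its word; those of
  -- the last letter of this word lie on the side `v`, which the next `A` confines to the next
  -- digit.
  refine not_pinched_pinched hN hD2 hnd (w n).2 (w (n + 1 + (l + 1))).2
    (fun j : Fin (l + 1) => w (n + 1 + j)) ?_ ?_
  · rintro y ⟨hy, i, hi, hiw, z, hz, hzy⟩
    refine h.mem_cell_of_subset hN (l + 1) (n + 1) hBj y hy ?_ ?_
    · rintro rfl
      rw [h.map_eq n] at hzy
      exact hiw (h.unique n i hi ⟨z, hz, hzy⟩)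
    · rw [h.left_eq n]
      exact hAn i hi hiw ⟨z, hz, hzy⟩
  · rw [Fin.val_last]
    rintro y ⟨hy, i, hi, hiw, z, hz, hzy⟩
    have hyx : y ≠ x (n + 1 + l + 1) := by
      rintro rfl
      rw [h.map_eq] at hzy
      exact hiw (h.unique _ i hi ⟨z, hz, hzy⟩)
    have hyv : y ∈ v (n + 1 + l + 1) := by
      rw [h.right_eq]
      exact hBj l (by omega) i hi hiw ⟨z, hz, hzy⟩
    obtain ⟨j, hj, y', hy', rfl⟩ := exists_digitMap_eq hN hD hy
    have hjw : j = w (n + 1 + (l + 1)) := by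
      by_contra hne
      exact (h.separates _).disjoint _ hy hyx (hAl j hj hne ⟨y', hy', rfl⟩) hyv
    exact ⟨y', hy', by rw [← hjw]⟩

end IsCutSequence

/-! ### Conclusion. -/

/-- If a carpet is not fragile, then every cell of level one is touched in two points. -/
theorem exists_ne_mem_touchSet {N : ℕ} {D : Finset (Fin N × Fin N)} (hD1 : 1 < D.card)
    (hnf : ∀ P x, ¬ IsFragileAt N D P x) {a : Fin N × Fin N} (ha : a ∈ D) (y : ℝ × ℝ) :
    ∃ y' ∈ touchSet N D a, y' ≠ y := by
  by_contra hno
  push Not at hno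
  obtain ⟨b, hb, hba⟩ := Finset.exists_mem_ne hD1 a
  -- A cell with at most one contact would by itself be a class of a fragile splitting.
  refine hnf {a} (digitMap N a y) ⟨⟨a, ha, rfl⟩, ⟨b, hb, hba⟩, ?_⟩
  rintro i - j hj rfl hji z hz z' hz' hzz
  rw [hno z ⟨hz, j, hj, hji, z', hz', hzz.symm⟩]

theorem pow_sub_one_le_chi_of_isCutPoint {N : ℕ} (hN : 2 ≤ N) {D : Finset (Fin N × Fin N)}
    (hD1 : 1 < D.card) (hD2 : D.card < N ^ 2) (hF : IsConnected (carpet N D))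
    (hcut : ∃ x, IsCutPoint (carpet N D) x) (k : ℕ) :
    D.card ^ k - 1 ≤ chi (hataGraph N D (k + 1)) := by
  by_cases hf : ∃ P x, IsFragileAt N D P x
  · obtain ⟨P, x, h⟩ := hf
    exact h.pow_sub_one_le_chi hN hF k
  · push Not at hf
    obtain ⟨w, x, u, v, h⟩ := exists_isCutSequence hN hF hf hcut
    exact (Nat.sub_le _ _).trans
      (h.exists_pow_le_chi hN hF hD2 (fun a ha y => exists_ne_mem_touchSet hD1 hf ha y) k)

theorem theorem1p3 (N : ℕ) (hN : 2 ≤ N) (D : Finset (Fin N × Fin N))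
    (hD1 : 1 < D.card) (hD2 : D.card < N ^ 2) (hF : IsConnected (carpet N D)) :
    (∃ x, IsCutPoint (carpet N D) x) ↔
      ∀ k : ℕ, 2 ≤ k → D.card ^ (k - 1) - 1 ≤ chi (hataGraph N D k) := by
  constructor
  · intro hcut k hk
    obtain ⟨k, rfl⟩ : ∃ m, k = m + 1 := ⟨k - 1, by omega⟩
    exact pow_sub_one_le_chi_of_isCutPoint hN hD1 hD2 hF hcut k
  · exact exists_isCutPoint_of_le_chi hN hD1 hF
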